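/- Let $n\ge 2$, let $\Omega\subset\mathbb R^n$ be a bounded domain, and let $1<p\le q<\infty$, $0<s\le t<1$, $\Lambda>1$, $\alpha>0$. Let $K_{sp},K_{tq}:\mathbb R^n\times\mathbb R^n\to\mathbb R$ be measurable and symmetric with $$\frac{\Lambda^{-1}}{|x-y|^{n+sp}}\le K_{sp}(x,y)\le\frac{\Lambda}{|x-y|^{n+sp}},\qquad \frac{\Lambda^{-1}}{|x-y|^{n+tq}}\le K_{tq}(x,y)\le\frac{\Lambda}{|x-y|^{n+tq}}$$ for a.e. $(x,y)$. Let $a:\mathbb R^n\times\mathbb R^n\to\mathbb R$ be measurable and symmetric with $0\le a(x,y)\le A$ for all $x,y$, and $$|a(x_1,y_1)-a(x_2,y_2)|\le L\,(|x_1-x_2|+|y_1-y_2|)^\alpha\quad\text{for all }(x_1,y_1),(x_2,y_2)\in\mathbb R^n\times\mathbb R^n,$$ with constants $A,L$. Put $\mathcal C_\Omega=(\mathbb R^n\times\mathbb R^n)\setminus((\mathbb R^n\setminus\Omega)\times(\mathbb R^n\setminus\Omega))$ and $H(x,y,\tau)=\frac{\tau^p}{|x-y|^{sp}}+a(x,y)\frac{\tau^q}{|x-y|^{tq}}$.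 Let $\mathcal A(\Omega)$ be the set of measurable $v:\mathbb R^n\to\mathbb R$ with $v|_\Omega\in L^p(\Omega)$ and $\iint_{\mathcal C_\Omega}H(x,y,|v(x)-v(y)|)\frac{dx\,dy}{|x-y|^n}<\infty$, and let $L^{q-1}_{sp}(\mathbb R^n)$ be the set of measurable $v:\mathbb R^n\to\mathbb R$ with $\int_{\mathbb R^n}\frac{|v(x)|^{q-1}}{(1+|x|)^{n+sp}}dx<\infty$. A function $u\in\mathcal A(\Omega)$ is called a weak solution if $$\iint_{\mathcal C_\Omega}\Big[|u(x)-u(y)|^{p-2}(u(x)-u(y))(\varphi(x)-\varphi(y))K_{sp}(x,y)+a(x,y)|u(x)-u(y)|^{q-2}(u(x)-u(y))(\varphi(x)-\varphi(y))K_{tq}(x,y)\Big]dx\,dy=0$$ for every $\varphi\in\mathcal A(\Omega)$ with $\varphi=0$ a.e. in $\mathbb R^n\setminus\Omega$. Assume that $tq\le sp+\alpha$. Then every weak solution $u\in\mathcal A(\Omega)\cap L^{q-1}_{sp}(\mathbb R^n)$ which is locally (essentially) bounded in $\Omega$ is, after modification on a null set, locally Hölder continuous in $\Omega$. More precisely,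 for every open $\Omega'\Subset\Omega$ there is $\gamma\in(0,1)$, depending only on $n,s,t,p,q,\Lambda,A,\alpha,L$ and (an upper bound for) $\|u\|_{L^\infty(\Omega')}$, such that $u\in C^{0,\gamma}_{\rm loc}(\Omega')$, that is, $u$ is $\gamma$-Hölder continuous on every compact subset of $\Omega'$. -/

import Mathlib

open MeasureTheory Set
open scoped NNReal ENNReal

noncomputable section

namespace DoublePhase

/-- The Euclidean space `ℝⁿ`. -/
abbrev E (n : ℕ) : Type := EuclideanSpace ℝ (Fin n)

/-- `𝒞_Ω = (ℝⁿ × ℝⁿ) \ ((ℝⁿ \ Ω) × (ℝⁿ \ Ω))`. -/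
def crossSet {n : ℕ} (Ω : Set (E n)) : Set (E n × E n) := (Ωᶜ ×ˢ Ωᶜ)ᶜ

/-- `K` is a measurable symmetric kernel of order `(s, p)` with ellipticity constant `Λ`. -/
structure IsKernel {n : ℕ} (s p Λ : ℝ) (K : E n → E n → ℝ) : Prop where
  aemeasurable : AEMeasurable (fun z : E n × E n => K z.1 z.2) volume
  symm : ∀ x y, K x y = K y x
  bounds : ∀ᵐ z : E n × E n,
    Λ⁻¹ / ‖z.1 - z.2‖ ^ ((n : ℝ) + s * p) ≤ K z.1 z.2 ∧
      K z.1 z.2 ≤ Λ / ‖z.1 - z.2‖ ^ ((n : ℝ) + s * p)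

/-- `a` is a nonnegative, measurable, symmetric modulating coefficient, bounded by `A`. -/
structure IsCoefficient {n : ℕ} (A : ℝ) (a : E n → E n → ℝ) : Prop where
  aemeasurable : AEMeasurable (fun z : E n × E n => a z.1 z.2) volume
  symm : ∀ x y, a x y = a y x
  nonneg : ∀ x y, 0 ≤ a x y
  le_bound : ∀ x y, a x y ≤ A

/-- `|a(x₁,y₁) - a(x₂,y₂)| ≤ L (|x₁-x₂| + |y₁-y₂|)^α` on `ℝⁿ × ℝⁿ`. -/
def IsHolderCoefficient {n : ℕ} (α L : ℝ) (a : E n → E n → ℝ) : Prop :=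
  ∀ x₁ y₁ x₂ y₂ : E n, |a x₁ y₁ - a x₂ y₂| ≤ L * (‖x₁ - x₂‖ + ‖y₁ - y₂‖) ^ α

/-- `H(x,y,τ) = τ^p / |x-y|^{sp} + a(x,y) τ^q / |x-y|^{tq}`, for `τ ≥ 0`. -/
def H {n : ℕ} (s t p q : ℝ) (a : E n → E n → ℝ) (x y : E n) (τ : ℝ) : ℝ :=
  τ ^ p / ‖x - y‖ ^ (s * p) + a x y * (τ ^ q / ‖x - y‖ ^ (t * q))

/-- The energy space `𝒜(Ω)`: measurable `v : ℝⁿ → ℝ` with `v|_Ω ∈ L^p(Ω)` and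
`∬_{𝒞_Ω} H(x,y,|v(x)-v(y)|) dx dy / |x-y|ⁿ < ∞`. -/
structure MemA {n : ℕ} (s t p q : ℝ) (a : E n → E n → ℝ) (Ω : Set (E n)) (v : E n → ℝ) :
    Prop where
  aemeasurable : AEMeasurable v volume
  memLp : MemLp v (ENNReal.ofReal p) (volume.restrict Ω)
  energy_lt_top :
    ∫⁻ z in crossSet Ω,
      ENNReal.ofReal (H s t p q a z.1 z.2 |v z.1 - v z.2| / ‖z.1 - z.2‖ ^ (n : ℝ)) < ∞

/-- The tail space `L^{q-1}_{sp}(ℝⁿ)`: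
measurable `v` with `∫ |v(x)|^{q-1} / (1+|x|)^{n+sp} dx < ∞`. -/
structure MemTail {n : ℕ} (s p q : ℝ) (v : E n → ℝ) : Prop where
  aemeasurable : AEMeasurable v volume
  tail_lt_top :
    ∫⁻ x : E n, ENNReal.ofReal (|v x| ^ (q - 1) / (1 + ‖x‖) ^ ((n : ℝ) + s * p)) < ∞

/-- The integrand of the weak formulation at the pair `z = (x, y)`. -/
def weakIntegrand {n : ℕ} (p q : ℝ) (a Ksp Ktq : E n → E n → ℝ) (u φ : E n → ℝ)
    (z : E n × E n) : ℝ :=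
  |u z.1 - u z.2| ^ (p - 2) * (u z.1 - u z.2) * (φ z.1 - φ z.2) * Ksp z.1 z.2
    + a z.1 z.2 * |u z.1 - u z.2| ^ (q - 2) * (u z.1 - u z.2) * (φ z.1 - φ z.2) * Ktq z.1 z.2

/-- `u ∈ 𝒜(Ω)` is a weak solution of `ℒ u = 0` in `Ω`: for every `φ ∈ 𝒜(Ω)` vanishing a.e. outside
`Ω`, the weak form over `𝒞_Ω` (an absolutely convergent integral) is zero. -/
structure IsWeakSolution {n : ℕ} (s t p q : ℝ) (a Ksp Ktq : E n → E n → ℝ) (Ω : Set (E n))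
    (u : E n → ℝ) : Prop where
  memA : MemA s t p q a Ω u
  weak_form : ∀ φ : E n → ℝ, MemA s t p q a Ω φ → (∀ᵐ x : E n, x ∉ Ω → φ x = 0) →
    IntegrableOn (weakIntegrand p q a Ksp Ktq u φ) (crossSet Ω) volume ∧
      ∫ z in crossSet Ω, weakIntegrand p q a Ksp Ktq u φ z = 0

/-- `u ∈ L^∞_loc(Ω)`. -/
def IsLocallyBounded {n : ℕ} (Ω : Set (E n)) (u : E n → ℝ) : Prop :=
  ∀ K : Set (E n), IsCompact K → K ⊆ Ω → eLpNorm u ∞ (volume.restrict K) < ∞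

/-- `f ∈ C^{0,γ}_loc(U)`: `f` is `γ`-Hölder continuous on every compact subset of `U`. -/
def HolderLoc {n : ℕ} (γ : ℝ≥0) (U : Set (E n)) (f : E n → ℝ) : Prop :=
  ∀ K : Set (E n), IsCompact K → K ⊆ U → ∃ C : ℝ≥0, HolderOnWith C γ f K

/-- `f` is locally Hölder continuous in `U`: on every compact subset of `U` it is Hölder
continuous, with some exponent in `(0, 1)` (which may depend on the compact set). -/
def LocallyHolder {n : ℕ} (U : Set (E n)) (f : E n → ℝ) : Prop :=
  ∀ K : Set (E n), IsCompact K → K ⊆ U →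
    ∃ γ : ℝ≥0, 0 < γ ∧ γ < 1 ∧ ∃ C : ℝ≥0, HolderOnWith C γ f K

end DoublePhase

end

/-!
The proof is De Giorgi's method in a form that uses neither a Sobolev inequality nor a logarithmic
estimate: the nonlocal interaction itself controls the measure of level sets.

*Testing with a barrier.* Let `u ≥ 0` in `B_R(x₀)`, let `ψ` be a Lipschitz barrier of height `k`
supported in `B_r(x₀)`, `2r ≤ R`, and test the equation with `(ψ - u)₊`. For a pair `(x, y)` with
`u < ψ` at `x` and `u ≥ ψ` at `y`, the integrand has a favourable sign and is at least
`(ψ x - u x) (ψ x - u x + u y - ψ y)^{p-1} |x - y|^{-n-sp}`, up to a constant; all other pairs cost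
at most the energy of `ψ` and the tail of the negative part of `u` (`pair_bound`). Hence the
interaction between `{u < ψ}` and `{u ≥ ψ}` is bounded by the measure of `{u < ψ}` times `k` times
the flux `k^{p-1} r^{-sp} + a(x₀, x₀) k^{q-1} r^{-tq}` (`lintegral_interaction_le`,
`levelSet_inequality`). The coefficient may be frozen at `(x₀, x₀)`: its variation on `B_r(x₀)` is
`O(r^α)`, and `r^{α - tq} ≤ r^{-sp}` for `r ≤ 1` by the assumption `tq ≤ sp + α`, while `k ≤ M`
gives `k^{q-1} ≤ M^{q-p} k^{p-1}`. So the error is a multiple, depending on `M`, of the first phase,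
and no distinction between the phases is needed.

*Growth.* If `u ≥ ω / 2` on half of a ball and the tail is at most the flux of height `δ ω`, then
the interaction inequality with a barrier of height comparable to `δ ω` shows that the set where `u`
is below this height has measure `O(δ^{p-1})` (`measure_low_le`). A decreasing sequence of barriers,
with interaction measured at smaller and smaller distances, then makes the set disappear
(`lower_bound_of_measure_low_le`), so that `u` is bounded below by a multiple of `ω` (`growth`).

*Decay of the oscillation.* On the balls of radii `σ^j R₀` the growth lemma is applied to `u - m_j`
or to `m_j + ω_j - u`, whichever is large on half of a ball. The tail is split into the part near
`x₀`, controlled by the bounds of the earlier steps and small because `σ` is small, and the part far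
from `x₀`, controlled by the membership of `u` in the tail space and small because `R₀` is small
(`lintegral_near_tail_le`, `lintegral_far_tail_le`). Only `R₀`, and not the ratio of decay, depends
on the tail of `u`. So the oscillation decays like `(σ^γ)^j` with `γ` depending on the data and on
the bound of `|u|` (`oscillation_decay`). The averages of `u` over small balls inherit these bounds,
and their upper limit is the Hölder continuous representative.
-/

namespace DoublePhase

/-! ### Algebraic inequalities -/

lemma rpow_sub_two_mul_self {p d : ℝ} (hp : 1 < p) (hd : 0 ≤ d) :
    |d| ^ (p - 2) * d = d ^ (p - 1) := by
  rcases hd.eq_or_lt with rfl | hd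
  · rw [mul_zero, Real.zero_rpow (by linarith)]
  · rw [abs_of_pos hd]
    nth_rewrite 2 [← Real.rpow_one d]
    rw [← Real.rpow_add hd]
    congr 1; ring

/-- Coercivity of `d ↦ |d|^{p-2} d` in the direction `h`, up to an error which is controlled by the
increment `b` of the barrier alone. No lower bound on `p` beyond `1` is needed: if `|b| ≤ g / 2` the
jump `-d` is at least `g / 2`, and otherwise `h` is itself controlled by `b`. -/
lemma coercivity {p g h b d : ℝ} (hp : 1 < p) (h0 : 0 ≤ h) (hg : h ≤ g)
    (hd : g - b ≤ -d) :
    (2 : ℝ) ^ (1 - p) * g ^ (p - 1) * h - 4 * |b| ^ p ≤ -(|d| ^ (p - 2) * d * h) := by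
  have hg0 : 0 ≤ g := h0.trans hg
  have e1 : -(|d| ^ (p - 2) * d * h) = |(-d)| ^ (p - 2) * (-d) * h := by rw [abs_neg]; ring
  rw [e1]
  set e := -d with he
  have hbp : 0 ≤ |b| ^ p := by positivity
  by_cases hb : |b| ≤ g / 2
  · have hle : g / 2 ≤ e := by linarith [le_abs_self b]
    rw [rpow_sub_two_mul_self hp (by linarith)]
    have h1 : (g / 2) ^ (p - 1) ≤ e ^ (p - 1) :=
      Real.rpow_le_rpow (by linarith) hle (by linarith)
    have h2 : (g / 2) ^ (p - 1) = 2 ^ (1 - p) * g ^ (p - 1) := by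
      rw [div_eq_inv_mul, Real.mul_rpow (by norm_num) hg0, Real.inv_rpow (by norm_num),
        ← Real.rpow_neg (by norm_num)]
      congr 2; ring
    rw [← h2]
    nlinarith [mul_le_mul_of_nonneg_right h1 h0]
  · push Not at hb
    have hb0 : 0 < |b| := by linarith [abs_nonneg b]
    have split : ∀ x : ℝ, 0 < x → x ^ (p - 1) * x = x ^ p := fun x hx => by
      nth_rewrite 2 [← Real.rpow_one x]
      rw [← Real.rpow_add hx]; congr 1; ring
    have h1 : (2 : ℝ) ^ (1 - p) * g ^ (p - 1) * h ≤ 2 * |b| ^ p := by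
      have hgp : g ^ (p - 1) ≤ (2 * |b|) ^ (p - 1) :=
        Real.rpow_le_rpow hg0 (by linarith) (by linarith)
      calc (2 : ℝ) ^ (1 - p) * g ^ (p - 1) * h
          ≤ 2 ^ (1 - p) * (2 * |b|) ^ (p - 1) * (2 * |b|) := by
            apply mul_le_mul _ (by linarith) h0 (by positivity)
            exact mul_le_mul_of_nonneg_left hgp (by positivity)
        _ = (2 ^ (1 - p) * 2 ^ (p - 1)) * 2 * (|b| ^ (p - 1) * |b|) := by
            rw [Real.mul_rpow (by norm_num) hb0.le]; ring
        _ = 2 * |b| ^ p := by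
            rw [split _ hb0, ← Real.rpow_add (by norm_num)]; simp
    rcases le_or_gt 0 e with h3 | h3
    · have : 0 ≤ |e| ^ (p - 2) * e * h := by positivity
      linarith
    · have h4 : |e| ≤ |b| := by
        rw [abs_of_neg h3]; linarith [le_abs_self b]
      have h5 : |e| ^ (p - 2) * e = - (|e| ^ (p - 1)) := by
        have := rpow_sub_two_mul_self hp (d := -e) (by linarith)
        rw [abs_neg] at this
        rw [abs_of_neg h3] at this ⊢
        linarith
      rw [h5]
      have h6 : |e| ^ (p - 1) * h ≤ 2 * |b| ^ p := by
        calc |e| ^ (p - 1) * h ≤ |b| ^ (p - 1) * (2 * |b|) := by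
              apply mul_le_mul _ (by linarith) h0 (by positivity)
              exact Real.rpow_le_rpow (abs_nonneg _) h4 (by linarith)
          _ = 2 * |b| ^ p := by rw [← split _ hb0]; ring
      linarith

lemma add_rpow_le {x y e : ℝ} (hx : 0 ≤ x) (hy : 0 ≤ y) (he : 0 ≤ e) :
    (x + y) ^ e ≤ 2 ^ e * (x ^ e + y ^ e) := by
  have hxe : 0 ≤ x ^ e := by positivity
  have hye : 0 ≤ y ^ e := by positivity
  rcases le_total x y with h | h
  · calc (x + y) ^ e ≤ (2 * y) ^ e := Real.rpow_le_rpow (by positivity) (by linarith) he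
      _ = 2 ^ e * y ^ e := Real.mul_rpow (by norm_num) hy
      _ ≤ _ := by gcongr; linarith
  · calc (x + y) ^ e ≤ (2 * x) ^ e := Real.rpow_le_rpow (by positivity) (by linarith) he
      _ = 2 ^ e * x ^ e := Real.mul_rpow (by norm_num) hx
      _ ≤ _ := by gcongr; linarith

lemma rpow_sub_one_mul {p x : ℝ} (hp : 1 < p) (hx : 0 ≤ x) : x * x ^ (p - 1) = x ^ p := by
  rcases hx.eq_or_lt with rfl | hx
  · rw [zero_mul, Real.zero_rpow (by linarith)]
  · nth_rewrite 1 [← Real.rpow_one x]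
    rw [← Real.rpow_add hx]; congr 1; ring

/-! ### Integral comparison -/

/-- If the integral of `F` vanishes and `P ≤ F + N`, the integral of `P` is at most that of `N`.
The integral of `N` may be infinite, and `P` need not be measurable. -/
lemma lintegral_le_of_integral_eq_zero {X : Type*} [MeasurableSpace X] {μ : Measure X}
    {F P N : X → ℝ} (hF : Integrable F μ) (hF0 : ∫ z, F z ∂μ = 0)
    (hN : AEMeasurable N μ) (hN0 : ∀ᵐ z ∂μ, 0 ≤ N z) (hP0 : ∀ᵐ z ∂μ, 0 ≤ P z)
    (h : ∀ᵐ z ∂μ, P z ≤ F z + N z) :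
    ∫⁻ z, ENNReal.ofReal (P z) ∂μ ≤ ∫⁻ z, ENNReal.ofReal (N z) ∂μ := by
  -- finiteness of the integral of `N` is needed for its Bochner integral to be meaningful
  by_cases hfin : ∫⁻ z, ENNReal.ofReal (N z) ∂μ = ∞
  · rw [hfin]; exact le_top
  have hNi : Integrable N μ := by
    refine ⟨hN.aestronglyMeasurable, ?_⟩
    rw [hasFiniteIntegral_iff_ofReal hN0]
    exact lt_top_iff_ne_top.2 hfin
  calc ∫⁻ z, ENNReal.ofReal (P z) ∂μ ≤ ∫⁻ z, ENNReal.ofReal (F z + N z) ∂μ := by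
        apply lintegral_mono_ae
        filter_upwards [h] with z hz using ENNReal.ofReal_le_ofReal hz
    _ = ENNReal.ofReal (∫ z, (F z + N z) ∂μ) := by
        refine (ofReal_integral_eq_lintegral_ofReal (hF.add hNi) ?_).symm
        filter_upwards [h, hP0] with z hz hz0 using hz0.trans hz
    _ = ENNReal.ofReal (∫ z, N z ∂μ) := by
        rw [integral_add hF hNi, hF0, zero_add]
    _ = ∫⁻ z, ENNReal.ofReal (N z) ∂μ := ofReal_integral_eq_lintegral_ofReal hNi hN0

/-! ### Integrals of the kernels -/

variable {n : ℕ}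

lemma lintegral_comp_smul_pos {f : E n → ℝ≥0∞} (hf : Measurable f) {r : ℝ} (hr : 0 < r) :
    ∫⁻ x, f x = ENNReal.ofReal (r ^ n) * ∫⁻ x, f (r • x) := by
  have h := Measure.map_addHaar_smul (volume : Measure (E n)) hr.ne'
  have h2 : ∫⁻ x, f (r • x) = ∫⁻ x, f x ∂(Measure.map (r • ·) (volume : Measure (E n))) :=
    (lintegral_map hf (measurable_const_smul r)).symm
  rw [h2, h, lintegral_smul_measure, finrank_euclideanSpace_fin, smul_eq_mul, ← mul_assoc,
    ← ENNReal.ofReal_mul (by positivity), abs_of_pos (by positivity),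
    mul_inv_cancel₀ (by positivity)]
  simp

/-- The kernel `‖z‖^{-(n+β)}` has mass of order `r^{-β}` off `B_r`, by scaling from `r = 1`. -/
lemma lintegral_tail_kernel_le {β : ℝ} (hβ : 0 < β) :
    ∃ C : ℝ, 0 < C ∧ ∀ r : ℝ, 0 < r →
      ∫⁻ z : E n, ENNReal.ofReal (if r ≤ ‖z‖ then 1 / ‖z‖ ^ ((n : ℝ) + β) else 0)
        ≤ ENNReal.ofReal (C * r ^ (-β)) := by
  set I := ∫⁻ z : E n, ENNReal.ofReal (if 1 ≤ ‖z‖ then 1 / ‖z‖ ^ ((n : ℝ) + β) else 0) with hI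
  have hIfin : I < ∞ := by
    have h1 := finite_integral_one_add_norm (E := E n) (μ := volume) (r := n + β)
      (by rw [finrank_euclideanSpace_fin]; linarith)
    refine lt_of_le_of_lt (b := ENNReal.ofReal (2 ^ ((n : ℝ) + β)) *
      ∫⁻ x : E n, ENNReal.ofReal ((1 + ‖x‖) ^ (-((n : ℝ) + β)))) ?_
      (ENNReal.mul_lt_top ENNReal.ofReal_lt_top h1)
    rw [hI, ← lintegral_const_mul' _ _ ENNReal.ofReal_ne_top]
    refine lintegral_mono fun z => ?_
    rw [← ENNReal.ofReal_mul (by positivity)]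
    apply ENNReal.ofReal_le_ofReal
    split_ifs with hz
    · have hz0 : 0 < ‖z‖ := by linarith
      rw [Real.rpow_neg (by positivity), ← div_eq_mul_inv, div_le_div_iff₀ (by positivity)
        (by positivity), one_mul, ← Real.mul_rpow (by norm_num) (by positivity)]
      exact Real.rpow_le_rpow (by positivity) (by linarith) (by positivity)
    · positivity
  refine ⟨I.toReal + 1, by positivity, fun r hr => ?_⟩
  have hrn : r ^ n * (r ^ ((n : ℝ) + β))⁻¹ = r ^ (-β) := by
    rw [Real.rpow_add hr, Real.rpow_natCast, Real.rpow_neg hr.le]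
    field_simp
  rw [lintegral_comp_smul_pos (Measurable.ennreal_ofReal (Measurable.ite
    (measurableSet_le measurable_const measurable_norm) (by fun_prop) measurable_const)) hr]
  calc _ = ENNReal.ofReal (r ^ n) * ∫⁻ z : E n, ENNReal.ofReal ((r ^ ((n : ℝ) + β))⁻¹) *
        ENNReal.ofReal (if 1 ≤ ‖z‖ then 1 / ‖z‖ ^ ((n : ℝ) + β) else 0) := by
        congr 1
        refine lintegral_congr fun z => ?_
        rw [← ENNReal.ofReal_mul (by positivity), norm_smul, Real.norm_of_nonneg hr.le]
        congr 1
        have : r ≤ r * ‖z‖ ↔ 1 ≤ ‖z‖ := by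
          constructor
          · intro h; by_contra h'; push Not at h'; nlinarith
          · intro h; nlinarith
        simp only [this]
        split_ifs with hz
        · rw [Real.mul_rpow hr.le (norm_nonneg _)]
          field_simp
        · simp
    _ = ENNReal.ofReal (r ^ (-β)) * I := by
        rw [lintegral_const_mul' _ _ ENNReal.ofReal_ne_top, ← mul_assoc,
          ← ENNReal.ofReal_mul (by positivity), hrn]
    _ ≤ _ := by
        rw [mul_comm, ENNReal.ofReal_mul (by positivity)]
        gcongr
        rw [← ENNReal.ofReal_toReal hIfin.ne]
        exact ENNReal.ofReal_le_ofReal (by simp)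

/-- The kernel `‖z‖^{-(n+β)}` against the `P`-th power of the increment of a barrier of height one:
as `β < P`, the Lipschitz bound makes it integrable at the origin, and scaling gives the order
`r^{-β}`. -/
lemma lintegral_barrier_kernel_le (hn : 1 ≤ n) {β P : ℝ} (hβ : 0 < β) (hP : β < P) :
    ∃ C : ℝ, 0 < C ∧ ∀ r : ℝ, 0 < r →
      ∫⁻ z : E n, ENNReal.ofReal ((min 1 (2 * ‖z‖ / r)) ^ P / ‖z‖ ^ ((n : ℝ) + β))
        ≤ ENNReal.ofReal (C * r ^ (-β)) := by
  set I := ∫⁻ z : E n, ENNReal.ofReal ((min 1 (2 * ‖z‖)) ^ P / ‖z‖ ^ ((n : ℝ) + β)) with hI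
  have hIfin : I < ∞ := by
    obtain ⟨C, hC0, hC⟩ := lintegral_tail_kernel_le (n := n) hβ
    have hloc : IntegrableOn (fun z : E n => (2 : ℝ) ^ P * ‖z‖ ^ (-((n : ℝ) + β - P)))
        (Metric.ball 0 1) volume := by
      refine integrableOn_ball_of_norm_le_rpow (C := 2 ^ P) (α := (n : ℝ) + β - P)
        (by rw [finrank_euclideanSpace_fin]; exact hn)
        (by rw [finrank_euclideanSpace_fin]; linarith) ?_ ?_
      · refine Filter.Eventually.of_forall fun z => ?_
        rw [Real.norm_of_nonneg (by positivity)]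
      · exact Measurable.aestronglyMeasurable (by fun_prop)
    have h1 := hloc.lintegral_lt_top
    rw [← lintegral_indicator Metric.isOpen_ball.measurableSet] at h1
    refine lt_of_le_of_lt ?_ (ENNReal.add_lt_top.2 ⟨h1,
      (hC 1 one_pos).trans_lt ENNReal.ofReal_lt_top⟩)
    rw [← lintegral_add_right _ (Measurable.ennreal_ofReal (Measurable.ite
      (measurableSet_le measurable_const measurable_norm) (by fun_prop) measurable_const))]
    refine lintegral_mono fun z => ?_
    simp only [indicator, Metric.mem_ball, dist_zero_right]
    by_cases hz : ‖z‖ < 1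
    · rw [if_pos hz]
      refine le_add_right (ENNReal.ofReal_le_ofReal ?_)
      rcases (norm_nonneg z).eq_or_lt with h0 | h0
      · rw [← h0, Real.zero_rpow (by positivity : (n : ℝ) + β ≠ 0), div_zero]; positivity
      · have e : -((n : ℝ) + β - P) = P - ((n : ℝ) + β) := by ring
        rw [e, Real.rpow_sub h0, ← mul_div_assoc, ← Real.mul_rpow (by norm_num) h0.le]
        gcongr
        · linarith
        · apply min_le_right
    · rw [if_neg hz, zero_add, if_pos (not_lt.1 hz)]
      refine ENNReal.ofReal_le_ofReal ?_
      gcongr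
      have h0 : 0 ≤ min 1 (2 * ‖z‖) := le_min zero_le_one (by positivity)
      exact Real.rpow_le_one h0 (min_le_left _ _) (by linarith)
  refine ⟨I.toReal + 1, by positivity, fun r hr => ?_⟩
  have hrn : r ^ n * (r ^ ((n : ℝ) + β))⁻¹ = r ^ (-β) := by
    rw [Real.rpow_add hr, Real.rpow_natCast, Real.rpow_neg hr.le]
    field_simp
  rw [lintegral_comp_smul_pos (by fun_prop) hr]
  calc _ = ENNReal.ofReal (r ^ n) * ∫⁻ z : E n, ENNReal.ofReal ((r ^ ((n : ℝ) + β))⁻¹) *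
        ENNReal.ofReal ((min 1 (2 * ‖z‖)) ^ P / ‖z‖ ^ ((n : ℝ) + β)) := by
        congr 1
        refine lintegral_congr fun z => ?_
        rw [← ENNReal.ofReal_mul (by positivity), norm_smul, Real.norm_of_nonneg hr.le]
        congr 1
        have : 2 * (r * ‖z‖) / r = 2 * ‖z‖ := by field_simp
        rw [this, Real.mul_rpow hr.le (norm_nonneg _)]
        field_simp
    _ = ENNReal.ofReal (r ^ (-β)) * I := by
        rw [lintegral_const_mul' _ _ ENNReal.ofReal_ne_top, ← mul_assoc,
          ← ENNReal.ofReal_mul (by positivity), hrn]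
    _ ≤ _ := by
        rw [mul_comm, ENNReal.ofReal_mul (by positivity)]
        gcongr
        rw [← ENNReal.ofReal_toReal hIfin.ne]
        exact ENNReal.ofReal_le_ofReal (by simp)

/-! ### Barriers and test functions -/

/-- A barrier of height `k` on the ball `B_r(x₀)`: a nonnegative function, bounded by `k`, supported
in the ball, with Lipschitz constant `2k/r`. -/
structure IsBarrier (x₀ : E n) (r k : ℝ) (ψ : E n → ℝ) : Prop where
  nonneg : ∀ x, 0 ≤ ψ x
  le_height : ∀ x, ψ x ≤ k
  lipschitz : ∀ x y, |ψ x - ψ y| ≤ 2 * k / r * ‖x - y‖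
  zero_off : ∀ x, x ∉ Metric.ball x₀ r → ψ x = 0

/-- The test function `(ψ - u)₊ 1_{B_r(x₀)}`. -/
noncomputable def barrierTest (x₀ : E n) (r : ℝ) (ψ u : E n → ℝ) : E n → ℝ :=
  (Metric.ball x₀ r).indicator fun x => max (ψ x - u x) 0

/-- The part of `B_r(x₀)` on which `u` lies below the barrier `ψ`. -/
def belowSet (x₀ : E n) (r : ℝ) (ψ u : E n → ℝ) : Set (E n) :=
  {x | x ∈ Metric.ball x₀ r ∧ u x < ψ x}

/-- The error density of one phase at `(x, y)`: the `p`-th power of the increment allowed to a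
barrier of height `k`, plus the contribution of the negative part of `u` off `B_R(x₀)`. -/
noncomputable def phaseError (p k r R : ℝ) (x₀ : E n) (u : E n → ℝ) (x y : E n) : ℝ :=
  (k * min 1 (2 * ‖x - y‖ / r)) ^ p
    + (Metric.ball x₀ R)ᶜ.indicator (fun y => k * max (-u y) 0 ^ (p - 1)) y

lemma phaseError_nonneg {p k r R : ℝ} (hk : 0 ≤ k) (hr : 0 < r) {x₀ : E n} {u : E n → ℝ}
    (x y : E n) : 0 ≤ phaseError p k r R x₀ u x y := by
  have h0 : 0 ≤ min 1 (2 * ‖x - y‖ / r) := le_min zero_le_one (by positivity)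
  refine add_nonneg (by positivity) (indicator_nonneg (fun y _ => ?_) y)
  positivity

namespace IsBarrier

variable {x₀ : E n} {r k : ℝ} {ψ : E n → ℝ}

lemma height_nonneg (h : IsBarrier x₀ r k ψ) : 0 ≤ k := (h.nonneg x₀).trans (h.le_height x₀)

lemma abs_sub_le (h : IsBarrier x₀ r k ψ) (x y : E n) :
    |ψ x - ψ y| ≤ k * min 1 (2 * ‖x - y‖ / r) := by
  rw [mul_min_of_nonneg _ _ h.height_nonneg]
  refine le_min ?_ ((h.lipschitz x y).trans (le_of_eq (by ring)))
  rw [mul_one, abs_sub_le_iff]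
  constructor <;> linarith [h.nonneg x, h.nonneg y, h.le_height x, h.le_height y]

lemma continuous (h : IsBarrier x₀ r k ψ) (hr : 0 < r) : Continuous ψ := by
  have hk := h.height_nonneg
  refine (LipschitzWith.of_dist_le_mul (K := ⟨2 * k / r, by positivity⟩) fun x y => ?_).continuous
  rw [Real.dist_eq, dist_eq_norm]
  exact h.lipschitz x y

end IsBarrier

section Pointwise

variable {x₀ : E n} {r R k : ℝ} {ψ u : E n → ℝ}

lemma barrierTest_nonneg (x : E n) : 0 ≤ barrierTest x₀ r ψ u x :=
  indicator_nonneg (fun _ _ => le_max_right _ _) x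

lemma barrierTest_eq (hψ : IsBarrier x₀ r k ψ) {x : E n} (hx : 0 ≤ u x) :
    barrierTest x₀ r ψ u x = max (ψ x - u x) 0 := by
  by_cases h : x ∈ Metric.ball x₀ r
  · simp [barrierTest, h]
  · rw [barrierTest, indicator_of_notMem h, hψ.zero_off x h, max_eq_right (by linarith)]

lemma barrierTest_of_pos {x : E n} (h : 0 < barrierTest x₀ r ψ u x) :
    x ∈ belowSet x₀ r ψ u ∧ barrierTest x₀ r ψ u x = ψ x - u x := by
  by_cases hx : x ∈ Metric.ball x₀ r
  · rw [barrierTest, indicator_of_mem hx] at h ⊢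
    have : 0 < ψ x - u x := by
      by_contra h'; rw [max_eq_right (not_lt.1 h')] at h; exact lt_irrefl _ h
    exact ⟨⟨hx, by linarith⟩, max_eq_left this.le⟩
  · rw [barrierTest, indicator_of_notMem hx] at h; exact absurd h (lt_irrefl _)

lemma barrierTest_le (hψ : IsBarrier x₀ r k ψ) {x : E n}
    (hx : x ∈ Metric.ball x₀ r → 0 ≤ u x) :
    barrierTest x₀ r ψ u x ≤ k := by
  rcases (barrierTest_nonneg (x₀ := x₀) (r := r) (ψ := ψ) (u := u) x).eq_or_lt with h | h
  · rw [← h]; exact hψ.height_nonneg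
  · obtain ⟨h1, h2⟩ := barrierTest_of_pos h
    rw [h2]; linarith [hψ.le_height x, hx h1.1]

/-- Both points in `B_R(x₀)`: the jump of `u` is the jump of `ψ`, minus the jump of the test
function, plus the excess of `u` over `ψ`. -/
lemma near_pair_bound {p w K Λ : ℝ} (hp : 1 < p) (hψ : IsBarrier x₀ r k ψ)
    (hw : 0 ≤ w) (hΛ : 0 < Λ) (hK : Λ⁻¹ * w ≤ K) (hK' : K ≤ Λ * w) {x y : E n}
    (huy : 0 ≤ u y)
    (hle : barrierTest x₀ r ψ u y ≤ barrierTest x₀ r ψ u x)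
    (hpos : 0 < barrierTest x₀ r ψ u x) :
    Λ⁻¹ * 2 ^ (1 - p) * ((barrierTest x₀ r ψ u x - barrierTest x₀ r ψ u y) *
        (barrierTest x₀ r ψ u x - barrierTest x₀ r ψ u y + max (u y - ψ y) 0) ^ (p - 1)) * w
      ≤ -(|u x - u y| ^ (p - 2) * (u x - u y) *
          (barrierTest x₀ r ψ u x - barrierTest x₀ r ψ u y) * K)
        + 4 * Λ * (k * min 1 (2 * ‖x - y‖ / r)) ^ p * w := by
  obtain ⟨-, hx⟩ := barrierTest_of_pos hpos
  have hy := barrierTest_eq hψ huy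
  set h := barrierTest x₀ r ψ u x - barrierTest x₀ r ψ u y with hh
  have h0 : 0 ≤ h := by linarith
  have hm : 0 ≤ max (u y - ψ y) 0 := le_max_right _ _
  have hjump : h + max (u y - ψ y) 0 - (ψ x - ψ y) ≤ -(u x - u y) := by
    rw [hh, hx, hy]
    rcases le_total (u y) (ψ y) with h1 | h1
    · rw [max_eq_left (by linarith), max_eq_right (by linarith)]; linarith
    · rw [max_eq_right (by linarith), max_eq_left (by linarith)]; linarith
  have hc := coercivity hp h0 (by linarith : h ≤ h + max (u y - ψ y) 0) hjump
  have hb : |ψ x - ψ y| ^ p ≤ (k * min 1 (2 * ‖x - y‖ / r)) ^ p :=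
    Real.rpow_le_rpow (abs_nonneg _) (hψ.abs_sub_le x y) (by linarith)
  have hK0 : 0 ≤ K := le_trans (by positivity) hK
  set G := (2 : ℝ) ^ (1 - p) * (h + max (u y - ψ y) 0) ^ (p - 1) * h with hG
  have hG0 : 0 ≤ G := by positivity
  set Q := (k * min 1 (2 * ‖x - y‖ / r)) ^ p
  have hQ0 : 0 ≤ Q := le_trans (by positivity) hb
  calc _ = (Λ⁻¹ * w) * G := by rw [hG]; ring
    _ ≤ K * G := mul_le_mul_of_nonneg_right hK hG0
    _ ≤ K * (-(|u x - u y| ^ (p - 2) * (u x - u y) * h) + 4 * Q) :=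
        mul_le_mul_of_nonneg_left (by linarith) hK0
    _ = -(|u x - u y| ^ (p - 2) * (u x - u y) * h * K) + 4 * Q * K := by ring
    _ ≤ -(|u x - u y| ^ (p - 2) * (u x - u y) * h * K) + 4 * Q * (Λ * w) := by gcongr
    _ = _ := by ring

/-- One point in `B_r(x₀)`, the other off `B_R(x₀)`, where the test function vanishes: nothing is
gained, and the loss is at most the tail of the negative part of `u`, plus a term in `k` alone. -/
lemma far_pair_bound {p w K Λ : ℝ} (hp : 1 < p) (hψ : IsBarrier x₀ r k ψ) (hr : 0 < r)
    (hR : 2 * r ≤ R) (hw : 0 ≤ w) (hΛ : 0 < Λ) (hK : Λ⁻¹ * w ≤ K) (hK' : K ≤ Λ * w)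
    {x y : E n} (hux : 0 ≤ u x) (hy : y ∉ Metric.ball x₀ R)
    (hpos : 0 < barrierTest x₀ r ψ u x) :
    0 ≤ -(|u x - u y| ^ (p - 2) * (u x - u y) *
          (barrierTest x₀ r ψ u x - barrierTest x₀ r ψ u y) * K)
        + 2 ^ (p - 1) * Λ * phaseError p k r R x₀ u x y * w := by
  obtain ⟨⟨hxr, -⟩, hx⟩ := barrierTest_of_pos hpos
  have hy0 : barrierTest x₀ r ψ u y = 0 := by
    refine indicator_of_notMem (fun h => hy ?_) _
    exact Metric.ball_subset_ball (by linarith) h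
  rw [hy0, sub_zero]
  have hk : 0 ≤ k := hψ.height_nonneg
  have hφk := barrierTest_le hψ (u := u) (x := x) fun _ => hux
  have hK0 : 0 ≤ K := le_trans (by positivity) hK
  set h := barrierTest x₀ r ψ u x
  rcases le_total (u x - u y) 0 with hd | hd
  -- a large value of `u` outside only helps
  · have h1 : 0 ≤ |u x - u y| ^ (p - 2) * (-(u x - u y)) * h * K := by
      have : 0 ≤ -(u x - u y) := by linarith
      positivity
    have h2 := phaseError_nonneg (p := p) (R := R) (x₀ := x₀) (u := u) hk hr x y
    have : 0 ≤ 2 ^ (p - 1) * Λ * phaseError p k r R x₀ u x y * w := by positivity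
    linarith
  · have hdist : r ≤ ‖x - y‖ := by
      rw [Metric.mem_ball, dist_eq_norm] at hxr
      rw [Metric.mem_ball, dist_eq_norm, not_lt] at hy
      have := norm_sub_le_norm_sub_add_norm_sub y x x₀
      rw [norm_sub_rev y x] at this
      linarith
    have hmin : min 1 (2 * ‖x - y‖ / r) = 1 := by
      apply min_eq_left
      rw [le_div_iff₀ hr]; linarith
    have herr : phaseError p k r R x₀ u x y = k * (k ^ (p - 1) + max (-u y) 0 ^ (p - 1)) := by
      rw [phaseError, hmin, mul_one, indicator_of_mem (by exact hy), mul_add,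
        rpow_sub_one_mul hp hk]
    have hm : 0 ≤ max (-u y) 0 := le_max_right _ _
    have hd2 : u x - u y ≤ k + max (-u y) 0 := by
      have : u x ≤ k := by linarith [hψ.le_height x]
      linarith [le_max_left (-u y) 0]
    rw [rpow_sub_two_mul_self hp hd, herr]
    have h1 : (u x - u y) ^ (p - 1) ≤ 2 ^ (p - 1) * (k ^ (p - 1) + max (-u y) 0 ^ (p - 1)) :=
      (Real.rpow_le_rpow hd hd2 (by linarith)).trans (add_rpow_le hk hm (by linarith))
    have h2 : (u x - u y) ^ (p - 1) * h * K ≤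
        2 ^ (p - 1) * (k ^ (p - 1) + max (-u y) 0 ^ (p - 1)) * k * (Λ * w) := by
      gcongr
    linarith

/-- The pointwise estimate behind the energy inequality, for one phase, and for pairs at which the
test function is not smaller at the first point. -/
lemma ordered_pair_bound {p q w K Λ : ℝ} (hp : 1 < p) (hpq : p ≤ q) (hψ : IsBarrier x₀ r k ψ)
    (hr : 0 < r) (hR : 2 * r ≤ R) (hw : 0 ≤ w) (hΛ : 0 < Λ) (hK : Λ⁻¹ * w ≤ K) (hK' : K ≤ Λ * w)
    {x y : E n} (hux : x ∈ Metric.ball x₀ R → 0 ≤ u x) (huy : y ∈ Metric.ball x₀ R → 0 ≤ u y)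
    (hle : barrierTest x₀ r ψ u y ≤ barrierTest x₀ r ψ u x) :
    (belowSet x₀ r ψ u).indicator (fun x => Λ⁻¹ * 2 ^ (1 - q) *
        ((Metric.ball x₀ R).indicator (fun y =>
          (barrierTest x₀ r ψ u x - barrierTest x₀ r ψ u y) *
          (barrierTest x₀ r ψ u x - barrierTest x₀ r ψ u y + max (u y - ψ y) 0) ^ (p - 1)) y)
          * w) x
      ≤ -(|u x - u y| ^ (p - 2) * (u x - u y) *
          (barrierTest x₀ r ψ u x - barrierTest x₀ r ψ u y) * K)
        + (belowSet x₀ r ψ u).indicator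
            (fun x => 2 ^ (q + 2) * Λ * phaseError p k r R x₀ u x y * w) x := by
  have hk := hψ.height_nonneg
  rcases (barrierTest_nonneg (x₀ := x₀) (r := r) (ψ := ψ) (u := u) x).eq_or_lt with h | hpos
  -- the test function vanishes at both points, and so do both sides
  · have hy : barrierTest x₀ r ψ u y = 0 :=
      le_antisymm (by rw [h]; exact hle) (barrierTest_nonneg y)
    have hx : x ∉ belowSet x₀ r ψ u := by
      intro hx
      have : 0 < barrierTest x₀ r ψ u x := by
        rw [barrierTest, indicator_of_mem hx.1]
        exact lt_max_of_lt_left (by linarith [hx.2])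
      linarith
    rw [indicator_of_notMem hx, indicator_of_notMem hx, hy, ← h]
    simp
  · obtain ⟨hx, -⟩ := barrierTest_of_pos hpos
    rw [indicator_of_mem hx, indicator_of_mem hx]
    have hxR : x ∈ Metric.ball x₀ R := Metric.ball_subset_ball (by linarith) hx.1
    have herr := phaseError_nonneg (p := p) (R := R) (x₀ := x₀) (u := u) hk hr x y
    by_cases hy : y ∈ Metric.ball x₀ R
    · rw [indicator_of_mem hy]
      have hb := near_pair_bound hp hψ hw hΛ hK hK' (huy hy) hle hpos
      refine le_trans ?_ (hb.trans ?_)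
      · have h1 : (2 : ℝ) ^ (1 - q) ≤ 2 ^ (1 - p) :=
          Real.rpow_le_rpow_of_exponent_le (by norm_num) (by linarith)
        have h2 : 0 ≤ barrierTest x₀ r ψ u x - barrierTest x₀ r ψ u y := by linarith
        have h3 : 0 ≤ max (u y - ψ y) 0 := le_max_right _ _
        gcongr
      · have h1 : (4 : ℝ) ≤ 2 ^ (q + 2) := by
          calc (4 : ℝ) = 2 ^ (2 : ℝ) := by norm_num
            _ ≤ 2 ^ (q + 2) := Real.rpow_le_rpow_of_exponent_le (by norm_num) (by linarith)
        have h2 : (k * min 1 (2 * ‖x - y‖ / r)) ^ p = phaseError p k r R x₀ u x y := by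
          rw [phaseError, indicator_of_notMem (by simpa using hy), add_zero]
        rw [h2]
        gcongr
    · rw [indicator_of_notMem hy]
      have hb := far_pair_bound hp hψ hr hR hw hΛ hK hK' (hux hxR) hy hpos
      have h1 : (2 : ℝ) ^ (p - 1) ≤ 2 ^ (q + 2) :=
        Real.rpow_le_rpow_of_exponent_le (by norm_num) (by linarith)
      have h2 : 2 ^ (p - 1) * Λ * phaseError p k r R x₀ u x y * w ≤
          2 ^ (q + 2) * Λ * phaseError p k r R x₀ u x y * w := by gcongr
      simp only [mul_zero, zero_mul]
      linarith

lemma ordered_pair_nonneg {p q w K Λ : ℝ} (hp : 1 < p) (hpq : p ≤ q) (hψ : IsBarrier x₀ r k ψ)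
    (hr : 0 < r) (hR : 2 * r ≤ R) (hw : 0 ≤ w) (hΛ : 0 < Λ) (hK : Λ⁻¹ * w ≤ K) (hK' : K ≤ Λ * w)
    {x y : E n} (hux : x ∈ Metric.ball x₀ R → 0 ≤ u x) (huy : y ∈ Metric.ball x₀ R → 0 ≤ u y)
    (hle : barrierTest x₀ r ψ u y ≤ barrierTest x₀ r ψ u x) :
    0 ≤ -(|u x - u y| ^ (p - 2) * (u x - u y) *
          (barrierTest x₀ r ψ u x - barrierTest x₀ r ψ u y) * K)
        + (belowSet x₀ r ψ u).indicator
            (fun x => 2 ^ (q + 2) * Λ * phaseError p k r R x₀ u x y * w) x := by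
  refine le_trans ?_ (ordered_pair_bound hp hpq hψ hr hR hw hΛ hK hK' hux huy hle)
  have h2 : 0 ≤ barrierTest x₀ r ψ u x - barrierTest x₀ r ψ u y := by linarith
  have h3 : 0 ≤ max (u y - ψ y) 0 := le_max_right _ _
  by_cases hx : x ∈ belowSet x₀ r ψ u
  · rw [indicator_of_mem hx]
    by_cases hy : y ∈ Metric.ball x₀ R
    · rw [indicator_of_mem hy]
      positivity
    · simp [indicator_of_notMem hy]
  · rw [indicator_of_notMem hx]

/-- The pointwise estimate behind the energy inequality, for one phase: pairs in `X × Y`, with `u`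
below the barrier by `h₀` on `X` and above it on `Y`, contribute a positive amount, and all
other pairs are controlled by the error density on the set where `u` is below the barrier. -/
lemma pair_bound {p q w K Λ : ℝ} (hp : 1 < p) (hpq : p ≤ q) (hψ : IsBarrier x₀ r k ψ)
    (hr : 0 < r) (hR : 2 * r ≤ R) (hw : 0 ≤ w) (hΛ : 0 < Λ) (hK : Λ⁻¹ * w ≤ K) (hK' : K ≤ Λ * w)
    {X Y : Set (E n)} {h₀ g₀ : ℝ} (hh₀ : 0 < h₀) (hg₀ : 0 ≤ g₀)
    (hX : ∀ x ∈ X, x ∈ Metric.ball x₀ r ∧ h₀ ≤ ψ x - u x)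
    (hY : ∀ y ∈ Y, y ∈ Metric.ball x₀ r ∧ ψ y ≤ u y)
    (hXY : ∀ x ∈ X, ∀ y ∈ Y, g₀ ≤ ψ x - u x + (u y - ψ y))
    {x y : E n} (hux : x ∈ Metric.ball x₀ R → 0 ≤ u x) (huy : y ∈ Metric.ball x₀ R → 0 ≤ u y) :
    (X ×ˢ Y).indicator (fun _ => Λ⁻¹ * 2 ^ (1 - q) * (h₀ * g₀ ^ (p - 1)) * w) (x, y)
      ≤ -(|u x - u y| ^ (p - 2) * (u x - u y) *
          (barrierTest x₀ r ψ u x - barrierTest x₀ r ψ u y) * K)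
        + ((belowSet x₀ r ψ u).indicator
            (fun x => 2 ^ (q + 2) * Λ * phaseError p k r R x₀ u x y * w) x
          + (belowSet x₀ r ψ u).indicator
            (fun y => 2 ^ (q + 2) * Λ * phaseError p k r R x₀ u y x * w) y) := by
  have hk := hψ.height_nonneg
  have herr := fun x y => phaseError_nonneg (p := p) (R := R) (x₀ := x₀) (u := u) hk hr x y
  have hind : ∀ x y, 0 ≤ (belowSet x₀ r ψ u).indicator
      (fun x => 2 ^ (q + 2) * Λ * phaseError p k r R x₀ u x y * w) x := fun x y =>
    indicator_nonneg (fun x _ => mul_nonneg (mul_nonneg (by positivity) (herr x y)) hw) x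
  have hm : ∀ y, 0 ≤ max (u y - ψ y) 0 := fun y => le_max_right _ _
  rcases le_total (barrierTest x₀ r ψ u y) (barrierTest x₀ r ψ u x) with hle | hle
  · have hb := ordered_pair_bound hp hpq hψ hr hR hw hΛ hK hK' hux huy hle
    by_cases hxy : (x, y) ∈ X ×ˢ Y
    · refine le_trans ?_ (hb.trans (by linarith [hind y x]))
      rw [indicator_of_mem hxy]
      obtain ⟨hxX, hyY⟩ := mem_prod.1 hxy
      have hx1 := hX x hxX
      have hy1 := hY y hyY
      have hxy1 := hXY x hxX y hyY
      have hyR : y ∈ Metric.ball x₀ R := Metric.ball_subset_ball (by linarith) hy1.1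
      have hxA : x ∈ belowSet x₀ r ψ u := ⟨hx1.1, by linarith [hx1.2]⟩
      rw [indicator_of_mem hxA, indicator_of_mem hyR]
      have e1 : barrierTest x₀ r ψ u y = 0 := by
        rw [barrierTest_eq hψ (huy hyR), max_eq_right (by linarith [hy1.2])]
      have e2 : barrierTest x₀ r ψ u x = ψ x - u x := by
        rw [barrierTest, indicator_of_mem hx1.1, max_eq_left (by linarith [hx1.2])]
      rw [e1, e2, sub_zero, max_eq_left (by linarith [hy1.2])]
      gcongr
      exacts [by linarith, hx1.2]
    · rw [indicator_of_notMem hxy]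
      linarith [ordered_pair_nonneg hp hpq hψ hr hR hw hΛ hK hK' hux huy hle, hind y x]
  · by_cases hxy : (x, y) ∈ X ×ˢ Y
    -- impossible: on `X × Y` the test function is at least `h₀ > 0` at `x` and zero at `y`
    · obtain ⟨hxX, hyY⟩ := mem_prod.1 hxy
      have hx1 := hX x hxX
      have hy1 := hY y hyY
      have e1 : barrierTest x₀ r ψ u y = 0 := by
        rw [barrierTest_eq hψ (huy (Metric.ball_subset_ball (by linarith) hy1.1)),
          max_eq_right (by linarith [hy1.2])]
      have e2 : barrierTest x₀ r ψ u x = ψ x - u x := by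
        rw [barrierTest, indicator_of_mem hx1.1, max_eq_left (by linarith [hx1.2])]
      linarith [hx1.2]
    · rw [indicator_of_notMem hxy]
      have hb := ordered_pair_nonneg hp hpq hψ hr hR hw hΛ hK hK' huy hux hle
      rw [abs_sub_comm (u y) (u x)] at hb
      have e : -(|u x - u y| ^ (p - 2) * (u y - u x) *
          (barrierTest x₀ r ψ u y - barrierTest x₀ r ψ u x) * K) =
          -(|u x - u y| ^ (p - 2) * (u x - u y) *
          (barrierTest x₀ r ψ u x - barrierTest x₀ r ψ u y) * K) := by ring
      linarith [hind x y]

end Pointwise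

/-! ### Structural data and the coefficient at a fixed scale -/

/-- The structural constants of the problem, with the bounds `A` and `L` nonnegative. -/
structure Exponents (n : ℕ) (s t p q Λ A α L : ℝ) : Prop where
  dim_pos : 1 ≤ n
  s_pos : 0 < s
  s_le : s ≤ t
  t_lt : t < 1
  one_lt_p : 1 < p
  p_le : p ≤ q
  Λ_pos : 0 < Λ
  α_pos : 0 < α
  gap : t * q ≤ s * p + α
  A_nonneg : 0 ≤ A
  L_nonneg : 0 ≤ L

/-- Kernels and coefficient of the operator, with the constants of `Exponents`. -/
structure IsOperator (s t p q Λ A α L : ℝ) (a Ksp Ktq : E n → E n → ℝ) : Prop where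
  kernel_sp : IsKernel s p Λ Ksp
  kernel_tq : IsKernel t q Λ Ktq
  coeff : IsCoefficient A a
  holder : IsHolderCoefficient α L a

/-- The singular weight `|x - y|^{-(n+β)}`. -/
noncomputable def weight (β : ℝ) (x y : E n) : ℝ := 1 / ‖x - y‖ ^ ((n : ℝ) + β)

/-- `k^{p-1} r^{-sp} + a₀ k^{q-1} r^{-tq}`: the size of the operator on a bump of height `k` and
width `r`, for the coefficient frozen at the value `a₀`. -/
noncomputable def flux (s t p q a₀ r k : ℝ) : ℝ :=
  k ^ (p - 1) * r ^ (-(s * p)) + a₀ * (k ^ (q - 1) * r ^ (-(t * q)))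

lemma weight_nonneg (β : ℝ) (x y : E n) : 0 ≤ weight β x y := by unfold weight; positivity

lemma weight_comm (β : ℝ) (x y : E n) : weight β x y = weight β y x := by
  rw [weight, weight, norm_sub_rev]

lemma measurable_weight (β : ℝ) : Measurable fun z : E n × E n => weight β z.1 z.2 := by
  unfold weight; fun_prop

lemma flux_nonneg {s t p q a₀ r k : ℝ} (ha : 0 ≤ a₀) (hr : 0 ≤ r) (hk : 0 ≤ k) :
    0 ≤ flux s t p q a₀ r k := by unfold flux; positivity

lemma flux_pos {s t p q a₀ r k : ℝ} (ha : 0 ≤ a₀) (hr : 0 < r) (hk : 0 < k) :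
    0 < flux s t p q a₀ r k := by unfold flux; positivity

namespace Exponents

variable {s t p q Λ A α L : ℝ}

lemma sp_pos (h : Exponents n s t p q Λ A α L) : 0 < s * p :=
  mul_pos h.s_pos (by linarith [h.one_lt_p])

lemma sp_le_tq (h : Exponents n s t p q Λ A α L) : s * p ≤ t * q :=
  mul_le_mul h.s_le h.p_le (by linarith [h.one_lt_p]) (by linarith [h.s_pos, h.s_le])

lemma tq_pos (h : Exponents n s t p q Λ A α L) : 0 < t * q := h.sp_pos.trans_le h.sp_le_tq

lemma sp_lt_p (h : Exponents n s t p q Λ A α L) : s * p < p := by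
  nlinarith [h.s_le, h.t_lt, h.one_lt_p]

lemma tq_lt_q (h : Exponents n s t p q Λ A α L) : t * q < q := by
  nlinarith [h.t_lt, h.one_lt_p, h.p_le]

lemma one_lt_q (h : Exponents n s t p q Λ A α L) : 1 < q := h.one_lt_p.trans_le h.p_le

/-- At scales `r ≤ 1` the oscillation `r^α` of the coefficient times the size of the `q`-phase is at
most the size of the `p`-phase, by `tq ≤ sp + α`. -/
lemma rpow_gap (h : Exponents n s t p q Λ A α L) {r : ℝ} (hr : 0 < r) (hr1 : r ≤ 1) :
    r ^ α * r ^ (-(t * q)) ≤ r ^ (-(s * p)) := by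
  rw [← Real.rpow_add hr]
  exact Real.rpow_le_rpow_of_exponent_ge hr hr1 (by linarith [h.gap])

/-- At heights `k ≤ M` the `q`-phase is controlled by the `p`-phase. This is where the constants
come to depend on the bound of the solution. -/
lemma rpow_height (h : Exponents n s t p q Λ A α L) {k M : ℝ} (hk : 0 < k) (hM : k ≤ M) :
    k ^ (q - 1) ≤ M ^ (q - p) * k ^ (p - 1) := by
  have e : q - 1 = (q - p) + (p - 1) := by ring
  rw [e, Real.rpow_add hk]
  exact mul_le_mul_of_nonneg_right (Real.rpow_le_rpow hk.le hM (by linarith [h.p_le]))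
    (by positivity)

end Exponents

namespace IsOperator

variable {s t p q Λ A α L : ℝ} {a Ksp Ktq : E n → E n → ℝ}

lemma coeff_continuous (ho : IsOperator s t p q Λ A α L a Ksp Ktq)
    (he : Exponents n s t p q Λ A α L) : Continuous fun z : E n × E n => a z.1 z.2 := by
  rw [continuous_iff_continuousAt]
  intro z₀
  have h : Filter.Tendsto (fun z : E n × E n =>
      L * (‖z.1 - z₀.1‖ + ‖z.2 - z₀.2‖) ^ α) (nhds z₀) (nhds 0) := by
    have hc : Continuous fun z : E n × E n => L * (‖z.1 - z₀.1‖ + ‖z.2 - z₀.2‖) ^ α :=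
      continuous_const.mul (Continuous.rpow_const (by fun_prop) fun _ => Or.inr he.α_pos.le)
    have := hc.tendsto z₀
    simpa [Real.zero_rpow he.α_pos.ne'] using this
  refine tendsto_iff_dist_tendsto_zero.2 (squeeze_zero (fun _ => dist_nonneg) (fun z => ?_) h)
  rw [Real.dist_eq]
  exact ho.holder _ _ _ _

lemma coeff_lower (ho : IsOperator s t p q Λ A α L a Ksp Ktq)
    (he : Exponents n s t p q Λ A α L) {x₀ x y : E n} {r : ℝ}
    (hx : x ∈ Metric.ball x₀ r) (hy : y ∈ Metric.ball x₀ r) :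
    a x₀ x₀ ≤ a x y + L * (2 * r) ^ α := by
  have h := (abs_sub_le_iff.1 (ho.holder x y x₀ x₀)).2
  rw [Metric.mem_ball, dist_eq_norm] at hx hy
  have h2 : L * (‖x - x₀‖ + ‖y - x₀‖) ^ α ≤ L * (2 * r) ^ α :=
    mul_le_mul_of_nonneg_left
      (Real.rpow_le_rpow (by positivity) (by linarith) he.α_pos.le) he.L_nonneg
  linarith

lemma coeff_upper (ho : IsOperator s t p q Λ A α L a Ksp Ktq)
    (he : Exponents n s t p q Λ A α L) {x₀ x y : E n} {r : ℝ}
    (hx : x ∈ Metric.ball x₀ r) (hxy : ‖x - y‖ ≤ r) :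
    a x y ≤ a x₀ x₀ + L * (3 * r) ^ α := by
  have h := (abs_sub_le_iff.1 (ho.holder x y x₀ x₀)).1
  rw [Metric.mem_ball, dist_eq_norm] at hx
  have h3 : ‖y - x₀‖ ≤ ‖x - y‖ + ‖x - x₀‖ := by
    have := norm_sub_le_norm_sub_add_norm_sub y x x₀
    rwa [norm_sub_rev y x] at this
  have h2 : L * (‖x - x₀‖ + ‖y - x₀‖) ^ α ≤ L * (3 * r) ^ α :=
    mul_le_mul_of_nonneg_left
      (Real.rpow_le_rpow (by positivity) (by linarith) he.α_pos.le) he.L_nonneg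
  linarith

/-- At distance at least `r` from `x`, the `q`-phase is a frozen `q`-phase plus a term of the order
of the `p`-phase. -/
lemma coeff_mul_weight_far (ho : IsOperator s t p q Λ A α L a Ksp Ktq)
    (he : Exponents n s t p q Λ A α L) {x₀ x y : E n} {r : ℝ} (hr : 0 < r)
    (hx : x ∈ Metric.ball x₀ r) (hxy : r ≤ ‖x - y‖) :
    a x y * weight (t * q) x y ≤
      a x₀ x₀ * weight (t * q) x y + (L * 3 ^ α + A) * weight (s * p) x y := by
  have hd : 0 < ‖x - y‖ := hr.trans_le hxy
  have hL := he.L_nonneg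
  have hA := he.A_nonneg
  -- at distances below one by Hölder continuity, at larger ones by the bound `A`
  have key : a x y ≤ a x₀ x₀ + (L * 3 ^ α + A) * ‖x - y‖ ^ (t * q - s * p) := by
    have h0 := ho.coeff.nonneg x₀ x₀
    rcases le_total ‖x - y‖ 1 with h1 | h1
    · have h := ho.coeff_upper he (Metric.ball_subset_ball hxy hx) le_rfl
      have h2 : ‖x - y‖ ^ α ≤ ‖x - y‖ ^ (t * q - s * p) :=
        Real.rpow_le_rpow_of_exponent_ge hd h1 (by linarith [he.gap])
      have h3 : L * (3 * ‖x - y‖) ^ α ≤ L * 3 ^ α * ‖x - y‖ ^ (t * q - s * p) := by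
        rw [Real.mul_rpow (by norm_num) hd.le, ← mul_assoc]
        gcongr
      have h4 : 0 ≤ A * ‖x - y‖ ^ (t * q - s * p) := by positivity
      linarith
    · have h2 : 1 ≤ ‖x - y‖ ^ (t * q - s * p) :=
        Real.one_le_rpow h1 (by linarith [he.sp_le_tq])
      have h3 : A * 1 ≤ A * ‖x - y‖ ^ (t * q - s * p) := by gcongr
      have h4 : 0 ≤ L * 3 ^ α * ‖x - y‖ ^ (t * q - s * p) := by positivity
      linarith [ho.coeff.le_bound x y]
  have hw : ‖x - y‖ ^ (t * q - s * p) * weight (t * q) x y = weight (s * p) x y := by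
    have e : (n : ℝ) + t * q = (t * q - s * p) + (n + s * p) := by ring
    rw [weight, weight, e, Real.rpow_add hd]
    field_simp
  calc _ ≤ (a x₀ x₀ + (L * 3 ^ α + A) * ‖x - y‖ ^ (t * q - s * p)) * weight (t * q) x y :=
        mul_le_mul_of_nonneg_right key (weight_nonneg _ _ _)
    _ = _ := by rw [add_mul, mul_assoc, hw]

end IsOperator

lemma lintegral_ofReal_add_le' {X : Type*} [MeasurableSpace X] {μ : Measure X} {f g : X → ℝ}
    (hf : Measurable f) :
    ∫⁻ x, ENNReal.ofReal (f x + g x) ∂μ ≤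
      ∫⁻ x, ENNReal.ofReal (f x) ∂μ + ∫⁻ x, ENNReal.ofReal (g x) ∂μ := by
  rw [← lintegral_add_left hf.ennreal_ofReal]
  exact lintegral_mono fun x => ENNReal.ofReal_add_le

lemma lintegral_const_mul_ofReal {X : Type*} [MeasurableSpace X] {μ : Measure X} {c : ℝ}
    (hc : 0 ≤ c) (f : X → ℝ) :
    ∫⁻ x, ENNReal.ofReal (c * f x) ∂μ = ENNReal.ofReal c * ∫⁻ x, ENNReal.ofReal (f x) ∂μ := by
  simp_rw [ENNReal.ofReal_mul hc]
  exact lintegral_const_mul' _ _ ENNReal.ofReal_ne_top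

lemma lintegral_tail_weight_le {β : ℝ} (hβ : 0 < β) :
    ∃ C : ℝ, 0 < C ∧ ∀ (x : E n) (r : ℝ), 0 < r →
      ∫⁻ y, ENNReal.ofReal (if r ≤ ‖x - y‖ then weight β x y else 0)
        ≤ ENNReal.ofReal (C * r ^ (-β)) := by
  obtain ⟨C, hC, h⟩ := lintegral_tail_kernel_le (n := n) hβ
  refine ⟨C, hC, fun x r hr => (le_of_eq ?_).trans (h r hr)⟩
  exact lintegral_sub_left_eq_self
    (fun z : E n => ENNReal.ofReal (if r ≤ ‖z‖ then 1 / ‖z‖ ^ ((n : ℝ) + β) else 0)) x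

lemma lintegral_barrier_weight_le (hn : 1 ≤ n) {β P : ℝ} (hβ : 0 < β) (hP : β < P) :
    ∃ C : ℝ, 0 < C ∧ ∀ (x : E n) (r : ℝ), 0 < r →
      ∫⁻ y, ENNReal.ofReal ((min 1 (2 * ‖x - y‖ / r)) ^ P * weight β x y)
        ≤ ENNReal.ofReal (C * r ^ (-β)) := by
  obtain ⟨C, hC, h⟩ := lintegral_barrier_kernel_le hn hβ hP
  refine ⟨C, hC, fun x r hr => (le_of_eq ?_).trans (h r hr)⟩
  rw [← lintegral_sub_left_eq_self
    (fun z : E n => ENNReal.ofReal ((min 1 (2 * ‖z‖ / r)) ^ P / ‖z‖ ^ ((n : ℝ) + β))) x]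
  refine lintegral_congr fun y => ?_
  rw [weight, mul_one_div]

/-- The energy density of a barrier of height `k` on a ball of radius `r`. -/
noncomputable def barrierEnergy (s t p q : ℝ) (a : E n → E n → ℝ) (r k : ℝ) (x y : E n) : ℝ :=
  (k * min 1 (2 * ‖x - y‖ / r)) ^ p * weight (s * p) x y
    + a x y * ((k * min 1 (2 * ‖x - y‖ / r)) ^ q * weight (t * q) x y)

/-- The energy of barriers of height `k` on a ball of radius `r`, seen from a fixed point. -/
lemma lintegral_barrier_energy_le {s t p q Λ A α L : ℝ} (he : Exponents n s t p q Λ A α L)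
    {M : ℝ} (hM : 0 < M) :
    ∃ C : ℝ, 0 < C ∧ ∀ a Ksp Ktq : E n → E n → ℝ, IsOperator s t p q Λ A α L a Ksp Ktq →
      ∀ (x₀ x : E n) (r k : ℝ), 0 < r → r ≤ 1 → 0 < k → k ≤ M → x ∈ Metric.ball x₀ r →
      ∫⁻ y, ENNReal.ofReal (barrierEnergy s t p q a r k x y)
        ≤ ENNReal.ofReal (C * (k * flux s t p q (a x₀ x₀) r k)) := by
  obtain ⟨C₁, hC₁, h₁⟩ := lintegral_barrier_weight_le he.dim_pos he.sp_pos he.sp_lt_p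
  obtain ⟨C₂, hC₂, h₂⟩ := lintegral_barrier_weight_le he.dim_pos he.tq_pos he.tq_lt_q
  obtain ⟨C₃, hC₃, h₃⟩ := lintegral_tail_weight_le (n := n) he.sp_pos
  have hL := he.L_nonneg
  have hA := he.A_nonneg
  have hp1 := he.one_lt_p
  have hpq := he.p_le
  set c₃ := L * 3 ^ α + A with hc₃
  have hc₃0 : 0 ≤ c₃ := by positivity
  refine ⟨C₁ + C₂ + (L * 3 ^ α * C₂ + c₃ * C₃) * M ^ (q - p), by positivity, ?_⟩
  intro a Ksp Ktq ho x₀ x r k hr hr1 hk hkM hx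
  have ha0 := ho.coeff.nonneg x₀ x₀
  set m : E n → ℝ := fun y => min 1 (2 * ‖x - y‖ / r) with hm
  have hm0 : ∀ y, 0 ≤ m y := fun y => le_min zero_le_one (by positivity)
  have hm1 : ∀ y, m y ≤ 1 := fun y => min_le_left _ _
  have hmm : Measurable m := by fun_prop
  have hw := weight_nonneg (n := n)
  have hwm : ∀ β, Measurable fun y => weight β x y := fun β => by unfold weight; fun_prop
  have hpt : ∀ y, barrierEnergy s t p q a r k x y ≤
      k ^ p * (m y ^ p * weight (s * p) x y) +
      ((a x₀ x₀ + L * (3 * r) ^ α) * k ^ q * (m y ^ q * weight (t * q) x y) +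
        c₃ * k ^ q * (if r ≤ ‖x - y‖ then weight (s * p) x y else 0)) := by
    intro y
    change (k * m y) ^ p * _ + a x y * ((k * m y) ^ q * _) ≤ _
    rw [Real.mul_rpow hk.le (hm0 y), Real.mul_rpow hk.le (hm0 y), mul_assoc]
    refine add_le_add le_rfl ?_
    have hmq := Real.rpow_nonneg (hm0 y) q
    have hwq := hw (t * q) x y
    have hwp := hw (s * p) x y
    split_ifs with hxy
    -- the coefficient is compared with `a x₀ x₀` differently at distances above and below `r`
    · have h := ho.coeff_mul_weight_far he hr hx hxy
      have h5 : m y ^ q ≤ 1 := Real.rpow_le_one (hm0 y) (hm1 y) (by linarith)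
      calc _ = (k ^ q * m y ^ q) * (a x y * weight (t * q) x y) := by ring
        _ ≤ (k ^ q * m y ^ q) * (a x₀ x₀ * weight (t * q) x y + c₃ * weight (s * p) x y) := by
            gcongr
        _ = a x₀ x₀ * k ^ q * (m y ^ q * weight (t * q) x y)
            + c₃ * k ^ q * (m y ^ q * weight (s * p) x y) := by ring
        _ ≤ (a x₀ x₀ + L * (3 * r) ^ α) * k ^ q * (m y ^ q * weight (t * q) x y)
            + c₃ * k ^ q * (1 * weight (s * p) x y) := by
            gcongr
            have : 0 ≤ L * (3 * r) ^ α := by positivity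
            linarith
        _ = _ := by rw [one_mul]
    · have h := ho.coeff_upper he hx (not_le.1 hxy).le
      rw [mul_zero, add_zero]
      calc _ = (a x y) * (k ^ q * (m y ^ q * weight (t * q) x y)) := by ring
        _ ≤ (a x₀ x₀ + L * (3 * r) ^ α) * (k ^ q * (m y ^ q * weight (t * q) x y)) := by gcongr
        _ = _ := by ring
  calc _ ≤ ∫⁻ y, ENNReal.ofReal (k ^ p * (m y ^ p * weight (s * p) x y) +
      ((a x₀ x₀ + L * (3 * r) ^ α) * k ^ q * (m y ^ q * weight (t * q) x y) +
        c₃ * k ^ q * (if r ≤ ‖x - y‖ then weight (s * p) x y else 0))) :=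
        lintegral_mono fun y => ENNReal.ofReal_le_ofReal (hpt y)
    _ ≤ _ := lintegral_ofReal_add_le' (by have := hwm (s * p); fun_prop)
    _ ≤ _ := add_le_add_right
        (lintegral_ofReal_add_le' (by have := hwm (t * q); fun_prop)) _
    _ ≤ ENNReal.ofReal (k ^ p) * ENNReal.ofReal (C₁ * r ^ (-(s * p))) +
        (ENNReal.ofReal ((a x₀ x₀ + L * (3 * r) ^ α) * k ^ q) *
          ENNReal.ofReal (C₂ * r ^ (-(t * q))) +
          ENNReal.ofReal (c₃ * k ^ q) * ENNReal.ofReal (C₃ * r ^ (-(s * p)))) := by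
        rw [lintegral_const_mul_ofReal (by positivity), lintegral_const_mul_ofReal (by positivity),
          lintegral_const_mul_ofReal (by positivity)]
        gcongr
        exacts [h₁ x r hr, h₂ x r hr, h₃ x r hr]
    _ = ENNReal.ofReal (k ^ p * (C₁ * r ^ (-(s * p))) +
        ((a x₀ x₀ + L * (3 * r) ^ α) * k ^ q * (C₂ * r ^ (-(t * q))) +
          c₃ * k ^ q * (C₃ * r ^ (-(s * p))))) := by
        rw [← ENNReal.ofReal_mul (by positivity), ← ENNReal.ofReal_mul (by positivity),
          ← ENNReal.ofReal_mul (by positivity), ← ENNReal.ofReal_add (by positivity)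
          (by positivity), ← ENNReal.ofReal_add (by positivity) (by positivity)]
    _ ≤ _ := by
        apply ENNReal.ofReal_le_ofReal
        have hgap := he.rpow_gap hr hr1
        have hkq : k ^ q ≤ M ^ (q - p) * k ^ p := by
          rw [← rpow_sub_one_mul he.one_lt_q hk.le, ← rpow_sub_one_mul hp1 hk.le]
          have := mul_le_mul_of_nonneg_left (he.rpow_height hk hkM) hk.le
          linarith
        have e1 : k * flux s t p q (a x₀ x₀) r k
            = k ^ p * r ^ (-(s * p)) + a x₀ x₀ * (k ^ q * r ^ (-(t * q))) := by
          rw [flux, ← rpow_sub_one_mul he.one_lt_q hk.le, ← rpow_sub_one_mul hp1 hk.le]; ring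
        rw [e1, Real.mul_rpow (by norm_num) hr.le]
        set P := k ^ p
        set Q := k ^ q
        set Rp := r ^ (-(s * p))
        set Rq := r ^ (-(t * q))
        have hP : 0 ≤ P := by positivity
        have hQ : 0 ≤ Q := by positivity
        have hRp : 0 ≤ Rp := by positivity
        have hRq : 0 ≤ Rq := by positivity
        have i1 : L * (3 ^ α * r ^ α) * Q * (C₂ * Rq) ≤
            L * 3 ^ α * C₂ * (M ^ (q - p) * P) * Rp := by
          calc _ = L * 3 ^ α * C₂ * Q * (r ^ α * Rq) := by ring
            _ ≤ L * 3 ^ α * C₂ * (M ^ (q - p) * P) * Rp := by gcongr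
        have i2 : c₃ * Q * (C₃ * Rp) ≤ c₃ * (M ^ (q - p) * P) * (C₃ * Rp) := by gcongr
        have i3 : 0 ≤ (C₁ + (L * 3 ^ α * C₂ + c₃ * C₃) * M ^ (q - p)) *
          (a x₀ x₀ * (Q * Rq)) := by positivity
        have i4 : 0 ≤ C₂ * (P * Rp) := by positivity
        linarith

/-- If `f x` has integral at most `C` for every `x ∈ S`, then `f`, placed symmetrically on the pairs
with a point in `S`, has integral at most `2 C |S|`. -/
lemma lintegral_symmetrized_le {S : Set (E n)} (hS : MeasurableSet S) {f : E n → E n → ℝ}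
    (hf : Measurable fun z : E n × E n => f z.1 z.2) {C : ℝ≥0∞}
    (h : ∀ x ∈ S, ∫⁻ y, ENNReal.ofReal (f x y) ≤ C) :
    ∫⁻ z : E n × E n, ENNReal.ofReal (S.indicator (fun x => f x z.2) z.1
      + S.indicator (fun y => f y z.1) z.2) ≤ ENNReal.ofReal 2 * (C * volume S) := by
  have hm : Measurable fun z : E n × E n => S.indicator (fun x => f x z.2) z.1 := by
    have : (fun z : E n × E n => S.indicator (fun x => f x z.2) z.1) =
        (Prod.fst ⁻¹' S).indicator (fun z : E n × E n => f z.1 z.2) := by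
      ext z; by_cases hz : z.1 ∈ S <;> simp [indicator, hz]
    rw [this]
    exact hf.indicator (measurable_fst hS)
  have h1 : ∫⁻ z : E n × E n, ENNReal.ofReal (S.indicator (fun x => f x z.2) z.1)
      ≤ C * volume S := by
    rw [Measure.volume_eq_prod, lintegral_prod _ hm.ennreal_ofReal.aemeasurable]
    calc _ ≤ ∫⁻ x : E n, S.indicator (fun _ => C) x := by
          refine lintegral_mono fun x => ?_
          by_cases hx : x ∈ S
          · simpa [hx] using h x hx
          · simp [hx]
      _ = C * volume S := by rw [lintegral_indicator hS, setLIntegral_const]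
  have h2 : ∫⁻ z : E n × E n, ENNReal.ofReal (S.indicator (fun y => f y z.1) z.2)
      = ∫⁻ z : E n × E n, ENNReal.ofReal (S.indicator (fun x => f x z.2) z.1) :=
    (Measure.measurePreserving_swap (μ := (volume : Measure (E n)))
      (ν := (volume : Measure (E n)))).lintegral_comp hm.ennreal_ofReal
  calc _ ≤ _ := lintegral_ofReal_add_le' hm
    _ ≤ C * volume S + C * volume S := by rw [h2]; exact add_le_add h1 h1
    _ = _ := by rw [ENNReal.ofReal_ofNat, two_mul]

/-! ### Invariance of weak solutions -/

section Invariance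

variable {s t p q : ℝ} {a Ksp Ktq : E n → E n → ℝ} {Ω : Set (E n)} {u v : E n → ℝ}

lemma ae_pair {P : E n → Prop} (h : ∀ᵐ x, P x) : ∀ᵐ z : E n × E n, P z.1 ∧ P z.2 := by
  filter_upwards [Measure.quasiMeasurePreserving_fst.ae h,
    Measure.quasiMeasurePreserving_snd.ae h] with z h1 h2 using ⟨h1, h2⟩

lemma MemA.congr_ae (hu : MemA s t p q a Ω u) (h : u =ᵐ[volume] v) : MemA s t p q a Ω v where
  aemeasurable := hu.aemeasurable.congr h
  memLp := hu.memLp.ae_eq (ae_restrict_of_ae h)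
  energy_lt_top := by
    refine (le_of_eq (lintegral_congr_ae (ae_restrict_of_ae ?_))).trans_lt hu.energy_lt_top
    filter_upwards [ae_pair h] with z hz
    rw [hz.1, hz.2]

lemma IsWeakSolution.congr_ae (hu : IsWeakSolution s t p q a Ksp Ktq Ω u) (h : u =ᵐ[volume] v) :
    IsWeakSolution s t p q a Ksp Ktq Ω v where
  memA := hu.memA.congr_ae h
  weak_form φ hφ hφ0 := by
    have e : weakIntegrand p q a Ksp Ktq u φ =ᵐ[volume.restrict (crossSet Ω)]
        weakIntegrand p q a Ksp Ktq v φ := by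
      refine ae_restrict_of_ae ?_
      filter_upwards [ae_pair h] with z hz
      rw [weakIntegrand, weakIntegrand, hz.1, hz.2]
    obtain ⟨h1, h2⟩ := hu.weak_form φ hφ hφ0
    exact ⟨h1.congr e, by rw [← h2]; exact (integral_congr_ae e).symm⟩

lemma IsWeakSolution.neg (hu : IsWeakSolution s t p q a Ksp Ktq Ω u) :
    IsWeakSolution s t p q a Ksp Ktq Ω (fun x => -u x) where
  memA :=
    { aemeasurable := hu.memA.aemeasurable.neg
      memLp := hu.memA.memLp.neg
      energy_lt_top := by
        refine (le_of_eq (lintegral_congr fun z => ?_)).trans_lt hu.memA.energy_lt_top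
        have : -u z.1 - -u z.2 = -(u z.1 - u z.2) := by ring
        rw [this, abs_neg] }
  weak_form φ hφ hφ0 := by
    have e : weakIntegrand p q a Ksp Ktq (fun x => -u x) φ =
        fun z => -weakIntegrand p q a Ksp Ktq u φ z := by
      ext z
      have : -u z.1 - -u z.2 = -(u z.1 - u z.2) := by ring
      simp only [weakIntegrand]
      rw [this, abs_neg]; ring
    obtain ⟨h1, h2⟩ := hu.weak_form φ hφ hφ0
    rw [e]
    exact ⟨h1.neg, by rw [integral_neg, h2, neg_zero]⟩

lemma IsWeakSolution.add_const (hu : IsWeakSolution s t p q a Ksp Ktq Ω u)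
    (hΩ : Bornology.IsBounded Ω) (c : ℝ) :
    IsWeakSolution s t p q a Ksp Ktq Ω (fun x => u x + c) := by
  have e : ∀ x y, u x + c - (u y + c) = u x - u y := fun x y => by ring
  have : IsFiniteMeasure (volume.restrict Ω) :=
    ⟨by rw [Measure.restrict_apply_univ]; exact hΩ.measure_lt_top⟩
  refine ⟨⟨hu.memA.aemeasurable.add_const c, hu.memA.memLp.add (memLp_const c), ?_⟩, ?_⟩
  · simp only [e]; exact hu.memA.energy_lt_top
  · intro φ hφ hφ0
    have e2 : weakIntegrand p q a Ksp Ktq (fun x => u x + c) φ =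
        weakIntegrand p q a Ksp Ktq u φ := by
      ext z; simp only [weakIntegrand, e]
    rw [e2]
    exact hu.weak_form φ hφ hφ0

end Invariance

/-! ### Admissibility of the test function -/

lemma measurable_symmetrized {S : Set (E n)} (hS : MeasurableSet S) {f : E n → E n → ℝ}
    (hf : Measurable fun z : E n × E n => f z.1 z.2) :
    Measurable fun z : E n × E n => S.indicator (fun x => f x z.2) z.1
      + S.indicator (fun y => f y z.1) z.2 := by
  have e1 : (fun z : E n × E n => S.indicator (fun x => f x z.2) z.1) =
      (Prod.fst ⁻¹' S).indicator (fun z => f z.1 z.2) := by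
    ext z; by_cases hz : z.1 ∈ S <;> simp [indicator, hz]
  have e2 : (fun z : E n × E n => S.indicator (fun y => f y z.1) z.2) =
      (Prod.snd ⁻¹' S).indicator (fun z => f z.2 z.1) := by
    ext z; by_cases hz : z.2 ∈ S <;> simp [indicator, hz]
  have m1 := hf.indicator (measurable_fst (α := E n) (β := E n) hS)
  have m2 := (hf.comp measurable_swap).indicator (measurable_snd (α := E n) (β := E n) hS)
  rw [← e1] at m1
  exact m1.add (by rw [e2]; exact m2)

section Test

variable {s t p q Λ A α L : ℝ} {a Ksp Ktq : E n → E n → ℝ} {x₀ : E n} {r R k : ℝ}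
  {ψ u : E n → ℝ}

lemma measurable_barrierTest (hψ : IsBarrier x₀ r k ψ) (hr : 0 < r) (hu : Measurable u) :
    Measurable (barrierTest x₀ r ψ u) :=
  (((hψ.continuous hr).measurable.sub hu).max measurable_const).indicator measurableSet_ball

lemma barrierTest_sub_le (hψ : IsBarrier x₀ r k ψ) (hr : 0 < r) (hR : 2 * r ≤ R) {x y : E n}
    (hux : x ∈ Metric.ball x₀ R → 0 ≤ u x) (huy : y ∈ Metric.ball x₀ R → 0 ≤ u y)
    (hx : x ∈ Metric.ball x₀ r) :
    |barrierTest x₀ r ψ u x - barrierTest x₀ r ψ u y| ≤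
      |u x - u y| + k * min 1 (2 * ‖x - y‖ / r) := by
  have hxR : x ∈ Metric.ball x₀ R := Metric.ball_subset_ball (by linarith) hx
  by_cases hy : y ∈ Metric.ball x₀ R
  · rw [barrierTest_eq hψ (hux hxR), barrierTest_eq hψ (huy hy)]
    have h1 := abs_max_sub_max_le_abs (ψ x - u x) (ψ y - u y) 0
    have h2 : ψ x - u x - (ψ y - u y) = (ψ x - ψ y) - (u x - u y) := by ring
    rw [h2] at h1
    linarith [abs_sub (ψ x - ψ y) (u x - u y), hψ.abs_sub_le x y]
  · have hy0 : barrierTest x₀ r ψ u y = 0 := by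
      refine indicator_of_notMem (fun h => hy ?_) _
      exact Metric.ball_subset_ball (by linarith) h
    have hdist : r ≤ ‖x - y‖ := by
      rw [Metric.mem_ball, dist_eq_norm] at hx
      rw [Metric.mem_ball, dist_eq_norm, not_lt] at hy
      have := norm_sub_le_norm_sub_add_norm_sub y x x₀
      rw [norm_sub_rev y x] at this
      linarith
    have hmin : min 1 (2 * ‖x - y‖ / r) = 1 := by
      apply min_eq_left
      rw [le_div_iff₀ hr]; linarith
    rw [hy0, sub_zero, abs_of_nonneg (barrierTest_nonneg x), hmin, mul_one]
    linarith [barrierTest_le hψ (u := u) (x := x) fun _ => hux hxR, abs_nonneg (u x - u y)]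

lemma H_div_norm_eq (he : Exponents n s t p q Λ A α L) (x y : E n) (τ : ℝ) :
    H s t p q a x y τ / ‖x - y‖ ^ (n : ℝ) =
      τ ^ p * weight (s * p) x y + a x y * (τ ^ q * weight (t * q) x y) := by
  have key : ∀ β : ℝ, 0 < β → ∀ c : ℝ, c / ‖x - y‖ ^ β / ‖x - y‖ ^ (n : ℝ) = c * weight β x y := by
    intro β hβ c
    rcases (norm_nonneg (x - y)).eq_or_lt with h | h
    · rw [weight, ← h, Real.zero_rpow hβ.ne', Real.zero_rpow (by positivity : (n : ℝ) + β ≠ 0)]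
      simp
    · rw [weight, Real.rpow_add h]
      field_simp
  rw [H, add_div, key _ he.sp_pos, mul_div_assoc, key _ he.tq_pos]

lemma barrierEnergy_nonneg (ho : IsOperator s t p q Λ A α L a Ksp Ktq) (hk : 0 ≤ k) (hr : 0 < r)
    (x y : E n) : 0 ≤ barrierEnergy s t p q a r k x y := by
  have h0 : 0 ≤ min 1 (2 * ‖x - y‖ / r) := le_min zero_le_one (by positivity)
  have h1 := weight_nonneg (s * p) x y
  have h2 := weight_nonneg (t * q) x y
  have h3 := ho.coeff.nonneg x y
  unfold barrierEnergy
  positivity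

lemma barrierEnergy_comm (ho : IsOperator s t p q Λ A α L a Ksp Ktq) (x y : E n) :
    barrierEnergy s t p q a r k x y = barrierEnergy s t p q a r k y x := by
  unfold barrierEnergy
  rw [norm_sub_rev, weight_comm (s * p), weight_comm (t * q), ho.coeff.symm]

lemma measurable_barrierEnergy (he : Exponents n s t p q Λ A α L)
    (ho : IsOperator s t p q Λ A α L a Ksp Ktq) :
    Measurable fun z : E n × E n => barrierEnergy s t p q a r k z.1 z.2 := by
  have h1 := measurable_weight (n := n) (s * p)
  have h2 := measurable_weight (n := n) (t * q)
  have h3 := (ho.coeff_continuous he).measurable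
  unfold barrierEnergy
  fun_prop

lemma phase_sum_add_le {X Y W₁ W₂ b : ℝ} (hp : 0 ≤ p) (hpq : p ≤ q) (hX : 0 ≤ X) (hY : 0 ≤ Y)
    (h₁ : 0 ≤ W₁) (h₂ : 0 ≤ W₂) (hb : 0 ≤ b) :
    (X + Y) ^ p * W₁ + b * ((X + Y) ^ q * W₂) ≤
      2 ^ q * ((X ^ p * W₁ + b * (X ^ q * W₂)) + (Y ^ p * W₁ + b * (Y ^ q * W₂))) := by
  have h3 : (2 : ℝ) ^ p ≤ 2 ^ q := Real.rpow_le_rpow_of_exponent_le (by norm_num) hpq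
  calc _ ≤ (2 ^ p * (X ^ p + Y ^ p)) * W₁ + b * ((2 ^ q * (X ^ q + Y ^ q)) * W₂) := by
        gcongr
        · exact add_rpow_le hX hY hp
        · exact add_rpow_le hX hY (hp.trans hpq)
    _ ≤ (2 ^ q * (X ^ p + Y ^ p)) * W₁ + b * ((2 ^ q * (X ^ q + Y ^ q)) * W₂) := by gcongr
    _ = _ := by ring

/-- The test function is admissible: its jumps are those of `u` plus those of a barrier. -/
lemma memA_barrierTest (he : Exponents n s t p q Λ A α L)
    (ho : IsOperator s t p q Λ A α L a Ksp Ktq) {Ω : Set (E n)} (hΩ : Bornology.IsBounded Ω)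
    (huA : MemA s t p q a Ω u) (hum : Measurable u)
    (hψ : IsBarrier x₀ r k ψ) (hr : 0 < r) (hr1 : r ≤ 1) (hR : 2 * r ≤ R) (hk : 0 < k)
    (hu : ∀ᵐ x, x ∈ Metric.ball x₀ R → 0 ≤ u x) :
    MemA s t p q a Ω (barrierTest x₀ r ψ u) := by
  have hm := measurable_barrierTest hψ hr hum
  have hp1 := he.one_lt_p
  have : IsFiniteMeasure (volume.restrict Ω) :=
    ⟨by rw [Measure.restrict_apply_univ]; exact hΩ.measure_lt_top⟩
  refine ⟨hm.aemeasurable, ?_, ?_⟩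
  · refine MemLp.of_bound hm.aestronglyMeasurable k (ae_restrict_of_ae ?_)
    filter_upwards [hu] with x hx
    rw [Real.norm_of_nonneg (barrierTest_nonneg x)]
    exact barrierTest_le hψ fun h => hx (Metric.ball_subset_ball (by linarith) h)
  · obtain ⟨C, -, hC⟩ := lintegral_barrier_energy_le he hk
    set S := Metric.ball x₀ r
    set N : E n × E n → ℝ := fun z => S.indicator (fun x => barrierEnergy s t p q a r k x z.2) z.1
      + S.indicator (fun y => barrierEnergy s t p q a r k y z.1) z.2 with hN
    have hint := lintegral_symmetrized_le (S := S) measurableSet_ball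
      (measurable_barrierEnergy (r := r) (k := k) he ho)
      (fun x hx => hC a Ksp Ktq ho x₀ x r k hr hr1 hk le_rfl hx)
    have hNm : Measurable N :=
      measurable_symmetrized measurableSet_ball (measurable_barrierEnergy he ho)
    have hN0 : ∀ z, 0 ≤ N z := fun z => add_nonneg
      (indicator_nonneg (fun _ _ => barrierEnergy_nonneg ho hk.le hr _ _) _)
      (indicator_nonneg (fun _ _ => barrierEnergy_nonneg ho hk.le hr _ _) _)
    have hpt : ∀ᵐ z : E n × E n, ENNReal.ofReal (H s t p q a z.1 z.2
        |barrierTest x₀ r ψ u z.1 - barrierTest x₀ r ψ u z.2| / ‖z.1 - z.2‖ ^ (n : ℝ)) ≤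
        ENNReal.ofReal (2 ^ q) * (ENNReal.ofReal (N z) + ENNReal.ofReal
          (H s t p q a z.1 z.2 |u z.1 - u z.2| / ‖z.1 - z.2‖ ^ (n : ℝ))) := by
      filter_upwards [ae_pair hu] with ⟨x, y⟩ hz
      simp only at hz ⊢
      have w1 := weight_nonneg (s * p) x y
      have w2 := weight_nonneg (t * q) x y
      have w3 := ho.coeff.nonneg x y
      rw [H_div_norm_eq he, H_div_norm_eq he, ← ENNReal.ofReal_add (hN0 _) (by positivity),
        ← ENNReal.ofReal_mul (by positivity)]
      apply ENNReal.ofReal_le_ofReal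
      have hEn := barrierEnergy_nonneg ho hk.le hr x y
      have hm0 : 0 ≤ k * min 1 (2 * ‖x - y‖ / r) :=
        mul_nonneg hk.le (le_min zero_le_one (by positivity))
      have main : ∀ D : ℝ, 0 ≤ D → D ≤ |u x - u y| + k * min 1 (2 * ‖x - y‖ / r) →
          D ^ p * weight (s * p) x y + a x y * (D ^ q * weight (t * q) x y) ≤
          2 ^ q * (barrierEnergy s t p q a r k x y + (|u x - u y| ^ p * weight (s * p) x y
            + a x y * (|u x - u y| ^ q * weight (t * q) x y))) := by
        intro D hD0 hD
        have hq1 := he.one_lt_q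
        have := phase_sum_add_le (by linarith) he.p_le (abs_nonneg (u x - u y)) hm0 w1 w2 w3
        refine le_trans ?_ (this.trans (le_of_eq ?_))
        · gcongr
        · rw [barrierEnergy]; ring
      by_cases hx : x ∈ S
      · refine (main _ (abs_nonneg _) (barrierTest_sub_le hψ hr hR hz.1 hz.2 hx)).trans ?_
        have : barrierEnergy s t p q a r k x y ≤ N (x, y) := by
          simp only [hN, indicator_of_mem hx]
          linarith [indicator_nonneg (s := S) (f := fun y => barrierEnergy s t p q a r k y x)
            (fun _ _ => barrierEnergy_nonneg ho hk.le hr _ _) y]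
        gcongr
      · by_cases hy : y ∈ S
        · have h := barrierTest_sub_le hψ hr hR hz.2 hz.1 hy
          rw [abs_sub_comm, abs_sub_comm (u y), norm_sub_rev y] at h
          refine (main _ (abs_nonneg _) h).trans ?_
          have : barrierEnergy s t p q a r k x y ≤ N (x, y) := by
            simp only [hN, indicator_of_mem hy, indicator_of_notMem hx]
            rw [barrierEnergy_comm ho, zero_add]
          gcongr
        · rw [barrierTest, indicator_of_notMem hx, indicator_of_notMem hy, sub_zero, abs_zero,
            Real.zero_rpow (by linarith), Real.zero_rpow (by linarith [he.p_le])]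
          have := hN0 (x, y)
          simp only [zero_mul, mul_zero, add_zero]
          positivity
    calc _ ≤ ∫⁻ z in crossSet Ω, ENNReal.ofReal (2 ^ q) * (ENNReal.ofReal (N z) + ENNReal.ofReal
          (H s t p q a z.1 z.2 |u z.1 - u z.2| / ‖z.1 - z.2‖ ^ (n : ℝ))) :=
          lintegral_mono_ae (ae_restrict_of_ae hpt)
      _ = ENNReal.ofReal (2 ^ q) * ((∫⁻ z in crossSet Ω, ENNReal.ofReal (N z)) +
          ∫⁻ z in crossSet Ω, ENNReal.ofReal
          (H s t p q a z.1 z.2 |u z.1 - u z.2| / ‖z.1 - z.2‖ ^ (n : ℝ))) := by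
          rw [lintegral_const_mul' _ _ ENNReal.ofReal_ne_top,
            lintegral_add_left hNm.ennreal_ofReal]
      _ < ∞ := by
          refine ENNReal.mul_lt_top ENNReal.ofReal_lt_top (ENNReal.add_lt_top.2
            ⟨(setLIntegral_le_lintegral _ _).trans_lt (hint.trans_lt ?_), huA.energy_lt_top⟩)
          exact ENNReal.mul_lt_top ENNReal.ofReal_lt_top
            (ENNReal.mul_lt_top ENNReal.ofReal_lt_top measure_ball_lt_top)

end Test

/-! ### The energy inequality -/

/-- The density at `y` of the tail of the negative part of `U`, seen from `x`. -/
noncomputable def tailDensity (s t p q : ℝ) (a : E n → E n → ℝ) (U : E n → ℝ) (x y : E n) : ℝ :=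
  max (-U y) 0 ^ (p - 1) * weight (s * p) x y
    + a x y * (max (-U y) 0 ^ (q - 1) * weight (t * q) x y)

/-- The part of the tail of the negative part of `u` off `B_R(x₀)`, seen from `B_r(x₀)`, is at most
the flux of a bump of height `k`. -/
def TailBound (s t p q : ℝ) (a : E n → E n → ℝ) (x₀ : E n) (r R k : ℝ) (u : E n → ℝ) : Prop :=
  ∀ x ∈ Metric.ball x₀ r, ∫⁻ y in (Metric.ball x₀ R)ᶜ,
    ENNReal.ofReal (tailDensity s t p q a u x y) ≤ ENNReal.ofReal (flux s t p q (a x₀ x₀) r k)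

section

variable {s t p q Λ A α L : ℝ} {a Ksp Ktq : E n → E n → ℝ} {x₀ : E n} {r R k : ℝ}
  {ψ u : E n → ℝ}

lemma measurable_phaseError (hum : Measurable u) (P : ℝ) :
    Measurable fun z : E n × E n => phaseError P k r R x₀ u z.1 z.2 := by
  have h1 : Measurable fun y => (Metric.ball x₀ R)ᶜ.indicator
      (fun y => k * max (-u y) 0 ^ (P - 1)) y :=
    Measurable.indicator (by fun_prop) measurableSet_ball.compl
  have h2 : Measurable fun z : E n × E n => (Metric.ball x₀ R)ᶜ.indicator
      (fun y => k * max (-u y) 0 ^ (P - 1)) z.2 := h1.comp measurable_snd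
  unfold phaseError
  exact Measurable.add (by fun_prop) h2

lemma measurableSet_belowSet (hψ : IsBarrier x₀ r k ψ) (hr : 0 < r) (hum : Measurable u) :
    MeasurableSet (belowSet x₀ r ψ u) :=
  measurableSet_ball.inter (measurableSet_lt hum (hψ.continuous hr).measurable)

/-- The error density of the energy inequality, both phases together. -/
noncomputable def errorDensity (s t p q : ℝ) (a : E n → E n → ℝ) (k r R : ℝ) (x₀ : E n)
    (u : E n → ℝ) (x y : E n) : ℝ :=
  phaseError p k r R x₀ u x y * weight (s * p) x y
    + a x y * (phaseError q k r R x₀ u x y * weight (t * q) x y)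

lemma errorDensity_nonneg (ho : IsOperator s t p q Λ A α L a Ksp Ktq) (hk : 0 ≤ k) (hr : 0 < r)
    (x y : E n) : 0 ≤ errorDensity s t p q a k r R x₀ u x y := by
  have h1 := weight_nonneg (s * p) x y
  have h2 := weight_nonneg (t * q) x y
  have h3 := ho.coeff.nonneg x y
  have h4 := phaseError_nonneg (p := p) (R := R) (x₀ := x₀) (u := u) hk hr x y
  have h5 := phaseError_nonneg (p := q) (R := R) (x₀ := x₀) (u := u) hk hr x y
  unfold errorDensity
  positivity

lemma measurable_errorDensity (he : Exponents n s t p q Λ A α L)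
    (ho : IsOperator s t p q Λ A α L a Ksp Ktq) (hum : Measurable u) :
    Measurable fun z : E n × E n => errorDensity s t p q a k r R x₀ u z.1 z.2 := by
  have h1 := measurable_weight (n := n) (s * p)
  have h2 := measurable_weight (n := n) (t * q)
  have h3 := (ho.coeff_continuous he).measurable
  have h4 := measurable_phaseError (x₀ := x₀) (r := r) (R := R) (k := k) hum p
  have h5 := measurable_phaseError (x₀ := x₀) (r := r) (R := R) (k := k) hum q
  exact (h4.mul h1).add (h3.mul (h5.mul h2))

lemma lintegral_errorDensity_le (he : Exponents n s t p q Λ A α L) {M : ℝ} (hM : 0 < M) :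
    ∃ C : ℝ, 0 < C ∧ ∀ a Ksp Ktq : E n → E n → ℝ, IsOperator s t p q Λ A α L a Ksp Ktq →
      ∀ (u : E n → ℝ) (x₀ x : E n) (r R k : ℝ), Measurable u → 0 < r → r ≤ 1 → 0 < k → k ≤ M →
      x ∈ Metric.ball x₀ r → TailBound s t p q a x₀ r R k u →
      ∫⁻ y, ENNReal.ofReal (errorDensity s t p q a k r R x₀ u x y)
        ≤ ENNReal.ofReal (C * (k * flux s t p q (a x₀ x₀) r k)) := by
  obtain ⟨C, hC0, hC⟩ := lintegral_barrier_energy_le he hM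
  refine ⟨C + 1, by positivity, fun a Ksp Ktq ho u x₀ x r R k hum hr hr1 hk hkM hx hT => ?_⟩
  have hfl := flux_nonneg (s := s) (t := t) (p := p) (q := q) (ho.coeff.nonneg x₀ x₀) hr.le hk.le
  set T : E n → ℝ := tailDensity s t p q a u x with hT'
  have e : ∀ y, errorDensity s t p q a k r R x₀ u x y = barrierEnergy s t p q a r k x y +
      (Metric.ball x₀ R)ᶜ.indicator (fun y => k * T y) y := by
    intro y
    rw [errorDensity, barrierEnergy, phaseError, phaseError]
    by_cases hy : y ∈ (Metric.ball x₀ R)ᶜ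
    · simp only [indicator_of_mem hy, hT', tailDensity]; ring
    · simp only [indicator_of_notMem hy]; ring
  simp_rw [e]
  have hm : Measurable fun y => barrierEnergy s t p q a r k x y := by
    have h : Measurable (Function.uncurry (barrierEnergy s t p q a r k)) :=
      measurable_barrierEnergy he ho
    exact h.of_uncurry_left
  calc _ ≤ _ := lintegral_ofReal_add_le' hm
    _ ≤ ENNReal.ofReal (C * (k * flux s t p q (a x₀ x₀) r k)) +
        ENNReal.ofReal (k * flux s t p q (a x₀ x₀) r k) := by
        refine add_le_add (hC a Ksp Ktq ho x₀ x r k hr hr1 hk hkM hx) ?_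
        have e2 : ∀ y, ENNReal.ofReal ((Metric.ball x₀ R)ᶜ.indicator (fun y => k * T y) y) =
            (Metric.ball x₀ R)ᶜ.indicator (fun y => ENNReal.ofReal (k * T y)) y := by
          intro y
          by_cases hy : y ∈ (Metric.ball x₀ R)ᶜ
          · simp only [indicator_of_mem hy]
          · simp only [indicator_of_notMem hy, ENNReal.ofReal_zero]
        simp_rw [e2]
        rw [lintegral_indicator measurableSet_ball.compl, lintegral_const_mul_ofReal hk.le,
          ENNReal.ofReal_mul hk.le]
        gcongr
        exact hT x hx
    _ = _ := by rw [← ENNReal.ofReal_add (by positivity) (by positivity)]; congr 1; ring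

/-- Testing the equation with `(ψ - u)₊`: the interaction between a set where `u` is below the
barrier and a set where it is above is controlled by the measure of the set where `u` is below the
barrier. -/
lemma lintegral_interaction_le (he : Exponents n s t p q Λ A α L) {M : ℝ} (hM : 0 < M) :
    ∃ C : ℝ, 0 < C ∧ ∀ a Ksp Ktq : E n → E n → ℝ, IsOperator s t p q Λ A α L a Ksp Ktq →
      ∀ (Ω : Set (E n)) (u : E n → ℝ), Bornology.IsBounded Ω → Measurable u →
      IsWeakSolution s t p q a Ksp Ktq Ω u →
      ∀ (x₀ : E n) (r R k : ℝ), 0 < r → r ≤ 1 → 2 * r ≤ R → 0 < k → k ≤ M →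
      Metric.ball x₀ R ⊆ Ω → (∀ᵐ x, x ∈ Metric.ball x₀ R → 0 ≤ u x) →
      TailBound s t p q a x₀ r R k u →
      ∀ ψ : E n → ℝ, IsBarrier x₀ r k ψ →
      ∀ (X Y : Set (E n)) (h₀ g₀ : ℝ), MeasurableSet X → MeasurableSet Y → 0 < h₀ → 0 < g₀ →
      (∀ x ∈ X, x ∈ Metric.ball x₀ r ∧ h₀ ≤ ψ x - u x) →
      (∀ y ∈ Y, y ∈ Metric.ball x₀ r ∧ ψ y ≤ u y) →
      (∀ x ∈ X, ∀ y ∈ Y, g₀ ≤ ψ x - u x + (u y - ψ y)) →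
      ∫⁻ z in X ×ˢ Y, ENNReal.ofReal (h₀ * (g₀ ^ (p - 1) * weight (s * p) z.1 z.2
          + a z.1 z.2 * (g₀ ^ (q - 1) * weight (t * q) z.1 z.2)))
        ≤ ENNReal.ofReal (C * (k * flux s t p q (a x₀ x₀) r k)) *
          volume (belowSet x₀ r ψ u) := by
  obtain ⟨C, hC0, hC⟩ := lintegral_errorDensity_le he hM
  have hΛ := he.Λ_pos
  have hp1 := he.one_lt_p
  have hpq := he.p_le
  set c : ℝ := Λ⁻¹ * 2 ^ (1 - q) with hc
  have hc0 : 0 < c := by positivity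
  set D : ℝ := 2 ^ (q + 2) * Λ with hD
  have hD0 : 0 < D := by positivity
  refine ⟨c⁻¹ * (2 * D * C), by positivity, ?_⟩
  intro a Ksp Ktq ho Ω u hΩ hum hsol x₀ r R k hr hr1 hR hk hkM hBR hu hT ψ hψ X Y h₀ g₀ hXm hYm
    hh₀ hg₀ hX hY hXY
  set S := belowSet x₀ r ψ u with hS
  have hSm : MeasurableSet S := measurableSet_belowSet hψ hr hum
  set φ := barrierTest x₀ r ψ u with hφ
  set I : E n × E n → ℝ := fun z => h₀ * (g₀ ^ (p - 1) * weight (s * p) z.1 z.2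
          + a z.1 z.2 * (g₀ ^ (q - 1) * weight (t * q) z.1 z.2)) with hI
  set f : E n → E n → ℝ := fun x y => D * errorDensity s t p q a k r R x₀ u x y with hf
  have hfm : Measurable fun z : E n × E n => f z.1 z.2 :=
    (measurable_errorDensity he ho hum).const_mul D
  have hf0 : ∀ x y, 0 ≤ f x y := fun x y => mul_nonneg hD0.le (errorDensity_nonneg ho hk.le hr x y)
  set N : E n × E n → ℝ := fun z => S.indicator (fun x => f x z.2) z.1
      + S.indicator (fun y => f y z.1) z.2 with hN
  have hNm : Measurable N := measurable_symmetrized hSm hfm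
  have hN0 : ∀ z, 0 ≤ N z := fun z => add_nonneg
    (indicator_nonneg (fun _ _ => hf0 _ _) _) (indicator_nonneg (fun _ _ => hf0 _ _) _)
  have hI0 : ∀ z, 0 ≤ I z := fun z => by
    have h1 := weight_nonneg (s * p) z.1 z.2
    have h2 := weight_nonneg (t * q) z.1 z.2
    have h3 := ho.coeff.nonneg z.1 z.2
    simp only [hI]; positivity
  obtain ⟨hint, hzero⟩ := hsol.weak_form φ
    (memA_barrierTest he ho hΩ hsol.memA hum hψ hr hr1 hR hk hu)
    (Filter.Eventually.of_forall fun x hx => indicator_of_notMem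
      (fun h => hx (hBR (Metric.ball_subset_ball (by linarith) h))) _)
  -- the pointwise bounds of the two phases, the second one multiplied by the coefficient, add up
  have hpt : ∀ᵐ z : E n × E n, (X ×ˢ Y).indicator (fun z => c * I z) z ≤
      -weakIntegrand p q a Ksp Ktq u φ z + N z := by
    filter_upwards [ae_pair hu, ho.kernel_sp.bounds, ho.kernel_tq.bounds] with ⟨x, y⟩ hz hk1 hk2
    simp only at hz hk1 hk2
    have e1 : ∀ (c : ℝ) (b : ℝ), c / ‖x - y‖ ^ ((n : ℝ) + b) = c * weight b x y := fun c b => by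
      rw [weight, mul_one_div]
    rw [e1, e1] at hk1 hk2
    have b1 := pair_bound hp1 hpq hψ hr hR (weight_nonneg (s * p) x y) hΛ hk1.1 hk1.2 hh₀ hg₀.le
      hX hY hXY hz.1 hz.2
    have b2 := mul_le_mul_of_nonneg_left (pair_bound he.one_lt_q le_rfl hψ hr hR
      (weight_nonneg (t * q) x y) hΛ hk2.1 hk2.2 hh₀ hg₀.le hX hY hXY hz.1 hz.2)
      (ho.coeff.nonneg x y)
    have e2 : weakIntegrand p q a Ksp Ktq u φ (x, y) =
        |u x - u y| ^ (p - 2) * (u x - u y) * (φ x - φ y) * Ksp x y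
        + a x y * (|u x - u y| ^ (q - 2) * (u x - u y) * (φ x - φ y) * Ktq x y) := by
      simp only [weakIntegrand]; ring
    have e3 : (X ×ˢ Y).indicator (fun z => c * I z) (x, y) =
        (X ×ˢ Y).indicator (fun _ => Λ⁻¹ * 2 ^ (1 - q) * (h₀ * g₀ ^ (p - 1)) *
          weight (s * p) x y) (x, y) +
        a x y * (X ×ˢ Y).indicator (fun _ => Λ⁻¹ * 2 ^ (1 - q) * (h₀ * g₀ ^ (q - 1)) *
          weight (t * q) x y) (x, y) := by
      by_cases h : (x, y) ∈ X ×ˢ Y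
      · simp only [indicator_of_mem h, hI, hc]; ring
      · simp only [indicator_of_notMem h]; ring
    have e4 : N (x, y) =
        (S.indicator (fun x => 2 ^ (q + 2) * Λ * phaseError p k r R x₀ u x y *
            weight (s * p) x y) x
          + S.indicator (fun y => 2 ^ (q + 2) * Λ * phaseError p k r R x₀ u y x *
            weight (s * p) x y) y) +
        a x y * (S.indicator (fun x => 2 ^ (q + 2) * Λ * phaseError q k r R x₀ u x y *
            weight (t * q) x y) x
          + S.indicator (fun y => 2 ^ (q + 2) * Λ * phaseError q k r R x₀ u y x *
            weight (t * q) x y) y) := by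
      simp only [indicator]
      have c1 := weight_comm (s * p) x y
      have c2 := weight_comm (t * q) x y
      have c3 := ho.coeff.symm x y
      simp only [hN, hf, errorDensity, hD, indicator, c1, c2, c3]
      split_ifs <;> ring
    have e5 : (belowSet x₀ r ψ u).indicator (fun x' => 2 ^ (q + 2) * Λ *
        phaseError p k r R x₀ u x' y * weight (s * p) x y) x = S.indicator (fun x' => 2 ^ (q + 2) *
        Λ * phaseError p k r R x₀ u x' y * weight (s * p) x' y) x := by
      simp only [indicator, hS]
    rw [e2, e3, e4]
    simp only [indicator] at b1 b2 ⊢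
    linarith
  -- all of `X × Y` is seen by the weak formulation
  have hcross : X ×ˢ Y ⊆ crossSet Ω := by
    rintro z hz hz'
    exact hz'.1 (hBR (Metric.ball_subset_ball (by linarith) (hX z.1 hz.1).1))
  have hle := lintegral_le_of_integral_eq_zero (μ := volume.restrict (crossSet Ω)) hint.neg
    (by simp only [Pi.neg_apply]; rw [integral_neg, hzero, neg_zero]) hNm.aemeasurable
    (Filter.Eventually.of_forall hN0)
    (Filter.Eventually.of_forall fun z =>
      indicator_nonneg (fun z _ => mul_nonneg hc0.le (hI0 z)) z)
    (ae_restrict_of_ae hpt)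
  have hleft : ∫⁻ z in crossSet Ω, ENNReal.ofReal ((X ×ˢ Y).indicator (fun z => c * I z) z) =
      ENNReal.ofReal c * ∫⁻ z in X ×ˢ Y, ENNReal.ofReal (I z) := by
    have e2 : ∀ z, ENNReal.ofReal ((X ×ˢ Y).indicator (fun z => c * I z) z) =
        (X ×ˢ Y).indicator (fun z => ENNReal.ofReal (c * I z)) z := by
      intro z
      by_cases hz : z ∈ X ×ˢ Y
      · simp only [indicator_of_mem hz]
      · simp only [indicator_of_notMem hz, ENNReal.ofReal_zero]
    simp_rw [e2]
    rw [lintegral_indicator (hXm.prod hYm), Measure.restrict_restrict (hXm.prod hYm),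
      inter_eq_left.2 hcross, lintegral_const_mul_ofReal hc0.le]
  have hright : ∫⁻ z in crossSet Ω, ENNReal.ofReal (N z) ≤
      ENNReal.ofReal 2 *
        (ENNReal.ofReal (D * (C * (k * flux s t p q (a x₀ x₀) r k))) * volume S) := by
    refine (setLIntegral_le_lintegral _ _).trans (lintegral_symmetrized_le hSm hfm fun x hx => ?_)
    simp only [hf]
    rw [lintegral_const_mul_ofReal hD0.le, ENNReal.ofReal_mul hD0.le]
    gcongr
    exact hC a Ksp Ktq ho u x₀ x r R k hum hr hr1 hk hkM hx.1 hT
  rw [hleft] at hle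
  have hfin := hle.trans hright
  have hcinv : ENNReal.ofReal c⁻¹ * ENNReal.ofReal c = 1 := by
    rw [← ENNReal.ofReal_mul (by positivity), inv_mul_cancel₀ hc0.ne', ENNReal.ofReal_one]
  have hfl := flux_nonneg (s := s) (t := t) (p := p) (q := q) (ho.coeff.nonneg x₀ x₀) hr.le hk.le
  calc ∫⁻ z in X ×ˢ Y, ENNReal.ofReal (I z)
      = ENNReal.ofReal c⁻¹ * (ENNReal.ofReal c * ∫⁻ z in X ×ˢ Y, ENNReal.ofReal (I z)) := by
        rw [← mul_assoc, hcinv, one_mul]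
    _ ≤ ENNReal.ofReal c⁻¹ * (ENNReal.ofReal 2 * (ENNReal.ofReal (D *
          (C * (k * flux s t p q (a x₀ x₀) r k))) *
          volume S)) := by gcongr
    _ = _ := by
        rw [← mul_assoc, ← mul_assoc, ← ENNReal.ofReal_mul (by positivity),
          ← ENNReal.ofReal_mul (by positivity)]
        congr 2; ring

/-- At distance less than `τ r`, the interaction density of an excess `g` is, up to a constant, at
least `τ^{-sp} (τ r)^{-n}` times the flux of height `g`. The coefficient is frozen at `(x₀, x₀)` at
the expense of a multiple of the `p`-phase. -/
lemma density_lower (he : Exponents n s t p q Λ A α L)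
    (ho : IsOperator s t p q Λ A α L a Ksp Ktq) {M τ g : ℝ} (hr : 0 < r) (hr1 : r ≤ 1)
    (hτ : 0 < τ) (hτ1 : τ ≤ 1) (hg : 0 < g) (hgM : g ≤ M) {x y : E n}
    (hx : x ∈ Metric.ball x₀ r) (hy : y ∈ Metric.ball x₀ r) (hne : x ≠ y)
    (hxy : ‖x - y‖ < τ * r) :
    τ ^ (-(s * p)) * flux s t p q (a x₀ x₀) r g ≤
      (1 + L * 2 ^ α * M ^ (q - p)) * (τ * r) ^ n *
        (g ^ (p - 1) * weight (s * p) x y + a x y * (g ^ (q - 1) * weight (t * q) x y)) := by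
  have hd : 0 < ‖x - y‖ := norm_pos_iff.2 (sub_ne_zero.2 hne)
  have hL := he.L_nonneg
  have hM : 0 < M := hg.trans_le hgM
  have hρ : 0 < τ * r := by positivity
  have hw : ∀ β : ℝ, 0 < β → τ ^ (-β) * r ^ (-β) ≤ (τ * r) ^ n * weight β x y := by
    intro β hβ
    rw [← Real.mul_rpow hτ.le hr.le, weight, mul_one_div, le_div_iff₀ (by positivity)]
    calc (τ * r) ^ (-β) * ‖x - y‖ ^ ((n : ℝ) + β)
        ≤ (τ * r) ^ (-β) * (τ * r) ^ ((n : ℝ) + β) := by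
          gcongr
      _ = (τ * r) ^ n := by
          rw [← Real.rpow_add hρ, ← Real.rpow_natCast]; congr 1; ring
  have w1 := hw _ he.sp_pos
  have w2 := hw _ he.tq_pos
  have hττ : τ ^ (-(s * p)) ≤ τ ^ (-(t * q)) :=
    Real.rpow_le_rpow_of_exponent_ge hτ hτ1 (by linarith [he.sp_le_tq])
  have ha := ho.coeff.nonneg x y
  have hlow := ho.coeff_lower he hx hy
  have hgap := he.rpow_gap hr hr1
  have hh := he.rpow_height hg hgM
  have hlow2 : flux s t p q (a x₀ x₀) r g ≤ (1 + L * 2 ^ α * M ^ (q - p)) *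
      (g ^ (p - 1) * r ^ (-(s * p)) + a x y * (g ^ (q - 1) * r ^ (-(t * q)))) := by
    rw [Real.mul_rpow (by norm_num) hr.le] at hlow
    unfold flux
    set P := g ^ (p - 1)
    set Q := g ^ (q - 1)
    set Rp := r ^ (-(s * p))
    set Rq := r ^ (-(t * q))
    have hP : 0 ≤ P := by positivity
    have hQ : 0 ≤ Q := by positivity
    have hRp : 0 ≤ Rp := by positivity
    have hRq : 0 ≤ Rq := by positivity
    have i1 : a x₀ x₀ * (Q * Rq) ≤ (a x y + L * (2 ^ α * r ^ α)) * (Q * Rq) := by gcongr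
    have i2 : L * (2 ^ α * r ^ α) * (Q * Rq) ≤ L * 2 ^ α * M ^ (q - p) * (P * Rp) := by
      calc _ = L * 2 ^ α * Q * (r ^ α * Rq) := by ring
        _ ≤ L * 2 ^ α * (M ^ (q - p) * P) * Rp := by gcongr
        _ = _ := by ring
    have i3 : 0 ≤ L * 2 ^ α * M ^ (q - p) * (a x y * (Q * Rq)) := by positivity
    linarith
  calc _ ≤ τ ^ (-(s * p)) * ((1 + L * 2 ^ α * M ^ (q - p)) *
      (g ^ (p - 1) * r ^ (-(s * p)) + a x y * (g ^ (q - 1) * r ^ (-(t * q))))) := by gcongr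
    _ = (1 + L * 2 ^ α * M ^ (q - p)) * (g ^ (p - 1) * (τ ^ (-(s * p)) * r ^ (-(s * p)))
        + a x y * (g ^ (q - 1) * (τ ^ (-(s * p)) * r ^ (-(t * q))))) := by ring
    _ ≤ (1 + L * 2 ^ α * M ^ (q - p)) * (g ^ (p - 1) * (τ ^ (-(s * p)) * r ^ (-(s * p)))
        + a x y * (g ^ (q - 1) * (τ ^ (-(t * q)) * r ^ (-(t * q))))) := by gcongr
    _ ≤ (1 + L * 2 ^ α * M ^ (q - p)) * (g ^ (p - 1) * ((τ * r) ^ n * weight (s * p) x y)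
        + a x y * (g ^ (q - 1) * ((τ * r) ^ n * weight (t * q) x y))) := by gcongr
    _ = _ := by ring

lemma volume_real_ball (x : E n) {ρ : ℝ} (hρ : 0 < ρ) :
    volume.real (Metric.ball x ρ) = ρ ^ n * volume.real (Metric.ball (0 : E n) 1) := by
  rw [Measure.real, Measure.addHaar_ball_of_pos _ _ hρ, finrank_euclideanSpace_fin,
    ENNReal.toReal_mul, ENNReal.toReal_ofReal (by positivity)]; rfl

lemma volume_real_ball_pos (x : E n) {ρ : ℝ} (hρ : 0 < ρ) : 0 < volume.real (Metric.ball x ρ) :=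
  ENNReal.toReal_pos (Metric.measure_ball_pos _ _ hρ).ne' measure_ball_lt_top.ne

/-- The form of the energy inequality used below: only measures of level sets appear. The factor
`τ^{-sp}`, which grows as the scale `τ r` of the interaction shrinks, plays the role of the Sobolev
embedding. -/
theorem levelSet_inequality (he : Exponents n s t p q Λ A α L) {M : ℝ} (hM : 0 < M) :
    ∃ C : ℝ, 0 < C ∧ ∀ a Ksp Ktq : E n → E n → ℝ, IsOperator s t p q Λ A α L a Ksp Ktq →
      ∀ (Ω : Set (E n)) (u : E n → ℝ), Bornology.IsBounded Ω → Measurable u →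
      IsWeakSolution s t p q a Ksp Ktq Ω u →
      ∀ (x₀ : E n) (r R k : ℝ), 0 < r → r ≤ 1 → 2 * r ≤ R → 0 < k → k ≤ M →
      Metric.ball x₀ R ⊆ Ω → (∀ᵐ x, x ∈ Metric.ball x₀ R → 0 ≤ u x) →
      TailBound s t p q a x₀ r R k u →
      ∀ ψ : E n → ℝ, IsBarrier x₀ r k ψ →
      ∀ (X Y : Set (E n)) (h₀ g₀ κ τ : ℝ), MeasurableSet X → MeasurableSet Y → 0 < h₀ → 0 < g₀ →
      g₀ ≤ M → 0 ≤ κ → 0 < τ → τ ≤ 1 →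
      (∀ x ∈ X, x ∈ Metric.ball x₀ r ∧ h₀ ≤ ψ x - u x) →
      (∀ y ∈ Y, y ∈ Metric.ball x₀ r ∧ ψ y ≤ u y) →
      (∀ x ∈ X, ∀ y ∈ Y, g₀ ≤ ψ x - u x + (u y - ψ y)) →
      (∀ x ∈ X, κ * volume.real (Metric.ball x (τ * r)) ≤
        volume.real (Y ∩ Metric.ball x (τ * r))) →
      h₀ * κ * τ ^ (-(s * p)) * flux s t p q (a x₀ x₀) r g₀ * volume.real X ≤
        C * (k * flux s t p q (a x₀ x₀) r k) * volume.real (belowSet x₀ r ψ u) := by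
  obtain ⟨C, hC0, hC⟩ := lintegral_interaction_le he hM
  have hL := he.L_nonneg
  set V : ℝ := volume.real (Metric.ball (0 : E n) 1) with hV
  have hV0 : 0 < V := volume_real_ball_pos 0 one_pos
  set c : ℝ := 1 + L * 2 ^ α * M ^ (q - p) with hc
  have hc0 : 0 < c := by positivity
  refine ⟨c * V⁻¹ * C, by positivity, ?_⟩
  intro a Ksp Ktq ho Ω u hΩ hum hsol x₀ r R k hr hr1 hR hk hkM hBR hu hT ψ hψ X Y h₀ g₀ κ τ hXm hYm
    hh₀ hg₀ hgM hκ hτ hτ1 hX hY hXY hκX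
  have hmain := hC a Ksp Ktq ho Ω u hΩ hum hsol x₀ r R k hr hr1 hR hk hkM hBR hu hT ψ hψ X Y h₀ g₀
    hXm hYm hh₀ hg₀ hX hY hXY
  have hfg := flux_nonneg (s := s) (t := t) (p := p) (q := q) (ho.coeff.nonneg x₀ x₀) hr.le hg₀.le
  have hfk := flux_nonneg (s := s) (t := t) (p := p) (q := q) (ho.coeff.nonneg x₀ x₀) hr.le hk.le
  set G := flux s t p q (a x₀ x₀) r g₀
  set F := flux s t p q (a x₀ x₀) r k
  set ρ := τ * r with hρ
  have hρ0 : 0 < ρ := by positivity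
  set b : ℝ := h₀ * (c⁻¹ * (ρ ^ n)⁻¹ * (τ ^ (-(s * p)) * G)) with hb
  have hb0 : 0 ≤ b := by positivity
  -- only the pairs at distance less than `τ r` are used
  set T : Set (E n × E n) := (X ×ˢ Y) ∩ {z | ‖z.1 - z.2‖ < ρ} with hTdef
  have hTm : MeasurableSet T :=
    (hXm.prod hYm).inter (measurableSet_lt (by fun_prop) measurable_const)
  have hball : ∀ x : E n, volume.real (Metric.ball x ρ) = ρ ^ n * V := fun x =>
    volume_real_ball x hρ0
  have hvolT : ENNReal.ofReal (κ * (ρ ^ n * V)) * volume X ≤ volume T := by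
    rw [Measure.volume_eq_prod, Measure.prod_apply hTm, ← setLIntegral_const,
      ← lintegral_indicator hXm]
    refine lintegral_mono fun x => ?_
    by_cases hx : x ∈ X
    · rw [indicator_of_mem hx]
      have e : Prod.mk x ⁻¹' T = Y ∩ Metric.ball x ρ := by
        ext y
        simp only [hTdef, mem_preimage, mem_inter_iff, mem_prod, hx, true_and, mem_ofPred_eq,
          Metric.mem_ball, dist_eq_norm, norm_sub_rev y x]
      rw [e]
      have h1 := hκX x hx
      rw [hball] at h1
      calc _ ≤ ENNReal.ofReal (volume.real (Y ∩ Metric.ball x ρ)) := ENNReal.ofReal_le_ofReal h1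
        _ ≤ _ := ENNReal.ofReal_toReal_le
    · rw [indicator_of_notMem hx]; exact zero_le
  have hlow : ENNReal.ofReal b * volume T ≤
      ENNReal.ofReal (C * (k * F)) * volume (belowSet x₀ r ψ u) := by
    refine le_trans ?_ hmain
    calc _ = ∫⁻ z in T, ENNReal.ofReal b := (setLIntegral_const _ _).symm
      _ ≤ ∫⁻ z in T, ENNReal.ofReal (h₀ * (g₀ ^ (p - 1) * weight (s * p) z.1 z.2
          + a z.1 z.2 * (g₀ ^ (q - 1) * weight (t * q) z.1 z.2))) := by
          refine setLIntegral_mono' hTm fun z hz => ENNReal.ofReal_le_ofReal ?_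
          have hx := hX z.1 hz.1.1
          have hy := hY z.2 hz.1.2
          have hne : z.1 ≠ z.2 := by
            intro h; rw [h] at hx; linarith [hx.2, hy.2]
          have := density_lower he ho hr hr1 hτ hτ1 hg₀ hgM hx.1 hy.1 hne hz.2
          rw [hb]
          refine mul_le_mul_of_nonneg_left ?_ hh₀.le
          rw [← mul_inv, inv_mul_le_iff₀ (by positivity)]
          exact this
      _ ≤ _ := lintegral_mono_set inter_subset_left
  have hSfin : volume (belowSet x₀ r ψ u) ≠ ∞ :=
    measure_ne_top_of_subset (fun x hx => hx.1) (measure_ball_lt_top (x := x₀) (r := r)).ne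
  have hreal := ENNReal.toReal_mono (ENNReal.mul_ne_top ENNReal.ofReal_ne_top hSfin)
    ((mul_le_mul_right hvolT (ENNReal.ofReal b)).trans hlow)
  rw [ENNReal.toReal_mul, ENNReal.toReal_mul, ENNReal.toReal_mul, ENNReal.toReal_ofReal hb0,
    ENNReal.toReal_ofReal (by positivity), ENNReal.toReal_ofReal (by positivity)] at hreal
  change b * (κ * (ρ ^ n * V) * volume.real X) ≤
    C * (k * F) * volume.real (belowSet x₀ r ψ u) at hreal
  calc h₀ * κ * τ ^ (-(s * p)) * G * volume.real X
      = c * V⁻¹ * (b * (κ * (ρ ^ n * V) * volume.real X)) := by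
        rw [hb]; field_simp
    _ ≤ c * V⁻¹ * (C * (k * F) * volume.real (belowSet x₀ r ψ u)) := by gcongr
    _ = _ := by ring

end

/-! ### Growth of nonnegative solutions -/

lemma flux_scale_le {s t p q a₀ r k l : ℝ} (hpq : p ≤ q) (ha : 0 ≤ a₀) (hr : 0 ≤ r) (hk : 0 ≤ k)
    (hl : 0 < l) (hl1 : l ≤ 1) :
    flux s t p q a₀ r (l * k) ≤ l ^ (p - 1) * flux s t p q a₀ r k := by
  have h : l ^ (q - 1) ≤ l ^ (p - 1) := Real.rpow_le_rpow_of_exponent_ge hl hl1 (by linarith)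
  unfold flux
  rw [Real.mul_rpow hl.le hk, Real.mul_rpow hl.le hk]
  calc _ ≤ l ^ (p - 1) * k ^ (p - 1) * r ^ (-(s * p)) +
        a₀ * (l ^ (p - 1) * k ^ (q - 1) * r ^ (-(t * q))) := by gcongr
    _ = _ := by ring

lemma le_flux_scale {s t p q a₀ r k l : ℝ} (hpq : p ≤ q) (hr : 0 ≤ r) (hk : 0 ≤ k)
    (hl : 0 < l) (hl1 : l ≤ 1) :
    l ^ (q - 1) * flux s t p q a₀ r k ≤ flux s t p q a₀ r (l * k) := by
  have h : l ^ (q - 1) ≤ l ^ (p - 1) := Real.rpow_le_rpow_of_exponent_ge hl hl1 (by linarith)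
  unfold flux
  rw [Real.mul_rpow hl.le hk, Real.mul_rpow hl.le hk]
  calc _ = l ^ (q - 1) * k ^ (p - 1) * r ^ (-(s * p)) +
        a₀ * (l ^ (q - 1) * k ^ (q - 1) * r ^ (-(t * q))) := by ring
    _ ≤ _ := by gcongr

/-- The radial cut-off equal to `1` on `B_ρ(x₀)` and to `0` off `B_{2ρ}(x₀)`. -/
noncomputable def bump (x₀ : E n) (ρ : ℝ) (x : E n) : ℝ := min 1 (max 0 (2 - ‖x - x₀‖ / ρ))

lemma bump_nonneg (x₀ : E n) (ρ : ℝ) (x : E n) : 0 ≤ bump x₀ ρ x :=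
  le_min zero_le_one (le_max_left _ _)

lemma bump_le_one (x₀ : E n) (ρ : ℝ) (x : E n) : bump x₀ ρ x ≤ 1 := min_le_left _ _

lemma bump_eq_one {x₀ : E n} {ρ : ℝ} (hρ : 0 < ρ) {x : E n} (hx : x ∈ Metric.ball x₀ ρ) :
    bump x₀ ρ x = 1 := by
  rw [Metric.mem_ball, dist_eq_norm] at hx
  refine min_eq_left (le_max_of_le_right ?_)
  have : ‖x - x₀‖ / ρ ≤ 1 := by rw [div_le_one hρ]; exact hx.le
  linarith

lemma bump_eq_zero {x₀ : E n} {ρ : ℝ} (hρ : 0 < ρ) {x : E n} (hx : x ∉ Metric.ball x₀ (2 * ρ)) :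
    bump x₀ ρ x = 0 := by
  rw [Metric.mem_ball, dist_eq_norm, not_lt] at hx
  have : 2 ≤ ‖x - x₀‖ / ρ := by rw [le_div_iff₀ hρ]; exact hx
  rw [bump, max_eq_left (by linarith), min_eq_right zero_le_one]

lemma bump_sub_le (x₀ : E n) {ρ : ℝ} (hρ : 0 < ρ) (x y : E n) :
    |bump x₀ ρ x - bump x₀ ρ y| ≤ ‖x - y‖ / ρ := by
  have h1 := abs_min_sub_min_le_max 1 (max 0 (2 - ‖x - x₀‖ / ρ)) 1 (max 0 (2 - ‖y - x₀‖ / ρ))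
  have h2 := abs_max_sub_max_le_max 0 (2 - ‖x - x₀‖ / ρ) 0 (2 - ‖y - x₀‖ / ρ)
  have h3 : |2 - ‖x - x₀‖ / ρ - (2 - ‖y - x₀‖ / ρ)| ≤ ‖x - y‖ / ρ := by
    have e : 2 - ‖x - x₀‖ / ρ - (2 - ‖y - x₀‖ / ρ) = (‖y - x₀‖ - ‖x - x₀‖) / ρ := by ring
    rw [e, abs_div, abs_of_pos hρ]
    gcongr
    have := abs_norm_sub_norm_le (y - x₀) (x - x₀)
    rw [sub_sub_sub_cancel_right] at this
    rwa [norm_sub_rev x y]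
  have h0 : 0 ≤ ‖x - y‖ / ρ := by positivity
  rw [sub_self, abs_zero] at h1 h2
  exact h1.trans (max_le h0 (h2.trans (max_le h0 h3)))

lemma isBarrier_bump {x₀ : E n} {r ρ k b c : ℝ} (hρ : 0 < ρ) (hρr : 2 * ρ ≤ r)
    (hk : 0 ≤ k) (hb : 0 ≤ b) (hb1 : b ≤ 1) (hbρ : b / ρ ≤ 2 / r) (hc : 0 ≤ c) :
    IsBarrier x₀ r k fun x => k * max 0 (b * bump x₀ ρ x - c) where
  nonneg x := mul_nonneg hk (le_max_left _ _)
  le_height x := by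
    have h1 := bump_le_one x₀ ρ x
    have h0 := bump_nonneg x₀ ρ x
    have : max 0 (b * bump x₀ ρ x - c) ≤ 1 := max_le zero_le_one (by nlinarith)
    nlinarith
  lipschitz x y := by
    rw [← mul_sub, abs_mul, abs_of_nonneg hk]
    have h2 := abs_max_sub_max_le_max 0 (b * bump x₀ ρ x - c) 0 (b * bump x₀ ρ y - c)
    have e : b * bump x₀ ρ x - c - (b * bump x₀ ρ y - c) = b * (bump x₀ ρ x - bump x₀ ρ y) := by
      ring
    rw [sub_self, abs_zero, e, abs_mul, abs_of_nonneg hb,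
      max_eq_right (a := 0) (b := b * |bump x₀ ρ x - bump x₀ ρ y|) (by positivity)] at h2
    calc _ ≤ k * (b * (‖x - y‖ / ρ)) := by
          gcongr
          exact h2.trans (by gcongr; exact bump_sub_le x₀ hρ x y)
      _ = k * (b / ρ) * ‖x - y‖ := by ring
      _ ≤ k * (2 / r) * ‖x - y‖ := by gcongr
      _ = _ := by ring
  zero_off x hx := by
    rw [bump_eq_zero hρ fun h => hx (Metric.ball_subset_ball hρr h), mul_zero, zero_sub,
      max_eq_left (by linarith), mul_zero]

variable {s t p q Λ A α L : ℝ}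

/-- If `u` is at least `ω / 2` on half of a ball, the set where it is below a small multiple of `ω`
has small measure: this set interacts with the set where `u` is large. -/
lemma measure_low_le (he : Exponents n s t p q Λ A α L) {M : ℝ} (hM : 0 < M) :
    ∃ C : ℝ, 0 < C ∧ ∀ a Ksp Ktq : E n → E n → ℝ, IsOperator s t p q Λ A α L a Ksp Ktq →
      ∀ (Ω : Set (E n)) (u : E n → ℝ), Bornology.IsBounded Ω → Measurable u →
      IsWeakSolution s t p q a Ksp Ktq Ω u →
      ∀ (x₀ : E n) (r R ω δ : ℝ), 0 < r → r ≤ 1 → 2 * r ≤ R → 0 < ω → ω ≤ M →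
      0 < δ → δ ≤ 1 / 4 →
      Metric.ball x₀ R ⊆ Ω → (∀ᵐ x, x ∈ Metric.ball x₀ R → 0 ≤ u x) →
      TailBound s t p q a x₀ r R (δ * ω) u →
      volume.real (Metric.ball x₀ (r / 2)) ≤
        2 * volume.real ({x | ω / 2 ≤ u x} ∩ Metric.ball x₀ (r / 2)) →
      volume.real ({x | u x < δ * ω / 2} ∩ Metric.ball x₀ (r / 2)) ≤
        C * δ ^ (p - 1) * volume.real (Metric.ball x₀ r) := by
  obtain ⟨C, hC0, hC⟩ := levelSet_inequality he hM
  have hp1 := he.one_lt_p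
  refine ⟨4 * 2 ^ n * C * 4 ^ (p - 1), by positivity, ?_⟩
  intro a Ksp Ktq ho Ω u hΩ hum hsol x₀ r R ω δ hr hr1 hR hω hωM hδ hδ1 hBR hu hT hhalf
  have ha0 := ho.coeff.nonneg x₀ x₀
  have hk : 0 < δ * ω := by positivity
  have hkω : δ * ω ≤ ω / 4 := by nlinarith
  set ψ : E n → ℝ := fun x => δ * ω * max 0 (1 * bump x₀ (r / 2) x - 0) with hψ'
  have hψ : IsBarrier x₀ r (δ * ω) ψ := isBarrier_bump (by positivity) (by linarith) hk.le
    zero_le_one le_rfl (le_of_eq (by field_simp)) le_rfl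
  have hψ1 : ∀ x ∈ Metric.ball x₀ (r / 2), ψ x = δ * ω := by
    intro x hx
    simp only [hψ', bump_eq_one (half_pos hr) hx]
    norm_num
  have hsub : Metric.ball x₀ (r / 2) ⊆ Metric.ball x₀ r := Metric.ball_subset_ball (by linarith)
  set X := {x | u x < δ * ω / 2} ∩ Metric.ball x₀ (r / 2) with hX
  set Y := {x | ω / 2 ≤ u x} ∩ Metric.ball x₀ (r / 2) with hY
  have hXm : MeasurableSet X := (measurableSet_lt hum measurable_const).inter measurableSet_ball
  have hYm : MeasurableSet Y := (measurableSet_le measurable_const hum).inter measurableSet_ball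
  have hX1 : ∀ x ∈ X, u x < δ * ω / 2 := fun x hx => hx.1
  have hY1 : ∀ y ∈ Y, ω / 2 ≤ u y := fun y hy => hy.1
  -- `u - ψ ≥ ω / 4` on `Y`, as `δ ≤ 1/4`: the flux on the left is that of height `ω / 4`, which
  -- exceeds the one on the right by a factor `(4 δ)^{1-p}` or more; all of `Y` is within `r` of `X`
  have key := hC a Ksp Ktq ho Ω u hΩ hum hsol x₀ r R (δ * ω) hr hr1 hR hk (by linarith) hBR hu hT
    ψ hψ X Y (δ * ω / 2) (ω / 4) ((2 ^ n)⁻¹ / 2) 1 hXm hYm (by positivity) (by positivity)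
    (by linarith) (by positivity) one_pos le_rfl
    (fun x hx => ⟨hsub hx.2, by rw [hψ1 x hx.2]; linarith [hX1 x hx]⟩)
    (fun y hy => ⟨hsub hy.2, by rw [hψ1 y hy.2]; linarith [hY1 y hy]⟩)
    (fun x hx y hy => by
      rw [hψ1 x hx.2, hψ1 y hy.2]; linarith [hX1 x hx, hY1 y hy])
    (fun x hx => by
      have hYx : Y ∩ Metric.ball x (1 * r) = Y := by
        refine inter_eq_left.2 fun y hy => ?_
        have h1 := Metric.mem_ball.1 hy.2
        have h2 := Metric.mem_ball'.1 hx.2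
        rw [Metric.mem_ball]
        linarith [dist_triangle y x₀ x]
      rw [hYx, one_mul, volume_real_ball x hr]
      rw [volume_real_ball x₀ (half_pos hr)] at hhalf
      have e : (r / 2) ^ n = r ^ n * (2 ^ n)⁻¹ := by rw [div_pow]; ring
      rw [e] at hhalf
      linarith)
  rw [Real.one_rpow, mul_one] at key
  have hG := flux_pos (s := s) (t := t) (p := p) (q := q) ha0 hr (by positivity : 0 < ω / 4)
  have hF : flux s t p q (a x₀ x₀) r (δ * ω) ≤
      4 ^ (p - 1) * δ ^ (p - 1) * flux s t p q (a x₀ x₀) r (ω / 4) := by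
    have := flux_scale_le (s := s) (t := t) he.p_le ha0 hr.le (by positivity : 0 ≤ ω / 4)
      (by positivity : 0 < 4 * δ) (by linarith)
    rw [Real.mul_rpow (by norm_num) hδ.le] at this
    have e : 4 * δ * (ω / 4) = δ * ω := by ring
    rwa [e] at this
  have hS : volume.real (belowSet x₀ r ψ u) ≤ volume.real (Metric.ball x₀ r) :=
    measureReal_mono (fun x hx => hx.1) measure_ball_lt_top.ne
  set G := flux s t p q (a x₀ x₀) r (ω / 4)
  set B := volume.real (Metric.ball x₀ r)
  have hB : 0 ≤ B := measureReal_nonneg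
  have h2 : δ * ω / 2 * ((2 ^ n)⁻¹ / 2) * G * volume.real X ≤
      δ * ω / 2 * ((2 ^ n)⁻¹ / 2) * G * (4 * 2 ^ n * C * 4 ^ (p - 1) * δ ^ (p - 1) * B) := by
    calc _ ≤ C * (δ * ω * flux s t p q (a x₀ x₀) r (δ * ω)) *
          volume.real (belowSet x₀ r ψ u) := key
      _ ≤ C * (δ * ω * (4 ^ (p - 1) * δ ^ (p - 1) * G)) * B := by gcongr
      _ = _ := by field_simp; ring
  exact le_of_mul_le_mul_left h2 (by positivity)

/-- De Giorgi's iteration: if the set where `u < k / 2` has small measure in a ball, then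
`u ≥ k / 4` almost everywhere in a smaller ball. The barriers are truncations of a fixed cone, so
that their Lipschitz constants do not deteriorate along the iteration. -/
lemma lower_bound_of_measure_low_le (he : Exponents n s t p q Λ A α L) {M : ℝ} (hM : 0 < M) :
    ∃ ε : ℝ, 0 < ε ∧ ∀ a Ksp Ktq : E n → E n → ℝ, IsOperator s t p q Λ A α L a Ksp Ktq →
      ∀ (Ω : Set (E n)) (u : E n → ℝ), Bornology.IsBounded Ω → Measurable u →
      IsWeakSolution s t p q a Ksp Ktq Ω u →
      ∀ (x₀ : E n) (r R k : ℝ), 0 < r → r ≤ 1 → 2 * r ≤ R → 0 < k → k ≤ M →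
      Metric.ball x₀ R ⊆ Ω → (∀ᵐ x, x ∈ Metric.ball x₀ R → 0 ≤ u x) →
      TailBound s t p q a x₀ r R k u →
      volume.real ({x | u x < k / 2} ∩ Metric.ball x₀ (r / 2)) ≤
        ε * volume.real (Metric.ball x₀ r) →
      ∀ᵐ x, x ∈ Metric.ball x₀ (r / 4) → k / 4 ≤ u x := by
  obtain ⟨C, hC0, hC⟩ := levelSet_inequality he hM
  have hsp := he.sp_pos
  have hq1 := he.one_lt_q
  have hn := he.dim_pos
  -- `b` is the gain per halving of the height, `θ` the matching ratio of interaction scales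
  set b : ℝ := (1 / 2) ^ q with hb
  have hb0 : 0 < b := by positivity
  have hb1 : b < 1 := Real.rpow_lt_one (by norm_num) (by norm_num) (by linarith)
  set θ : ℝ := b ^ (1 / (s * p)) with hθ
  have hθ0 : 0 < θ := by positivity
  have hθ1 : θ < 1 := Real.rpow_lt_one hb0.le hb1 (by positivity)
  have hθb : θ ^ (s * p) = b := by
    rw [hθ, ← Real.rpow_mul hb0.le, one_div_mul_cancel hsp.ne', Real.rpow_one]
  set τ₀ : ℝ := min (1 / 2) ((θ ^ n * b ^ 3 / (2 * C)) ^ (1 / (s * p))) with hτ₀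
  have hτ0 : 0 < τ₀ := lt_min (by norm_num) (by positivity)
  have hτhalf : τ₀ ≤ 1 / 2 := min_le_left _ _
  have hτC : 2 * C * τ₀ ^ (s * p) ≤ θ ^ n * b ^ 3 := by
    have h1 : τ₀ ^ (s * p) ≤ θ ^ n * b ^ 3 / (2 * C) := by
      calc τ₀ ^ (s * p) ≤ ((θ ^ n * b ^ 3 / (2 * C)) ^ (1 / (s * p))) ^ (s * p) :=
            Real.rpow_le_rpow hτ0.le (min_le_right _ _) hsp.le
        _ = _ := by
            rw [← Real.rpow_mul (by positivity), one_div_mul_cancel hsp.ne', Real.rpow_one]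
    rw [le_div_iff₀ (by positivity)] at h1
    linarith
  refine ⟨τ₀ ^ n / 2, by positivity, ?_⟩
  intro a Ksp Ktq ho Ω u hΩ hum hsol x₀ r R k hr hr1 hR hk hkM hBR hu hT hlow
  have ha0 := ho.coeff.nonneg x₀ x₀
  have hF := flux_pos (s := s) (t := t) (p := p) (q := q) ha0 hr hk
  set F := flux s t p q (a x₀ x₀) r k
  set B := volume.real (Metric.ball x₀ r) with hBdef
  have hB : 0 < B := volume_real_ball_pos x₀ hr
  -- the levels `c j` increase from `0` to `1/4`, and the barriers `ψ j` decrease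
  set c : ℕ → ℝ := fun j => (1 - (1 / 2) ^ j) / 4 with hc
  have hpow1 : ∀ j : ℕ, ((1 : ℝ) / 2) ^ j ≤ 1 := fun j => pow_le_one₀ (by norm_num) (by norm_num)
  have hc0 : ∀ j, 0 ≤ c j := fun j => by simp only [hc]; linarith [hpow1 j]
  have hc1 : ∀ j, c j ≤ 1 / 4 := fun j => by
    have : (0 : ℝ) < (1 / 2) ^ j := by positivity
    simp only [hc]; linarith
  have hcs : ∀ j, c (j + 1) = c j + (1 / 2) ^ (j + 3) := fun j => by
    simp only [hc, pow_succ]; ring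
  set ψ : ℕ → E n → ℝ := fun j x => k * max 0 (1 / 2 * bump x₀ (r / 4) x - c j) with hψ'
  have hψ : ∀ j, IsBarrier x₀ r k (ψ j) := fun j => isBarrier_bump (by positivity) (by linarith)
    hk.le (by norm_num) (by norm_num) (le_of_eq (by field_simp; norm_num)) (hc0 j)
  set S : ℕ → Set (E n) := fun j => belowSet x₀ r (ψ j) u with hS
  have hSm : ∀ j, MeasurableSet (S j) := fun j => measurableSet_belowSet (hψ j) hr hum
  have hSfin : ∀ j, volume (S j) ≠ ∞ := fun j =>
    measure_ne_top_of_subset (fun x hx => hx.1) (measure_ball_lt_top (x := x₀) (r := r)).ne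
  have hR' : Metric.ball x₀ r ⊆ Metric.ball x₀ R := Metric.ball_subset_ball (by linarith)
  -- where `u ≥ 0`, points below a barrier lie in the support of that barrier
  have hpos : ∀ j x, x ∈ S j → 0 ≤ u x →
      x ∈ Metric.ball x₀ (r / 2) ∧ ψ j x = k * (1 / 2 * bump x₀ (r / 4) x - c j) := by
    intro j x hx hux
    have h1 : 0 < ψ j x := hux.trans_lt hx.2
    have h2 : 0 < max 0 (1 / 2 * bump x₀ (r / 4) x - c j) := pos_of_mul_pos_right h1 hk.le
    have h3 : 0 < 1 / 2 * bump x₀ (r / 4) x - c j := by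
      rcases lt_max_iff.1 h2 with h | h
      · exact absurd h (lt_irrefl _)
      · exact h
    refine ⟨?_, by simp only [hψ', max_eq_right h3.le]⟩
    by_contra hx2
    rw [bump_eq_zero (by positivity : 0 < r / 4) (by
      rwa [show 2 * (r / 4) = r / 2 by ring])] at h3
    linarith [hc0 j]
  have hmain : ∀ j : ℕ, volume.real (S j) ≤ (τ₀ * θ ^ j) ^ n / 2 * B := by
    intro j
    induction j with
    | zero =>
      rw [pow_zero, mul_one]
      refine le_trans ?_ hlow
      refine ENNReal.toReal_mono (measure_ne_top_of_subset inter_subset_right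
        (measure_ball_lt_top (x := x₀) (r := r / 2)).ne) (measure_mono_ae ?_)
      filter_upwards [hu] with x hx hxS
      have hux := hx (hR' hxS.1)
      obtain ⟨h1, h2⟩ := hpos 0 x hxS hux
      refine ⟨?_, h1⟩
      have h3 : u x < ψ 0 x := hxS.2
      have h4 : k * (1 / 2 * bump x₀ (r / 4) x - c 0) ≤ k * (1 / 2) := by
        have := bump_le_one x₀ (r / 4) x
        have := hc0 0
        exact mul_le_mul_of_nonneg_left (by linarith) hk.le
      change u x < k / 2
      linarith
    | succ j ih =>
      set τ := τ₀ * θ ^ j with hτ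
      have hτpos : 0 < τ := by positivity
      have hτ12 : τ ≤ 1 / 2 := by
        have : θ ^ j ≤ 1 := pow_le_one₀ hθ0.le hθ1.le
        calc τ ≤ τ₀ * 1 := by rw [hτ]; gcongr
          _ ≤ 1 / 2 := by linarith
      set l : ℝ := (1 / 2) ^ (j + 3) with hl
      have hl0 : 0 < l := by positivity
      have hl1 : l ≤ 1 := hpow1 _
      -- the step from `ψ (j + 1)` to `ψ j` gives the gap `l k` on `S (j + 1)`, up to a null set
      set X := S (j + 1) ∩ {x | 0 ≤ u x} with hX
      set Y := Metric.ball x₀ r \ S j with hY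
      have hXm : MeasurableSet X := (hSm _).inter (measurableSet_le measurable_const hum)
      have hYm : MeasurableSet Y := measurableSet_ball.diff (hSm j)
      have hXS : volume.real X = volume.real (S (j + 1)) := by
        refine measureReal_congr ?_
        filter_upwards [hu] with x hx
        refine propext ⟨fun h => h.1, fun h => ⟨h, hx (hR' h.1)⟩⟩
      have hX1 : ∀ x ∈ X, x ∈ Metric.ball x₀ (r / 2) ∧ l * k ≤ ψ j x - u x := by
        intro x hx
        obtain ⟨h1, h2⟩ := hpos (j + 1) x hx.1 hx.2
        have h3 : u x < ψ (j + 1) x := hx.1.2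
        have h4 : k * (1 / 2 * bump x₀ (r / 4) x - c j) ≤ ψ j x :=
          mul_le_mul_of_nonneg_left (le_max_right _ _) hk.le
        refine ⟨h1, ?_⟩
        rw [h2, hcs] at h3
        rw [← hl] at h3
        linarith
      have hY1 : ∀ y ∈ Y, y ∈ Metric.ball x₀ r ∧ ψ j y ≤ u y := by
        intro y hy
        refine ⟨hy.1, ?_⟩
        by_contra h
        exact hy.2 ⟨hy.1, not_le.1 h⟩
      -- by the induction hypothesis `S j` fills at most half of each ball of radius `τ r`, hence
      -- the density `1 / 2` of `Y`
      have key := hC a Ksp Ktq ho Ω u hΩ hum hsol x₀ r R k hr hr1 hR hk hkM hBR hu hT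
        (ψ j) (hψ j) X Y (l * k) (l * k) (1 / 2) τ hXm hYm (by positivity) (by positivity)
        (by nlinarith) (by norm_num) hτpos (by linarith)
        (fun x hx => ⟨Metric.ball_subset_ball (by linarith) (hX1 x hx).1, (hX1 x hx).2⟩) hY1
        (fun x hx y hy => by linarith [(hX1 x hx).2, (hY1 y hy).2])
        (fun x hx => by
          have hsub : Metric.ball x (τ * r) ⊆ Metric.ball x₀ r := by
            refine Metric.ball_subset_ball' ?_
            have := Metric.mem_ball.1 (hX1 x hx).1
            nlinarith
          have e : Y ∩ Metric.ball x (τ * r) = Metric.ball x (τ * r) \ S j := by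
            ext y
            simp only [hY, mem_inter_iff, mem_sdiff]
            exact ⟨fun h => ⟨h.2, h.1.2⟩, fun h => ⟨⟨hsub h.1, h.2⟩, h.1⟩⟩
          have h1 : volume.real (Metric.ball x (τ * r)) = τ ^ n * B := by
            rw [volume_real_ball x (by positivity), hBdef, volume_real_ball x₀ hr, mul_pow]; ring
          have h2 := le_measureReal_sdiff (μ := volume) (s₁ := Metric.ball x (τ * r)) (s₂ := S j)
            (hSfin j)
          rw [e]
          rw [h1] at h2 ⊢
          linarith)
      rw [hXS] at key
      have hτsp : τ ^ (-(s * p)) = (τ₀ ^ (s * p) * b ^ j)⁻¹ := by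
        rw [Real.rpow_neg hτpos.le, hτ, Real.mul_rpow hτ0.le (by positivity),
          ← Real.rpow_pow_comm hθ0.le, hθb]
      have hlq : l ^ q = b ^ (j + 3) := by
        rw [hl, ← Real.rpow_pow_comm (by norm_num)]
      have hfl := le_flux_scale (s := s) (t := t) (a₀ := a x₀ x₀) he.p_le hr.le hk.le hl0 hl1
      have h3 : b ^ (j + 3) * (1 / 2) * (τ₀ ^ (s * p) * b ^ j)⁻¹ * volume.real (S (j + 1)) * (k * F)
          ≤ C * volume.real (S j) * (k * F) := by
        calc _ = l * k * (1 / 2) * (τ₀ ^ (s * p) * b ^ j)⁻¹ * (l ^ (q - 1) * F) *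
              volume.real (S (j + 1)) := by
              rw [← hlq, ← rpow_sub_one_mul hq1 hl0.le]; ring
          _ ≤ l * k * (1 / 2) * (τ₀ ^ (s * p) * b ^ j)⁻¹ * flux s t p q (a x₀ x₀) r (l * k) *
              volume.real (S (j + 1)) := by gcongr
          _ ≤ _ := by rw [← hτsp]; linarith
      have h4 := le_of_mul_le_mul_right h3 (by positivity)
      have h5 : b ^ 3 * volume.real (S (j + 1)) ≤
          2 * C * τ₀ ^ (s * p) * volume.real (S j) := by
        have e : b ^ (j + 3) * (1 / 2) * (τ₀ ^ (s * p) * b ^ j)⁻¹ * volume.real (S (j + 1)) =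
            b ^ 3 * volume.real (S (j + 1)) / (2 * τ₀ ^ (s * p)) := by
          rw [pow_add]; field_simp
        rw [e, div_le_iff₀ (by positivity)] at h4
        linarith
      have h6 : b ^ 3 * volume.real (S (j + 1)) ≤ b ^ 3 * (θ ^ n * volume.real (S j)) := by
        have : 0 ≤ volume.real (S j) := measureReal_nonneg
        calc _ ≤ _ := h5
          _ ≤ θ ^ n * b ^ 3 * volume.real (S j) := by gcongr
          _ = _ := by ring
      have h7 := le_of_mul_le_mul_left h6 (by positivity)
      calc _ ≤ θ ^ n * volume.real (S j) := h7
        _ ≤ θ ^ n * (τ ^ n / 2 * B) := by gcongr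
        _ = _ := by rw [hτ, pow_succ]; ring
  have hzero : volume ({x | u x < k / 4} ∩ Metric.ball x₀ (r / 4)) = 0 := by
    set Z := {x | u x < k / 4} ∩ Metric.ball x₀ (r / 4) with hZ
    have hZfin : volume Z ≠ ∞ := measure_ne_top_of_subset inter_subset_right
        (measure_ball_lt_top (x := x₀) (r := r / 4)).ne
    have hZS : ∀ j, Z ⊆ S j := by
      intro j x hx
      refine ⟨Metric.ball_subset_ball (by linarith) hx.2, ?_⟩
      have h1 : u x < k / 4 := hx.1
      have h2 : k * (1 / 2 * bump x₀ (r / 4) x - c j) ≤ ψ j x :=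
        mul_le_mul_of_nonneg_left (le_max_right _ _) hk.le
      rw [bump_eq_one (by positivity) hx.2] at h2
      have h3 : k * (1 / 4) ≤ k * (1 / 2 * 1 - c j) :=
        mul_le_mul_of_nonneg_left (by linarith [hc1 j]) hk.le
      linarith
    have hle : ∀ j : ℕ, volume.real Z ≤ τ₀ ^ n / 2 * B * (θ ^ n) ^ j := by
      intro j
      calc _ ≤ volume.real (S j) := measureReal_mono (hZS j) (hSfin j)
        _ ≤ _ := hmain j
        _ = _ := by rw [mul_pow, ← pow_mul, ← pow_mul, mul_comm j n]; ring
    have hlim : Filter.Tendsto (fun j : ℕ => τ₀ ^ n / 2 * B * (θ ^ n) ^ j) Filter.atTop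
        (nhds (τ₀ ^ n / 2 * B * 0)) :=
      (tendsto_pow_atTop_nhds_zero_of_lt_one (by positivity)
        (pow_lt_one₀ hθ0.le hθ1 (by omega))).const_mul _
    rw [mul_zero] at hlim
    have h0 := ge_of_tendsto' hlim hle
    exact (measureReal_eq_zero_iff hZfin).1 (le_antisymm h0 measureReal_nonneg)
  rw [measure_eq_zero_iff_ae_notMem] at hzero
  filter_upwards [hzero] with x hx hxr
  by_contra h
  exact hx ⟨not_le.1 h, hxr⟩

/-- Growth lemma: a nonnegative solution which is at least `ω / 2` on half of a ball, and whose
negative tail is small, is bounded below by a multiple of `ω` on a smaller ball. -/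
theorem growth (he : Exponents n s t p q Λ A α L) {M : ℝ} (hM : 0 < M) :
    ∃ δ : ℝ, 0 < δ ∧ δ ≤ 1 / 4 ∧
      ∀ a Ksp Ktq : E n → E n → ℝ, IsOperator s t p q Λ A α L a Ksp Ktq →
      ∀ (Ω : Set (E n)) (u : E n → ℝ), Bornology.IsBounded Ω → Measurable u →
      IsWeakSolution s t p q a Ksp Ktq Ω u →
      ∀ (x₀ : E n) (r R ω : ℝ), 0 < r → r ≤ 1 → 2 * r ≤ R → 0 < ω → ω ≤ M →
      Metric.ball x₀ R ⊆ Ω → (∀ᵐ x, x ∈ Metric.ball x₀ R → 0 ≤ u x) →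
      TailBound s t p q a x₀ r R (δ * ω) u →
      volume.real (Metric.ball x₀ (r / 2)) ≤
        2 * volume.real ({x | ω / 2 ≤ u x} ∩ Metric.ball x₀ (r / 2)) →
      ∀ᵐ x, x ∈ Metric.ball x₀ (r / 4) → δ * ω / 4 ≤ u x := by
  obtain ⟨C, hC0, hC⟩ := measure_low_le he hM
  obtain ⟨ε, hε0, hε⟩ := lower_bound_of_measure_low_le he hM
  have hp1 : 0 < p - 1 := by linarith [he.one_lt_p]
  set δ : ℝ := min (1 / 4) ((ε / C) ^ (1 / (p - 1))) with hδ
  have hδ0 : 0 < δ := lt_min (by norm_num) (by positivity)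
  have hδ1 : δ ≤ 1 / 4 := min_le_left _ _
  have hδε : C * δ ^ (p - 1) ≤ ε := by
    have h1 : δ ^ (p - 1) ≤ ε / C := by
      calc δ ^ (p - 1) ≤ ((ε / C) ^ (1 / (p - 1))) ^ (p - 1) :=
            Real.rpow_le_rpow hδ0.le (min_le_right _ _) hp1.le
        _ = _ := by
            rw [← Real.rpow_mul (by positivity), one_div_mul_cancel hp1.ne', Real.rpow_one]
    rw [le_div_iff₀ hC0] at h1
    linarith
  refine ⟨δ, hδ0, hδ1, ?_⟩
  intro a Ksp Ktq ho Ω u hΩ hum hsol x₀ r R ω hr hr1 hR hω hωM hBR hu hT hhalf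
  refine hε a Ksp Ktq ho Ω u hΩ hum hsol x₀ r R (δ * ω) hr hr1 hR (by positivity) (by nlinarith)
    hBR hu hT ?_
  refine (hC a Ksp Ktq ho Ω u hΩ hum hsol x₀ r R ω δ hr hr1 hR hω hωM hδ0 hδ1 hBR hu hT
    hhalf).trans ?_
  have := volume_real_ball_pos x₀ hr
  gcongr

/-! ### Tails -/

/-- The tail of the singular kernel against a weight growing like `|x - y|^{β/2}`: half of the decay
of the kernel is left. -/
lemma lintegral_growing_tail_le {β : ℝ} (hβ : 0 < β) :
    ∃ C : ℝ, 0 < C ∧ ∀ (x : E n) (R : ℝ), 0 < R →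
      ∫⁻ y, ENNReal.ofReal (if R / 2 ≤ ‖x - y‖ then
          (2 * ‖x - y‖ / R) ^ (β / 2) * weight β x y else 0)
        ≤ ENNReal.ofReal (C * R ^ (-β)) := by
  obtain ⟨C, hC, h⟩ := lintegral_tail_weight_le (n := n) (half_pos hβ)
  refine ⟨C * 2 ^ β, by positivity, fun x R hR => ?_⟩
  calc _ = ∫⁻ y, ENNReal.ofReal ((2 / R) ^ (β / 2) *
        (if R / 2 ≤ ‖x - y‖ then weight (β / 2) x y else 0)) := by
        refine lintegral_congr fun y => ?_
        congr 1
        split_ifs with hy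
        · have hd : 0 < ‖x - y‖ := (half_pos hR).trans_le hy
          have e : (n : ℝ) + β = β / 2 + (n + β / 2) := by ring
          rw [weight, weight, e, Real.rpow_add hd, mul_div_right_comm,
            Real.mul_rpow (by positivity) hd.le]
          field_simp
        · simp
    _ ≤ ENNReal.ofReal ((2 / R) ^ (β / 2)) * ENNReal.ofReal (C * (R / 2) ^ (-(β / 2))) := by
        rw [lintegral_const_mul_ofReal (by positivity)]
        gcongr
        exact h x (R / 2) (half_pos hR)
    _ = _ := by
        rw [← ENNReal.ofReal_mul (by positivity)]
        congr 1
        have e1 : (R / 2) ^ (-(β / 2)) = (2 / R) ^ (β / 2) := by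
          rw [Real.rpow_neg (by positivity), ← Real.inv_rpow (by positivity), inv_div]
        have e2 : (2 / R) ^ (β / 2) * (2 / R) ^ (β / 2) = 2 ^ β * R ^ (-β) := by
          rw [← Real.rpow_add (by positivity), add_halves, Real.div_rpow (by norm_num) hR.le,
            Real.rpow_neg hR.le, div_eq_mul_inv]
        rw [e1]
        calc _ = C * ((2 / R) ^ (β / 2) * (2 / R) ^ (β / 2)) := by ring
          _ = _ := by rw [e2]; ring

/-- The tail of a function whose negative part grows at most like `ω (|y - x₀| / R)^γ` off
`B_R(x₀)`. -/
lemma lintegral_near_tail_le (he : Exponents n s t p q Λ A α L) {M : ℝ} (hM : 0 < M) :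
    ∃ C : ℝ, 0 < C ∧ ∀ a Ksp Ktq : E n → E n → ℝ, IsOperator s t p q Λ A α L a Ksp Ktq →
      ∀ (x₀ : E n) (r R ω γ : ℝ) (U : E n → ℝ) (S : Set (E n)), 0 < r → 2 * r ≤ R →
      0 < ω → ω ≤ M → 0 < γ → γ * (q - 1) ≤ s * p / 2 → MeasurableSet S →
      S ⊆ (Metric.ball x₀ R)ᶜ →
      (∀ᵐ y, y ∈ S → max (-U y) 0 ≤ 2 * ω * (‖y - x₀‖ / R) ^ γ) →
      ∀ x ∈ Metric.ball x₀ r, ∫⁻ y in S, ENNReal.ofReal (tailDensity s t p q a U x y) ≤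
        ENNReal.ofReal (C * flux s t p q (a x₀ x₀) R ω) := by
  obtain ⟨C₁, hC₁, h₁⟩ := lintegral_growing_tail_le (n := n) he.sp_pos
  obtain ⟨C₂, hC₂, h₂⟩ := lintegral_growing_tail_le (n := n) he.tq_pos
  have hL := he.L_nonneg
  have hA := he.A_nonneg
  have hp1 := he.one_lt_p
  have hq1 := he.one_lt_q
  have hpq := he.p_le
  set c₃ := L * 3 ^ α + A with hc₃
  have hc₃0 : 0 ≤ c₃ := by positivity
  refine ⟨2 ^ (q - 1) * (C₁ + C₂ + c₃ * C₁ * M ^ (q - p)), by positivity, ?_⟩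
  intro a Ksp Ktq ho x₀ r R ω γ U S hr hR hω hωM hγ hγq hSm hSR hU x hx
  have hR0 : 0 < R := by linarith
  have ha0 := ho.coeff.nonneg x₀ x₀
  set G : ℝ → E n → ℝ := fun β y => if R / 2 ≤ ‖x - y‖ then
          (2 * ‖x - y‖ / R) ^ (β / 2) * weight β x y else 0 with hG
  have hGm : ∀ β, Measurable (G β) := fun β => Measurable.ite
    (measurableSet_le measurable_const (by fun_prop)) (by unfold weight; fun_prop) measurable_const
  have hpt : ∀ᵐ y, y ∈ S → tailDensity s t p q a U x y ≤
      ((2 * ω) ^ (p - 1) + c₃ * (2 * ω) ^ (q - 1)) * G (s * p) y +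
        a x₀ x₀ * (2 * ω) ^ (q - 1) * G (t * q) y := by
    filter_upwards [hU] with y hy hyS
    have hy1 := hy hyS
    have hyR := hSR hyS
    rw [mem_compl_iff, Metric.mem_ball, dist_eq_norm, not_lt] at hyR
    have hxr := Metric.mem_ball.1 hx
    rw [dist_eq_norm] at hxr
    have htri : ‖y - x₀‖ ≤ ‖x - y‖ + ‖x - x₀‖ := by
      have := norm_sub_le_norm_sub_add_norm_sub y x x₀
      rwa [norm_sub_rev y x] at this
    have hd : R / 2 ≤ ‖x - y‖ := by linarith
    have hξ : 1 ≤ 2 * ‖x - y‖ / R := by rw [le_div_iff₀ hR0]; linarith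
    have hle : max (-U y) 0 ≤ 2 * ω * (2 * ‖x - y‖ / R) ^ γ := by
      refine hy1.trans ?_
      gcongr
      linarith
    set ξ := 2 * ‖x - y‖ / R with hξdef
    have hξ0 : 0 < ξ := by linarith
    have hm0 : 0 ≤ max (-U y) 0 := le_max_right _ _
    have hpow : ∀ e : ℝ, 0 ≤ e → e ≤ q - 1 → max (-U y) 0 ^ e ≤ (2 * ω) ^ e * ξ ^ (s * p / 2) := by
      intro e he0 heq
      calc max (-U y) 0 ^ e ≤ (2 * ω * ξ ^ γ) ^ e := Real.rpow_le_rpow hm0 hle he0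
        _ = (2 * ω) ^ e * ξ ^ (γ * e) := by
            rw [Real.mul_rpow (by positivity) (by positivity), ← Real.rpow_mul hξ0.le]
        _ ≤ (2 * ω) ^ e * ξ ^ (s * p / 2) := by
            gcongr
            nlinarith
    have hpp := hpow (p - 1) (by linarith) (by linarith)
    have hqq := hpow (q - 1) (by linarith) le_rfl
    have hξξ : ξ ^ (s * p / 2) ≤ ξ ^ (t * q / 2) :=
      Real.rpow_le_rpow_of_exponent_le hξ (by linarith [he.sp_le_tq])
    have hw1 := weight_nonneg (s * p) x y
    have hw2 := weight_nonneg (t * q) x y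
    have hfar := ho.coeff_mul_weight_far he hr hx (by linarith : r ≤ ‖x - y‖)
    simp only [hG, if_pos hd, tailDensity]
    calc _ = max (-U y) 0 ^ (p - 1) * weight (s * p) x y
          + max (-U y) 0 ^ (q - 1) * (a x y * weight (t * q) x y) := by ring
      _ ≤ (2 * ω) ^ (p - 1) * ξ ^ (s * p / 2) * weight (s * p) x y
          + (2 * ω) ^ (q - 1) * ξ ^ (s * p / 2) *
            (a x₀ x₀ * weight (t * q) x y + c₃ * weight (s * p) x y) := by
          have := ho.coeff.nonneg x y
          gcongr
      _ = ((2 * ω) ^ (p - 1) + c₃ * (2 * ω) ^ (q - 1)) * (ξ ^ (s * p / 2) * weight (s * p) x y) +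
          a x₀ x₀ * (2 * ω) ^ (q - 1) * (ξ ^ (s * p / 2) * weight (t * q) x y) := by ring
      _ ≤ _ := by gcongr
  have hG0 : ∀ β y, 0 ≤ G β y := fun β y => by
    simp only [hG]
    have := weight_nonneg β x y
    split_ifs <;> positivity
  calc ∫⁻ y in S, ENNReal.ofReal (tailDensity s t p q a U x y)
      ≤ ∫⁻ y in S, ENNReal.ofReal (((2 * ω) ^ (p - 1) + c₃ * (2 * ω) ^ (q - 1)) * G (s * p) y +
        a x₀ x₀ * (2 * ω) ^ (q - 1) * G (t * q) y) := by
        refine lintegral_mono_ae ((ae_restrict_iff' hSm).2 ?_)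
        filter_upwards [hpt] with y hy hyS using ENNReal.ofReal_le_ofReal (hy hyS)
    _ ≤ ∫⁻ y, ENNReal.ofReal (((2 * ω) ^ (p - 1) + c₃ * (2 * ω) ^ (q - 1)) * G (s * p) y +
        a x₀ x₀ * (2 * ω) ^ (q - 1) * G (t * q) y) := setLIntegral_le_lintegral _ _
    _ ≤ _ := lintegral_ofReal_add_le' ((hGm _).const_mul _)
    _ ≤ ENNReal.ofReal ((2 * ω) ^ (p - 1) + c₃ * (2 * ω) ^ (q - 1)) *
          ENNReal.ofReal (C₁ * R ^ (-(s * p))) +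
        ENNReal.ofReal (a x₀ x₀ * (2 * ω) ^ (q - 1)) * ENNReal.ofReal (C₂ * R ^ (-(t * q))) := by
        rw [lintegral_const_mul_ofReal (by positivity), lintegral_const_mul_ofReal (by positivity)]
        gcongr
        exacts [h₁ x R hR0, h₂ x R hR0]
    _ = ENNReal.ofReal (((2 * ω) ^ (p - 1) + c₃ * (2 * ω) ^ (q - 1)) * (C₁ * R ^ (-(s * p))) +
        a x₀ x₀ * (2 * ω) ^ (q - 1) * (C₂ * R ^ (-(t * q)))) := by
        rw [← ENNReal.ofReal_mul (by positivity), ← ENNReal.ofReal_mul (by positivity),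
          ← ENNReal.ofReal_add (by positivity) (by positivity)]
    _ ≤ _ := by
        apply ENNReal.ofReal_le_ofReal
        have hh := he.rpow_height hω hωM
        have h2 : (2 : ℝ) ^ (p - 1) ≤ 2 ^ (q - 1) :=
          Real.rpow_le_rpow_of_exponent_le (by norm_num) (by linarith)
        unfold flux
        rw [Real.mul_rpow (by norm_num) hω.le, Real.mul_rpow (by norm_num) hω.le]
        set P := ω ^ (p - 1)
        set Q := ω ^ (q - 1)
        set Rp := R ^ (-(s * p))
        set Rq := R ^ (-(t * q))
        set K : ℝ := 2 ^ (q - 1)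
        have hP : 0 ≤ P := by positivity
        have hQ : 0 ≤ Q := by positivity
        have hK : 0 ≤ K := by positivity
        have hRp : 0 ≤ Rp := by positivity
        have hRq : 0 ≤ Rq := by positivity
        calc _ ≤ (K * P + c₃ * (K * (M ^ (q - p) * P))) * (C₁ * Rp) +
              a x₀ x₀ * (K * Q) * (C₂ * Rq) := by gcongr
          _ ≤ _ := by
            have i1 : 0 ≤ K * C₂ * (P * Rp) := by positivity
            have i2 : 0 ≤ K * (C₁ + c₃ * C₁ * M ^ (q - p)) * (a x₀ x₀ * (Q * Rq)) := by positivity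
            linarith

/-- The far part of the tail is finite, uniformly for centres in a bounded set. -/
lemma lintegral_far_tail_le (he : Exponents n s t p q Λ A α L) {a Ksp Ktq : E n → E n → ℝ}
    (ho : IsOperator s t p q Λ A α L a Ksp Ktq) {u : E n → ℝ} (hu : MemTail s p q u)
    {ρ B N : ℝ} (hρ : 0 < ρ) (hB : 0 ≤ B) (hN : 0 ≤ N) :
    ∃ T : ℝ, 0 < T ∧ ∀ x₀ : E n, ‖x₀‖ ≤ B → ∀ x ∈ Metric.ball x₀ (ρ / 2), ∀ U : E n → ℝ,
      (∀ y, max (-U y) 0 ≤ |u y| + N) →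
      ∫⁻ y in (Metric.ball x₀ ρ)ᶜ, ENNReal.ofReal (tailDensity s t p q a U x y) ≤
        ENNReal.ofReal T := by
  have hp1 := he.one_lt_p
  have hq1 := he.one_lt_q
  have hpq := he.p_le
  have hsp := he.sp_pos
  have htq := he.tq_pos
  have hA := he.A_nonneg
  -- `1 + ‖y‖ ≤ κ ‖x - y‖` for `y` off the ball, so that the weight is comparable to that of the
  -- tail space
  set κ : ℝ := (1 + B + ρ / 2) / (ρ / 2) + 1 with hκ
  have hκ0 : 0 < κ := by positivity
  set c : ℝ := κ ^ ((n : ℝ) + s * p) + A * κ ^ ((n : ℝ) + t * q) with hc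
  have hc0 : 0 ≤ c := by positivity
  set W : E n → ℝ := fun y => (1 + ‖y‖) ^ (-((n : ℝ) + s * p)) with hW
  have hWm : Measurable W := by fun_prop
  set I := ENNReal.ofReal (c * (1 + 2 ^ (q - 1) * N ^ (q - 1))) * (∫⁻ y, ENNReal.ofReal (W y)) +
    ENNReal.ofReal (c * 2 ^ (q - 1)) *
      ∫⁻ y : E n, ENNReal.ofReal (|u y| ^ (q - 1) / (1 + ‖y‖) ^ ((n : ℝ) + s * p)) with hI
  have hIfin : I < ∞ := by
    refine ENNReal.add_lt_top.2 ⟨ENNReal.mul_lt_top ENNReal.ofReal_lt_top ?_,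
      ENNReal.mul_lt_top ENNReal.ofReal_lt_top hu.tail_lt_top⟩
    exact finite_integral_one_add_norm (E := E n) (μ := volume) (r := n + s * p)
      (by rw [finrank_euclideanSpace_fin]; linarith)
  refine ⟨I.toReal + 1, by positivity, fun x₀ hx₀ x hx U hU => ?_⟩
  have hpt : ∀ y ∈ (Metric.ball x₀ ρ)ᶜ, tailDensity s t p q a U x y ≤
      c * (1 + 2 ^ (q - 1) * N ^ (q - 1)) * W y +
        c * 2 ^ (q - 1) * (|u y| ^ (q - 1) / (1 + ‖y‖) ^ ((n : ℝ) + s * p)) := by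
    intro y hy
    rw [mem_compl_iff, Metric.mem_ball, dist_eq_norm, not_lt] at hy
    rw [Metric.mem_ball, dist_eq_norm] at hx
    have htri : ‖y - x₀‖ ≤ ‖x - y‖ + ‖x - x₀‖ := by
      have := norm_sub_le_norm_sub_add_norm_sub y x x₀
      rwa [norm_sub_rev y x] at this
    have hd : ρ / 2 ≤ ‖x - y‖ := by linarith
    have hd0 : 0 < ‖x - y‖ := by linarith
    have hy1 : 1 + ‖y‖ ≤ κ * ‖x - y‖ := by
      have h1 : ‖y‖ ≤ ‖y - x‖ + ‖x - x₀‖ + ‖x₀‖ := by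
        have := norm_add₃_le (a := y - x) (b := x - x₀) (c := x₀)
        simpa using this
      rw [norm_sub_rev y x] at h1
      have h2 : 1 + B + ρ / 2 ≤ (1 + B + ρ / 2) / (ρ / 2) * ‖x - y‖ := by
        rw [div_mul_eq_mul_div, le_div_iff₀ (by positivity)]
        gcongr
      rw [hκ, add_mul, one_mul]
      linarith
    have hy0 : 0 < 1 + ‖y‖ := by positivity
    have hw : ∀ β : ℝ, s * p ≤ β → weight β x y ≤ κ ^ ((n : ℝ) + β) * W y := by
      intro β hβ
      have e1 : weight β x y ≤ κ ^ ((n : ℝ) + β) * (1 + ‖y‖) ^ (-((n : ℝ) + β)) := by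
        rw [weight, Real.rpow_neg hy0.le, ← div_eq_mul_inv, div_le_div_iff₀ (by positivity)
          (by positivity), one_mul, ← Real.mul_rpow hκ0.le hd0.le]
        have : (0 : ℝ) ≤ n := n.cast_nonneg
        exact Real.rpow_le_rpow hy0.le hy1 (by linarith)
      refine e1.trans ?_
      have : (1 + ‖y‖) ^ (-((n : ℝ) + β)) ≤ W y :=
        Real.rpow_le_rpow_of_exponent_le (by linarith [norm_nonneg y]) (by linarith)
      gcongr
    have hw1 := hw _ le_rfl
    have hw2 := hw _ he.sp_le_tq
    have hW0 : 0 ≤ W y := by positivity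
    set g := 2 ^ (q - 1) * (|u y| ^ (q - 1) + N ^ (q - 1)) with hg
    have hg0 : 0 ≤ g := by positivity
    have hm0 : 0 ≤ max (-U y) 0 := le_max_right _ _
    have hq2 : max (-U y) 0 ^ (q - 1) ≤ g :=
      (Real.rpow_le_rpow hm0 (hU y) (by linarith)).trans
        (add_rpow_le (abs_nonneg _) hN (by linarith))
    -- the tail space controls the power `q - 1` only; the power `p - 1` is below it, up to `1`
    have hp2 : max (-U y) 0 ^ (p - 1) ≤ 1 + g := by
      rcases le_total (max (-U y) 0) 1 with h | h
      · have := Real.rpow_le_one hm0 h (by linarith : 0 ≤ p - 1)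
        linarith
      · have : max (-U y) 0 ^ (p - 1) ≤ max (-U y) 0 ^ (q - 1) :=
          Real.rpow_le_rpow_of_exponent_le h (by linarith)
        linarith
    have e : |u y| ^ (q - 1) / (1 + ‖y‖) ^ ((n : ℝ) + s * p) = |u y| ^ (q - 1) * W y := by
      change _ = _ * (1 + ‖y‖) ^ (-((n : ℝ) + s * p))
      rw [Real.rpow_neg hy0.le, div_eq_mul_inv]
    rw [e, tailDensity]
    have hwn1 := weight_nonneg (s * p) x y
    have hwn2 := weight_nonneg (t * q) x y
    calc _ ≤ (1 + g) * (κ ^ ((n : ℝ) + s * p) * W y) +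
          A * ((1 + g) * (κ ^ ((n : ℝ) + t * q) * W y)) := by
          gcongr
          · exact ho.coeff.le_bound x y
          · linarith
      _ = _ := by rw [hc, hg]; ring
  calc ∫⁻ y in (Metric.ball x₀ ρ)ᶜ, ENNReal.ofReal (tailDensity s t p q a U x y)
      ≤ ∫⁻ y in (Metric.ball x₀ ρ)ᶜ, ENNReal.ofReal (c * (1 + 2 ^ (q - 1) * N ^ (q - 1)) * W y +
        c * 2 ^ (q - 1) * (|u y| ^ (q - 1) / (1 + ‖y‖) ^ ((n : ℝ) + s * p))) :=
        setLIntegral_mono' measurableSet_ball.compl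
          fun y hy => ENNReal.ofReal_le_ofReal (hpt y hy)
    _ ≤ _ := setLIntegral_le_lintegral _ _
    _ ≤ _ := lintegral_ofReal_add_le' (hWm.const_mul _)
    _ = I := by
        rw [lintegral_const_mul_ofReal (by positivity), lintegral_const_mul_ofReal (by positivity)]
    _ ≤ _ := by
        rw [← ENNReal.ofReal_toReal hIfin.ne]
        exact ENNReal.ofReal_le_ofReal (by simp)

/-! ### Decay of the oscillation -/

/-- A point outside the last of finitely many sets is outside the first one, or it is between two
consecutive ones. -/
lemma exists_shell {P : ℕ → Prop} {j : ℕ} (hj : ¬P j) :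
    ¬P 0 ∨ ∃ i, i < j ∧ P i ∧ ¬P (i + 1) := by
  by_contra h
  push Not at h
  refine hj ?_
  have : ∀ i, i ≤ j → P i := fun i => by
    induction i with
    | zero => exact fun _ => h.1
    | succ i ih => exact fun hi => h.2 i (by omega) (ih (by omega))
  exact this j le_rfl

/-- The choice of the ratio `σ` of consecutive radii and of the Hölder exponent `γ`: first `σ`, so
small that the near tail is negligible at the radius `4 σ R`, then `γ`, so small that the growth
lemma yields the decay `σ^γ`, and that the near tail converges. -/
lemma exists_ratio_exponent {β p q δ C : ℝ} (hβ : 0 < β) (hp : 1 < p) (hpq : p ≤ q) (hδ : 0 < δ)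
    (hδ1 : δ ≤ 1 / 4) (hC : 0 < C) :
    ∃ σ γ : ℝ, 0 < σ ∧ σ ≤ 1 / 8 ∧ 0 < γ ∧ γ < 1 ∧ γ * (q - 1) ≤ β / 2 ∧
      1 - δ / 4 ≤ σ ^ γ ∧ 2 * C ≤ δ ^ (q - 1) * (4 * σ) ^ (-β) := by
  set σ : ℝ := min (1 / 8) ((δ ^ (q - 1) / (2 * C)) ^ (1 / β) / 4) with hσ
  have hσ0 : 0 < σ := lt_min (by norm_num) (by positivity)
  have hσ8 : σ ≤ 1 / 8 := min_le_left _ _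
  have hlogσ : Real.log σ < 0 := Real.log_neg hσ0 (by linarith)
  have hη : 0 < 1 - δ / 4 := by linarith
  have hlogη : Real.log (1 - δ / 4) < 0 := Real.log_neg hη (by linarith)
  set γ : ℝ := min (1 / 2) (min (β / (2 * (q - 1))) (Real.log (1 - δ / 4) / Real.log σ)) with hγ
  have hq1 : 0 < q - 1 := by linarith
  refine ⟨σ, γ, hσ0, hσ8, ?_, (min_le_left _ _).trans_lt (by norm_num), ?_, ?_, ?_⟩
  · exact lt_min (by norm_num) (lt_min (by positivity) (div_pos_of_neg_of_neg hlogη hlogσ))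
  · have h : γ ≤ β / (2 * (q - 1)) := (min_le_right _ _).trans (min_le_left _ _)
    rw [le_div_iff₀ (by positivity)] at h
    linarith
  · have h : γ ≤ Real.log (1 - δ / 4) / Real.log σ := (min_le_right _ _).trans (min_le_right _ _)
    rw [le_div_iff_of_neg hlogσ] at h
    calc 1 - δ / 4 = Real.exp (Real.log (1 - δ / 4)) := (Real.exp_log hη).symm
      _ ≤ Real.exp (γ * Real.log σ) := Real.exp_le_exp.2 h
      _ = σ ^ γ := by rw [Real.rpow_def_of_pos hσ0, mul_comm]
  · have h1 : 4 * σ ≤ (δ ^ (q - 1) / (2 * C)) ^ (1 / β) := by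
      have : σ ≤ (δ ^ (q - 1) / (2 * C)) ^ (1 / β) / 4 := min_le_right _ _
      linarith
    have h2 : (4 * σ) ^ β ≤ δ ^ (q - 1) / (2 * C) := by
      calc (4 * σ) ^ β ≤ ((δ ^ (q - 1) / (2 * C)) ^ (1 / β)) ^ β :=
            Real.rpow_le_rpow (by positivity) h1 hβ.le
        _ = _ := by
            rw [← Real.rpow_mul (by positivity), one_div_mul_cancel hβ.ne', Real.rpow_one]
    rw [le_div_iff₀ (by positivity)] at h2
    rw [Real.rpow_neg (by positivity), ← div_eq_mul_inv, le_div_iff₀ (by positivity)]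
    linarith

/-- Reducing the radius by the factor `l` compensates the loss from reducing the height by `δ`. -/
lemma flux_rescale_le (he : Exponents n s t p q Λ A α L) {a₀ R l δ ω : ℝ}
    (ha : 0 ≤ a₀) (hR : 0 < R) (hl : 0 < l) (hl1 : l ≤ 1) (hδ : 0 < δ) (hδ1 : δ ≤ 1) (hω : 0 < ω) :
    δ ^ (q - 1) * l ^ (-(s * p)) * flux s t p q a₀ R ω ≤ flux s t p q a₀ (l * R) (δ * ω) := by
  have h1 := le_flux_scale (s := s) (t := t) (a₀ := a₀) he.p_le (by positivity : 0 ≤ l * R) hω.le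
    hδ hδ1
  refine le_trans ?_ h1
  have h2 : l ^ (-(s * p)) ≤ l ^ (-(t * q)) :=
    Real.rpow_le_rpow_of_exponent_ge hl hl1 (by linarith [he.sp_le_tq])
  rw [mul_assoc]
  refine mul_le_mul_of_nonneg_left ?_ (by positivity)
  unfold flux
  rw [Real.mul_rpow hl.le hR.le, Real.mul_rpow hl.le hR.le]
  calc _ = ω ^ (p - 1) * (l ^ (-(s * p)) * R ^ (-(s * p))) +
        a₀ * (ω ^ (q - 1) * (l ^ (-(s * p)) * R ^ (-(t * q)))) := by ring
    _ ≤ _ := by gcongr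

/-- Along the iteration the flux `(δ ω_j)^{p-1} r_j^{-sp}` does not fall below its initial size. -/
lemma scaled_flux_mono {s p q σ γ δ M R₀ : ℝ} (hsp : 0 < s * p) (hpq : p ≤ q)
    (hσ0 : 0 < σ) (hσ8 : σ ≤ 1 / 8) (hδ0 : 0 < δ) (hM : 0 < M) (hR₀0 : 0 < R₀) (hγ0 : 0 < γ)
    (hγq : γ * (q - 1) ≤ s * p / 2) (j : ℕ) :
    (2 * δ * M) ^ (p - 1) * R₀ ^ (-(s * p)) ≤
      (δ * (2 * M * (σ ^ γ) ^ j)) ^ (p - 1) * (4 * σ * (σ ^ j * R₀)) ^ (-(s * p)) := by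
  have hσpow : σ ^ j ≤ 1 := pow_le_one₀ hσ0.le (by linarith)
  have e1 : δ * (2 * M * (σ ^ γ) ^ j) = 2 * δ * M * (σ ^ γ) ^ j := by ring
  have e2 : ((σ ^ γ) ^ j) ^ (p - 1) = (σ ^ j) ^ (γ * (p - 1)) := by
    rw [Real.rpow_pow_comm hσ0.le, ← Real.rpow_mul (by positivity)]
  rw [e1, Real.mul_rpow (x := 2 * δ * M) (by positivity) (by positivity), e2,
    Real.mul_rpow (x := 4 * σ) (by positivity) (by positivity),
    Real.mul_rpow (x := σ ^ j) (by positivity) (by positivity)]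
  have i1 : 1 ≤ (4 * σ) ^ (-(s * p)) :=
    Real.one_le_rpow_of_pos_of_le_one_of_nonpos (by positivity) (by linarith) (by linarith)
  have i2 : 1 ≤ (σ ^ j) ^ (γ * (p - 1)) * (σ ^ j) ^ (-(s * p)) := by
    rw [← Real.rpow_add (by positivity)]
    refine Real.one_le_rpow_of_pos_of_le_one_of_nonpos (by positivity) hσpow ?_
    nlinarith
  have i3 : 1 ≤ (4 * σ) ^ (-(s * p)) * ((σ ^ j) ^ (γ * (p - 1)) * (σ ^ j) ^ (-(s * p))) :=
    one_le_mul_of_one_le_of_one_le i1 i2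
  calc _ = (2 * δ * M) ^ (p - 1) * R₀ ^ (-(s * p)) * 1 := (mul_one _).symm
    _ ≤ (2 * δ * M) ^ (p - 1) * R₀ ^ (-(s * p)) * ((4 * σ) ^ (-(s * p)) *
      ((σ ^ j) ^ (γ * (p - 1)) * (σ ^ j) ^ (-(s * p)))) := by gcongr
    _ = _ := by ring

/-- Growth of the weight `(|y - x₀| / R)^γ` over the shells between consecutive balls. -/
lemma shell_weight_le {σ γ M R₀ : ℝ} (hσ0 : 0 < σ) (hγ0 : 0 < γ) (hM : 0 < M) (hR₀ : 0 < R₀)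
    {d : ℝ} {l j : ℕ} (hd : σ ^ l * R₀ ≤ d) :
    4 * M * (σ ^ γ) ^ l ≤ 2 * (2 * M * (σ ^ γ) ^ j) * (d / (σ ^ j * R₀)) ^ γ := by
  have h1 : σ ^ l / σ ^ j ≤ d / (σ ^ j * R₀) := by
    rw [div_le_div_iff₀ (by positivity) (by positivity)]
    calc σ ^ l * (σ ^ j * R₀) = (σ ^ l * R₀) * σ ^ j := by ring
      _ ≤ d * σ ^ j := by gcongr
  have h2 : (σ ^ γ) ^ l / (σ ^ γ) ^ j ≤ (d / (σ ^ j * R₀)) ^ γ := by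
    calc (σ ^ γ) ^ l / (σ ^ γ) ^ j = (σ ^ l / σ ^ j) ^ γ := by
          rw [Real.div_rpow (by positivity) (by positivity), Real.rpow_pow_comm hσ0.le,
            Real.rpow_pow_comm hσ0.le]
      _ ≤ _ := Real.rpow_le_rpow (by positivity) h1 hγ0.le
  have hη : 0 < σ ^ γ := by positivity
  calc 4 * M * (σ ^ γ) ^ l = 2 * (2 * M * (σ ^ γ) ^ j) * ((σ ^ γ) ^ l / (σ ^ γ) ^ j) := by
        field_simp; ring
    _ ≤ _ := by gcongr

lemma measure_ball_le_add_of_alternative (u : E n → ℝ) (x₀ : E n) (ρ m ω : ℝ) :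
    volume.real (Metric.ball x₀ ρ) ≤
      volume.real ({x | ω / 2 ≤ u x + -m} ∩ Metric.ball x₀ ρ) +
      volume.real ({x | ω / 2 ≤ -u x + (m + ω)} ∩ Metric.ball x₀ ρ) := by
  refine le_trans (measureReal_mono (s₂ := ({x | ω / 2 ≤ u x + -m} ∩ Metric.ball x₀ ρ) ∪
    ({x | ω / 2 ≤ -u x + (m + ω)} ∩ Metric.ball x₀ ρ)) ?_ ?_)
    (measureReal_union_le _ _)
  · intro y hy
    rcases le_total (ω / 2) (u y + -m) with h | h
    · exact Or.inl ⟨h, hy⟩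
    · exact Or.inr ⟨by change ω / 2 ≤ -u y + (m + ω); linarith, hy⟩
  · exact measure_ne_top_of_subset (union_subset inter_subset_right inter_subset_right)
      (measure_ball_lt_top (x := x₀) (r := ρ)).ne

/-- Geometric decay of the essential oscillation over concentric balls. The ratio and the exponent
depend only on the structural constants and on the bound `M`; the tail of `u` enters through the
initial radius only. -/
theorem oscillation_decay (he : Exponents n s t p q Λ A α L) {M : ℝ} (hM : 0 < M) :
    ∃ σ γ : ℝ, 0 < σ ∧ σ ≤ 1 / 8 ∧ 0 < γ ∧ γ < 1 ∧
      ∀ a Ksp Ktq : E n → E n → ℝ, IsOperator s t p q Λ A α L a Ksp Ktq →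
      ∀ (Ω : Set (E n)) (u : E n → ℝ), Bornology.IsBounded Ω → Measurable u →
      IsWeakSolution s t p q a Ksp Ktq Ω u → MemTail s p q u →
      ∀ ρ B : ℝ, 0 < ρ → ρ ≤ 1 → 0 ≤ B →
      ∃ R₀ : ℝ, 0 < R₀ ∧ R₀ ≤ ρ ∧ ∀ x₀ : E n, ‖x₀‖ ≤ B → Metric.ball x₀ ρ ⊆ Ω →
        (∀ᵐ y, y ∈ Metric.ball x₀ ρ → |u y| ≤ M) →
        ∀ j : ℕ, ∃ m : ℝ, ∀ᵐ y, y ∈ Metric.ball x₀ (σ ^ j * R₀) →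
          m ≤ u y ∧ u y ≤ m + 2 * M * (σ ^ γ) ^ j := by
  obtain ⟨δ, hδ0, hδ1, hgrowth⟩ := growth he (M := 2 * M) (by positivity)
  obtain ⟨C, hC0, hC⟩ := lintegral_near_tail_le he (M := 2 * M) (by positivity)
  have hsp := he.sp_pos
  have hp1 := he.one_lt_p
  have hpq := he.p_le
  obtain ⟨σ, γ, hσ0, hσ8, hγ0, hγ1, hγq, hη, hσC⟩ :=
    exists_ratio_exponent hsp hp1 hpq hδ0 hδ1 hC0
  set η := σ ^ γ with hηdef
  have hη0 : 0 < η := by positivity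
  have hη1 : η < 1 := Real.rpow_lt_one hσ0.le (by linarith) hγ0
  refine ⟨σ, γ, hσ0, hσ8, hγ0, hγ1, ?_⟩
  intro a Ksp Ktq ho Ω u hΩ hum hsol htail ρ B hρ hρ1 hB
  obtain ⟨T, hT0, hT⟩ := lintegral_far_tail_le he ho htail (N := 5 * M) hρ hB (by positivity)
  -- the initial radius makes the far tail negligible
  set R₀ : ℝ := min (ρ / 2) (((2 * δ * M) ^ (p - 1) / (2 * T)) ^ (1 / (s * p))) with hR₀
  have hR₀0 : 0 < R₀ := lt_min (by positivity) (by positivity)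
  have hR₀ρ : R₀ ≤ ρ / 2 := min_le_left _ _
  have hR₀T : 2 * T ≤ (2 * δ * M) ^ (p - 1) * R₀ ^ (-(s * p)) := by
    have h1 : R₀ ^ (s * p) ≤ (2 * δ * M) ^ (p - 1) / (2 * T) := by
      calc R₀ ^ (s * p) ≤ (((2 * δ * M) ^ (p - 1) / (2 * T)) ^ (1 / (s * p))) ^ (s * p) :=
            Real.rpow_le_rpow hR₀0.le (min_le_right _ _) hsp.le
        _ = _ := by
            rw [← Real.rpow_mul (by positivity), one_div_mul_cancel hsp.ne', Real.rpow_one]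
    rw [le_div_iff₀ (by positivity)] at h1
    rw [Real.rpow_neg hR₀0.le, ← div_eq_mul_inv, le_div_iff₀ (by positivity)]
    linarith
  refine ⟨R₀, hR₀0, by linarith, ?_⟩
  intro x₀ hx₀ hball hbdd
  have ha0 := ho.coeff.nonneg x₀ x₀
  intro j
  induction j using Nat.strong_induction_on with
  | _ j ih =>
  cases j with
  | zero =>
    refine ⟨-M, ?_⟩
    filter_upwards [hbdd] with y hy hyR
    have h := abs_le.1 (hy (Metric.ball_subset_ball (by rw [pow_zero, one_mul]; linarith) hyR))
    rw [pow_zero, mul_one]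
    exact ⟨h.1, by linarith [h.2]⟩
  | succ j =>
  have ih' : ∀ i, ∃ m : ℝ, i ≤ j → ∀ᵐ y, y ∈ Metric.ball x₀ (σ ^ i * R₀) →
      m ≤ u y ∧ u y ≤ m + 2 * M * η ^ i := fun i => by
    by_cases hi : i ≤ j
    · obtain ⟨m, hm⟩ := ih i (by omega)
      exact ⟨m, fun _ => hm⟩
    · exact ⟨0, fun h => absurd h hi⟩
  choose m hm using ih'
  have hall : ∀ᵐ y, (y ∈ Metric.ball x₀ ρ → |u y| ≤ M) ∧ ∀ i, i ≤ j →
      y ∈ Metric.ball x₀ (σ ^ i * R₀) → m i ≤ u y ∧ u y ≤ m i + 2 * M * η ^ i := by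
    refine hbdd.and (ae_all_iff.2 fun i => ?_)
    by_cases hi : i ≤ j
    · filter_upwards [hm i hi] with y hy _ using hy
    · exact Filter.Eventually.of_forall fun y h => absurd h hi
  set R := σ ^ j * R₀ with hR
  have hR0 : 0 < R := by positivity
  have hσpow : ∀ i, σ ^ i ≤ 1 := fun i => pow_le_one₀ hσ0.le (by linarith)
  have hηpow : ∀ i, η ^ i ≤ 1 := fun i => pow_le_one₀ hη0.le hη1.le
  have hRρ : R ≤ ρ / 2 := by nlinarith [hσpow j]
  set ω := 2 * M * η ^ j with hω
  have hω0 : 0 < ω := by positivity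
  have hωM : ω ≤ 2 * M := by nlinarith [hηpow j]
  set r := 4 * σ * R with hr
  have hr0 : 0 < r := by positivity
  have hrR : 2 * r ≤ R := by nlinarith
  have hr4 : r / 4 = σ ^ (j + 1) * R₀ := by rw [hr, hR, pow_succ]; ring
  have hRsub : Metric.ball x₀ R ⊆ Metric.ball x₀ ρ := Metric.ball_subset_ball (by linarith)
  have hRmono : ∀ i, i ≤ j → Metric.ball x₀ R ⊆ Metric.ball x₀ (σ ^ i * R₀) := fun i hi =>
    Metric.ball_subset_ball (by
      rw [hR]; gcongr ?_ * R₀; exact pow_le_pow_of_le_one hσ0.le (by linarith) hi)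
  -- a point of the smallest ball at which all the bounds hold, to compare the intervals
  obtain ⟨z, hzR, hz⟩ : ∃ z ∈ Metric.ball x₀ R, (z ∈ Metric.ball x₀ ρ → |u z| ≤ M) ∧
      ∀ i, i ≤ j → z ∈ Metric.ball x₀ (σ ^ i * R₀) →
        m i ≤ u z ∧ u z ≤ m i + 2 * M * η ^ i := by
    by_contra h
    push Not at h
    have h0 : volume (Metric.ball x₀ R) = 0 := by
      rw [measure_eq_zero_iff_ae_notMem]
      filter_upwards [hall] with y hy hyR
      obtain ⟨i, hi, hi2, hi3⟩ := h y hyR hy.1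
      exact absurd (hy.2 i hi hi2).2 (not_le.2 (hi3 (hy.2 i hi hi2).1))
    exact (Metric.measure_ball_pos volume x₀ hR0).ne' h0
  have hzM := abs_le.1 (hz.1 (hRsub hzR))
  have hzi : ∀ i, i ≤ j → m i ≤ u z ∧ u z ≤ m i + 2 * M * η ^ i := fun i hi =>
    hz.2 i hi (hRmono i hi hzR)
  have hzj := hzi j le_rfl
  rw [← hω] at hzj
  have hweight : ∀ (y : E n) (l : ℕ), σ ^ l * R₀ ≤ ‖y - x₀‖ →
      4 * M * η ^ l ≤ 2 * ω * (‖y - x₀‖ / R) ^ γ := fun y l hy =>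
    shell_weight_le hσ0 hγ0 hM hR₀0 hy
  -- the growth lemma at the radius `r`, for either of the two functions measuring the distance of
  -- `u` to the ends of its range; the near tail is the one on `B_ρ(x₀) \ B_R(x₀)`
  have step : ∀ U : E n → ℝ, Measurable U → IsWeakSolution s t p q a Ksp Ktq Ω U →
      (∀ᵐ y, y ∈ Metric.ball x₀ R → 0 ≤ U y) →
      (∀ᵐ y, (y ∈ Metric.ball x₀ ρ → -U y ≤ 2 * M) ∧
        ∀ i, i ≤ j → y ∈ Metric.ball x₀ (σ ^ i * R₀) → -U y ≤ 2 * M * η ^ i) →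
      (∀ y, -U y ≤ |u y| + 5 * M) →
      volume.real (Metric.ball x₀ (r / 2)) ≤
        2 * volume.real ({x | ω / 2 ≤ U x} ∩ Metric.ball x₀ (r / 2)) →
      ∀ᵐ y, y ∈ Metric.ball x₀ (σ ^ (j + 1) * R₀) → δ * ω / 4 ≤ U y := by
    intro U hUm hUsol hU0 hUnear hUfar hhalf
    have hTail : TailBound s t p q a x₀ r R (δ * ω) U := by
      intro x hx
      set S := Metric.ball x₀ ρ \ Metric.ball x₀ R with hS
      have hcover : (Metric.ball x₀ R)ᶜ ⊆ S ∪ (Metric.ball x₀ ρ)ᶜ := by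
        intro y hy
        by_cases hyρ : y ∈ Metric.ball x₀ ρ
        · exact Or.inl ⟨hyρ, hy⟩
        · exact Or.inr hyρ
      have hnear := hC a Ksp Ktq ho x₀ r R ω γ U S hr0 hrR hω0 hωM hγ0 hγq
        (measurableSet_ball.diff measurableSet_ball) (fun y hy => hy.2) (by
          filter_upwards [hUnear] with y hy hyS
          refine max_le ?_ (by positivity)
          rcases exists_shell (P := fun i => y ∈ Metric.ball x₀ (σ ^ i * R₀)) hyS.2 with h | h
          · simp only [Metric.mem_ball, dist_eq_norm, not_lt] at h
            have := hweight y 0 h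
            rw [pow_zero] at this
            linarith [hy.1 hyS.1]
          · obtain ⟨i, hij, hi1, hi2⟩ := h
            simp only [Metric.mem_ball, dist_eq_norm, not_lt] at hi2
            have h1 := hweight y (i + 1) hi2
            have h2 := hy.2 i hij.le hi1
            have h3 : 2 * M * η ^ i ≤ 4 * M * η ^ (i + 1) := by
              -- `η ≥ 1 - δ / 4 ≥ 1 / 2`
              have : 1 ≤ 2 * η := by linarith
              calc 2 * M * η ^ i = 2 * M * η ^ i * 1 := (mul_one _).symm
                _ ≤ 2 * M * η ^ i * (2 * η) := by gcongr
                _ = _ := by rw [pow_succ]; ring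
            linarith) x hx
      have hfar := hT x₀ hx₀ x (Metric.ball_subset_ball (by linarith) hx) U
        (fun y => max_le (hUfar y) (by positivity))
      have hfR := flux_nonneg (s := s) (t := t) (p := p) (q := q) ha0 hR0.le hω0.le
      have hresc := flux_rescale_le he ha0 hR0 (by positivity : 0 < 4 * σ) (by linarith) hδ0
        (by linarith) hω0
      rw [← hr] at hresc
      have hhalf1 : C * flux s t p q (a x₀ x₀) R ω ≤ flux s t p q (a x₀ x₀) r (δ * ω) / 2 := by
        have := mul_le_mul_of_nonneg_right hσC hfR
        linarith
      have hhalf2 : T ≤ flux s t p q (a x₀ x₀) r (δ * ω) / 2 := by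
        have h1 : (2 * δ * M) ^ (p - 1) * R₀ ^ (-(s * p)) ≤
            (δ * ω) ^ (p - 1) * r ^ (-(s * p)) :=
          scaled_flux_mono hsp hpq hσ0 hσ8 hδ0 hM hR₀0 hγ0 hγq j
        have h2 : (δ * ω) ^ (p - 1) * r ^ (-(s * p)) ≤ flux s t p q (a x₀ x₀) r (δ * ω) := by
          unfold flux
          have : 0 ≤ a x₀ x₀ * ((δ * ω) ^ (q - 1) * r ^ (-(t * q))) := by positivity
          linarith
        linarith
      calc _ ≤ ∫⁻ y in S ∪ (Metric.ball x₀ ρ)ᶜ, ENNReal.ofReal (tailDensity s t p q a U x y) :=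
            lintegral_mono_set hcover
        _ ≤ _ := lintegral_union_le _ _ _
        _ ≤ ENNReal.ofReal (flux s t p q (a x₀ x₀) r (δ * ω) / 2) +
            ENNReal.ofReal (flux s t p q (a x₀ x₀) r (δ * ω) / 2) :=
            add_le_add (hnear.trans (ENNReal.ofReal_le_ofReal hhalf1))
              (hfar.trans (ENNReal.ofReal_le_ofReal hhalf2))
        _ = _ := by
            rw [← ENNReal.ofReal_add (by linarith) (by linarith), add_halves]
    have := hgrowth a Ksp Ktq ho Ω U hΩ hUm hUsol x₀ r R ω hr0 (by linarith) hrR hω0 hωM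
      (hRsub.trans hball) hU0 hTail hhalf
    rwa [hr4] at this
  have hB2 := measure_ball_le_add_of_alternative u x₀ (r / 2) (m j) ω
  have hωη : ω - 2 * M * η ^ (j + 1) ≤ δ * ω / 4 := by
    have e : 2 * M * η ^ (j + 1) = ω * η := by rw [hω, pow_succ]; ring
    rw [e]
    nlinarith
  have hsub : Metric.ball x₀ (σ ^ (j + 1) * R₀) ⊆ Metric.ball x₀ R :=
    Metric.ball_subset_ball (by rw [← hr4]; linarith)
  -- in the first case the lower end of the range of `u` is raised, in the second the upper one
  -- lowered
  rcases le_total (volume.real ({x | ω / 2 ≤ -u x + (m j + ω)} ∩ Metric.ball x₀ (r / 2)))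
    (volume.real ({x | ω / 2 ≤ u x + -m j} ∩ Metric.ball x₀ (r / 2))) with hcase | hcase
  · have h := step (fun y => u y + -m j) (hum.add_const _) (hsol.add_const hΩ _)
      (by filter_upwards [hm j le_rfl] with y hy hyR; linarith [(hy hyR).1])
      (by
        filter_upwards [hall] with y hy
        refine ⟨fun hyρ => ?_, fun i hi hyi => ?_⟩
        · linarith [(abs_le.1 (hy.1 hyρ)).1]
        · linarith [(hy.2 i hi hyi).1, (hzi i hi).2])
      (fun y => by linarith [neg_abs_le (u y)]) (by linarith)
    refine ⟨m j + ω - 2 * M * η ^ (j + 1), ?_⟩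
    filter_upwards [h, hm j le_rfl] with y hy hyj hyR
    have h1 := hy hyR
    have h2 := hyj (hsub hyR)
    rw [← hω] at h2
    exact ⟨by linarith, by linarith [h2.2]⟩
  · have h := step (fun y => -u y + (m j + ω)) (hum.neg.add_const _) (hsol.neg.add_const hΩ _)
      (by
        filter_upwards [hm j le_rfl] with y hy hyR
        have := (hy hyR).2
        rw [← hω] at this
        linarith)
      (by
        filter_upwards [hall] with y hy
        refine ⟨fun hyρ => ?_, fun i hi hyi => ?_⟩
        · linarith [(abs_le.1 (hy.1 hyρ)).2]
        · linarith [(hy.2 i hi hyi).2, (hzi i hi).1])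
      (fun y => by linarith [le_abs_self (u y)]) (by linarith)
    refine ⟨m j, ?_⟩
    filter_upwards [h, hm j le_rfl] with y hy hyj hyR
    have h1 := hy hyR
    have h2 := hyj (hsub hyR)
    exact ⟨h2.1, by linarith⟩

/-! ### The precise representative -/

/-- The precise representative of `f`: the upper limit of the averages of `f` over the balls of
radii `1 / (k + 1)`. The upper limit makes it defined at every point, and it is the limit at the
Lebesgue points. -/
noncomputable def preciseRep (f : E n → ℝ) (x : E n) : ℝ :=
  Filter.limsup (fun k : ℕ => ⨍ y in Metric.closedBall x (1 / ((k : ℝ) + 1)), f y) Filter.atTop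

lemma preciseRep_ae_eq {f : E n → ℝ} (hf : LocallyIntegrable f volume) :
    preciseRep f =ᵐ[volume] f := by
  filter_upwards [IsUnifLocDoublingMeasure.ae_tendsto_average volume hf 1] with x hx
  refine (hx (l := Filter.atTop) (fun _ : ℕ => x) (fun k : ℕ => 1 / ((k : ℝ) + 1)) ?_ ?_).limsup_eq
  · refine tendsto_nhdsWithin_iff.2 ⟨tendsto_one_div_add_atTop_nhds_zero_nat, ?_⟩
    exact Filter.Eventually.of_forall fun k => mem_Ioi.2 (by positivity)
  · exact Filter.Eventually.of_forall fun k => Metric.mem_closedBall_self (by positivity)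

lemma preciseRep_mem_Icc {f : E n → ℝ} (hf : LocallyIntegrable f volume) {U : Set (E n)}
    (hU : IsOpen U) {x : E n} (hx : x ∈ U) {m m' : ℝ} (h : ∀ᵐ y, y ∈ U → f y ∈ Icc m m') :
    preciseRep f x ∈ Icc m m' := by
  obtain ⟨ε, hε, hεU⟩ := Metric.isOpen_iff.1 hU x hx
  have hsmall : ∀ᶠ k : ℕ in Filter.atTop, 1 / ((k : ℝ) + 1) < ε :=
    tendsto_one_div_add_atTop_nhds_zero_nat.eventually_lt_const hε
  have hmem : ∀ᶠ k : ℕ in Filter.atTop,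
      ⨍ y in Metric.closedBall x (1 / ((k : ℝ) + 1)), f y ∈ Icc m m' := by
    filter_upwards [hsmall] with k hk
    have hk0 : 0 < 1 / ((k : ℝ) + 1) := by positivity
    refine (convex_Icc m m').set_average_mem isClosed_Icc
      (Metric.measure_closedBall_pos volume x hk0).ne' measure_closedBall_lt_top.ne ?_
      (hf.integrableOn_isCompact (isCompact_closedBall _ _))
    rw [ae_restrict_iff' Metric.isClosed_closedBall.measurableSet]
    filter_upwards [h] with y hy hyx
    exact hy (hεU (Metric.closedBall_subset_ball hk hyx))
  have hbdd : Filter.IsBoundedUnder (· ≤ ·) Filter.atTop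
      (fun k : ℕ => ⨍ y in Metric.closedBall x (1 / ((k : ℝ) + 1)), f y) :=
    ⟨m', Filter.eventually_map.2 (hmem.mono fun k hk => hk.2)⟩
  have hcobdd : Filter.IsCoboundedUnder (· ≤ ·) Filter.atTop
      (fun k : ℕ => ⨍ y in Metric.closedBall x (1 / ((k : ℝ) + 1)), f y) :=
    Filter.IsBoundedUnder.isCoboundedUnder_le
      ⟨m, Filter.eventually_map.2 (hmem.mono fun k hk => hk.1)⟩
  exact ⟨Filter.le_limsup_of_frequently_le (hmem.mono fun k hk => hk.1).frequently hbdd,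
    Filter.limsup_le_of_le hcobdd (hmem.mono fun k hk => hk.2)⟩

lemma locallyIntegrable_indicator {Ω : Set (E n)} (hΩ : IsOpen Ω) (hb : Bornology.IsBounded Ω)
    (hp : 1 < p) {u : E n → ℝ} (hu : MemLp u (ENNReal.ofReal p) (volume.restrict Ω)) :
    LocallyIntegrable (Ω.indicator u) volume := by
  have : IsFiniteMeasure (volume.restrict Ω) :=
    isFiniteMeasure_restrict.2 hb.measure_lt_top.ne
  have h : IntegrableOn u Ω volume :=
    hu.integrable (by rw [← ENNReal.ofReal_one]; exact ENNReal.ofReal_le_ofReal hp.le)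
  exact (h.integrable_indicator hΩ.measurableSet).locallyIntegrable

/-! ### From decay of the oscillation to Hölder continuity -/

/-- Decay of the oscillation over balls of radii `σ^j R₀`, uniform in the centre, is Hölder
continuity. Pairs at distance at least `R₀` are handled by the bound of `v`. -/
lemma holderOnWith_of_oscillation {K : Set (E n)} {v : E n → ℝ} {σ R₀ M : ℝ} {γ : ℝ≥0}
    (hσ : 0 < σ) (hσ1 : σ < 1) (hR : 0 < R₀) (hM : ∀ x ∈ K, |v x| ≤ M)
    (hosc : ∀ x ∈ K, ∀ j : ℕ, ∃ m, ∀ y ∈ Metric.ball x (σ ^ j * R₀),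
      m ≤ v y ∧ v y ≤ m + 2 * M * (σ ^ (γ : ℝ)) ^ j) :
    ∃ C : ℝ≥0, HolderOnWith C γ v K := by
  have key : ∀ x ∈ K, ∀ y ∈ K,
      dist (v x) (v y) ≤ 2 * M * (1 / (σ * R₀)) ^ (γ : ℝ) * dist x y ^ (γ : ℝ) := by
    intro x hx y hy
    have hM0 : 0 ≤ M := (abs_nonneg _).trans (hM x hx)
    rw [mul_assoc, ← Real.mul_rpow (by positivity) dist_nonneg]
    rcases (dist_nonneg (x := x) (y := y)).eq_or_lt with h0 | h0
    · rw [dist_eq_zero.1 h0.symm, dist_self]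
      positivity
    rcases le_or_gt R₀ (dist x y) with hfar | hnear
    · have h1 : 1 ≤ (1 / (σ * R₀) * dist x y) ^ (γ : ℝ) := by
        refine Real.one_le_rpow ?_ γ.2
        rw [one_div_mul_eq_div, one_le_div (by positivity)]
        nlinarith
      have h2 : dist (v x) (v y) ≤ 2 * M := by
        rw [Real.dist_eq]
        have := abs_sub (v x) (v y)
        linarith [hM x hx, hM y hy]
      nlinarith
    · obtain ⟨i, hi1, hi2⟩ : ∃ i : ℕ, dist x y < σ ^ i * R₀ ∧ σ ^ (i + 1) * R₀ ≤ dist x y := by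
        have hex : ∃ i : ℕ, σ ^ i * R₀ ≤ dist x y := by
          obtain ⟨i, hi⟩ := exists_pow_lt_of_lt_one (div_pos h0 hR) hσ1
          exact ⟨i, ((lt_div_iff₀ hR).1 hi).le⟩
        obtain ⟨i, hi⟩ : ∃ i, Nat.find hex = i + 1 :=
          Nat.exists_eq_succ_of_ne_zero fun h => by
            have := Nat.find_spec hex
            rw [h, pow_zero, one_mul] at this
            linarith
        exact ⟨i, not_le.1 (Nat.find_min hex (by omega)), hi ▸ Nat.find_spec hex⟩
      obtain ⟨m, hm⟩ := hosc x hx i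
      have hxm := hm x (Metric.mem_ball_self (by positivity))
      have hym := hm y (by rwa [Metric.mem_ball, dist_comm])
      have h1 : (σ ^ (γ : ℝ)) ^ i ≤ (1 / (σ * R₀) * dist x y) ^ (γ : ℝ) := by
        rw [← Real.rpow_natCast, ← Real.rpow_mul hσ.le, mul_comm, Real.rpow_mul hσ.le,
          Real.rpow_natCast]
        refine Real.rpow_le_rpow (by positivity) ?_ γ.2
        rw [one_div_mul_eq_div, le_div_iff₀ (by positivity)]
        rw [pow_succ] at hi2
        linarith
      calc dist (v x) (v y) ≤ 2 * M * (σ ^ (γ : ℝ)) ^ i := by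
            rw [Real.dist_eq, abs_le]
            constructor <;> linarith [hxm.1, hxm.2, hym.1, hym.2]
        _ ≤ _ := by gcongr
  rcases K.eq_empty_or_nonempty with rfl | ⟨x₀, hx₀⟩
  · exact ⟨0, fun x hx => hx.elim⟩
  have hM0 : 0 ≤ M := (abs_nonneg _).trans (hM x₀ hx₀)
  refine ⟨⟨2 * M * (1 / (σ * R₀)) ^ (γ : ℝ), by positivity⟩, fun x hx y hy => ?_⟩
  have h := ENNReal.ofReal_le_ofReal (key x hx y hy)
  rw [ENNReal.ofReal_mul (by positivity), ← ENNReal.ofReal_rpow_of_nonneg dist_nonneg γ.coe_nonneg,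
    ← edist_dist, ← edist_dist] at h
  refine h.trans (le_of_eq ?_)
  congr 1
  exact ENNReal.ofReal_eq_coe_nnreal _

lemma MemTail.congr_ae {u v : E n → ℝ} (hu : MemTail s p q u) (h : u =ᵐ[volume] v) :
    MemTail s p q v where
  aemeasurable := hu.aemeasurable.congr h
  tail_lt_top := by
    refine lt_of_eq_of_lt (lintegral_congr_ae ?_) hu.tail_lt_top
    filter_upwards [h] with x hx
    rw [hx]

lemma ae_abs_le_of_eLpNorm_le {U : Set (E n)} (hU : MeasurableSet U) {u : E n → ℝ} {M : ℝ≥0}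
    (h : eLpNorm u ∞ (volume.restrict U) ≤ M) : ∀ᵐ y, y ∈ U → |u y| ≤ M := by
  rw [← ae_restrict_iff' hU]
  rw [eLpNorm_exponent_top] at h
  filter_upwards [enorm_ae_le_eLpNormEssSup u (volume.restrict U)] with y hy
  have := hy.trans h
  rw [← ofReal_norm, Real.norm_eq_abs, ← ENNReal.ofReal_coe_nnreal] at this
  exact (ENNReal.ofReal_le_ofReal_iff M.2).1 this

end DoublePhase


open DoublePhase in
theorem theorem1p2 (n : ℕ) (hn : 2 ≤ n) (s t p q Λ A α L : ℝ)
    (hs : 0 < s) (hst : s ≤ t) (ht : t < 1)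
    (hp : 1 < p) (hpq : p ≤ q) (hΛ : 1 < Λ) (hα : 0 < α)
    (hq : t * q ≤ s * p + α) :
    -- the exponent depends only on the data, `A`, `α`, `L` and a bound `M` of `‖u‖_{L^∞(Ω')}`
    ∃ γ : ℝ≥0 → ℝ≥0, (∀ M, 0 < γ M ∧ γ M < 1) ∧
      ∀ Ω : Set (DoublePhase.E n), IsOpen Ω → IsConnected Ω → Bornology.IsBounded Ω →
      ∀ a Ksp Ktq : DoublePhase.E n → DoublePhase.E n → ℝ,
        DoublePhase.IsKernel s p Λ Ksp → DoublePhase.IsKernel t q Λ Ktq →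
        DoublePhase.IsCoefficient A a → DoublePhase.IsHolderCoefficient α L a →
      ∀ u : DoublePhase.E n → ℝ,
        DoublePhase.IsWeakSolution s t p q a Ksp Ktq Ω u →
        DoublePhase.MemTail s p q u →
        DoublePhase.IsLocallyBounded Ω u →
      ∃ v : DoublePhase.E n → ℝ, v =ᵐ[volume.restrict Ω] u ∧
        DoublePhase.LocallyHolder Ω v ∧
        ∀ Ω' : Set (DoublePhase.E n), IsOpen Ω' → IsCompact (closure Ω') → closure Ω' ⊆ Ω →
          ∀ M : ℝ≥0, eLpNorm u ∞ (volume.restrict Ω') ≤ M →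
            DoublePhase.HolderLoc (γ M) Ω' v := by
  -- nothing is assumed on the signs of `A` and `L`, and `|A|`, `|L|` are bounds as well
  have he : Exponents n s t p q Λ |A| α |L| := ⟨by omega, hs, hst, ht, hp, hpq, by linarith, hα, hq,
    abs_nonneg A, abs_nonneg L⟩
  -- `M + 1` in place of `M`, since `M = 0` is allowed
  choose σ γ hσ0 hσ8 hγ0 hγ1 hosc using fun M : ℝ≥0 =>
    oscillation_decay he (M := (M : ℝ) + 1) (by positivity)
  refine ⟨fun M => ⟨γ M, (hγ0 M).le⟩, fun M => ⟨hγ0 M, hγ1 M⟩, ?_⟩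
  intro Ω hΩ _ hΩb a Ksp Ktq hKsp hKtq ha haα u hu htail hloc
  have ho : IsOperator s t p q Λ |A| α |L| a Ksp Ktq :=
    ⟨hKsp, hKtq,
      ⟨ha.aemeasurable, ha.symm, ha.nonneg, fun x y => (ha.le_bound x y).trans (le_abs_self A)⟩,
      fun x₁ y₁ x₂ y₂ => (haα x₁ y₁ x₂ y₂).trans
        (mul_le_mul_of_nonneg_right (le_abs_self L) (by positivity))⟩
  set u' := hu.memA.aemeasurable.mk u with hu'
  have huu' : u =ᵐ[volume] u' := hu.memA.aemeasurable.ae_eq_mk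
  have hu'm : Measurable u' := hu.memA.aemeasurable.measurable_mk
  have hint : LocallyIntegrable (Ω.indicator u) volume :=
    locallyIntegrable_indicator hΩ hΩb hp hu.memA.memLp
  have hmain : ∀ Ω' : Set (E n), IsOpen Ω' → closure Ω' ⊆ Ω →
      ∀ M : ℝ≥0, eLpNorm u ∞ (volume.restrict Ω') ≤ M →
        HolderLoc ⟨γ M, (hγ0 M).le⟩ Ω' (preciseRep (Ω.indicator u)) := by
    intro Ω' hΩ' hsub M hM K hK hKΩ'
    have hΩ'Ω : Ω' ⊆ Ω := subset_closure.trans hsub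
    have hae := ae_abs_le_of_eLpNorm_le hΩ'.measurableSet hM
    obtain ⟨ε, hε, hεK⟩ := hK.exists_thickening_subset_open hΩ' hKΩ'
    obtain ⟨B, hB⟩ := hK.isBounded.exists_norm_le
    obtain ⟨R₀, hR0, hRρ, hdecay⟩ := hosc M a Ksp Ktq ho Ω u' hΩb hu'm (hu.congr_ae huu')
      (htail.congr_ae huu') (min ε 1) (max B 0) (lt_min hε one_pos) (min_le_right _ _)
      (le_max_right _ _)
    have hball : ∀ x ∈ K, Metric.ball x (min ε 1) ⊆ Ω' := fun x hx =>
      (Metric.ball_subset_ball (min_le_left _ _)).trans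
        ((Metric.ball_subset_thickening hx ε).trans hεK)
    refine holderOnWith_of_oscillation (M := (M : ℝ) + 1) (hσ0 M) (by linarith [hσ8 M]) hR0 ?_ ?_
    · intro x hx
      have := preciseRep_mem_Icc hint hΩ' (hKΩ' hx) (m := -(M : ℝ)) (m' := M) (by
        filter_upwards [hae] with y hy hyΩ'
        rw [indicator_of_mem (hΩ'Ω hyΩ')]
        exact abs_le.1 (hy hyΩ'))
      exact (abs_le.2 this).trans (by linarith)
    · intro x hx j
      obtain ⟨m, hm⟩ := hdecay x ((hB x hx).trans (le_max_left _ _)) ((hball x hx).trans hΩ'Ω)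
        (by
          filter_upwards [hae, huu'] with y hy hyu hyx
          rw [← hyu]
          exact (hy (hball x hx hyx)).trans (by linarith)) j
      refine ⟨m, fun y hy => preciseRep_mem_Icc hint Metric.isOpen_ball hy ?_⟩
      have hpow : σ M ^ j * R₀ ≤ min ε 1 :=
        (mul_le_of_le_one_left hR0.le
          (pow_le_one₀ (hσ0 M).le (by linarith [hσ8 M]))).trans hRρ
      filter_upwards [hm, huu'] with z hz hzu hzx
      rw [indicator_of_mem (hΩ'Ω (hball x hx (Metric.ball_subset_ball hpow hzx))), hzu]
      exact hz hzx
  refine ⟨preciseRep (Ω.indicator u), ?_, ?_, fun Ω' hΩ' _ => hmain Ω' hΩ'⟩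
  · filter_upwards [ae_restrict_of_ae (preciseRep_ae_eq hint), ae_restrict_mem hΩ.measurableSet]
      with x hx hxΩ
    rw [hx, indicator_of_mem hxΩ]
  · intro K hK hKΩ
    obtain ⟨Ω', hΩ', hKΩ', hΩ'Ω, hcomp⟩ := exists_open_between_and_isCompact_closure hK hΩ hKΩ
    have hfin : eLpNorm u ∞ (volume.restrict Ω') < ∞ :=
      (eLpNorm_mono_measure u (Measure.restrict_mono_set volume subset_closure)).trans_lt
        (hloc _ hcomp hΩ'Ω)
    obtain ⟨M, hM⟩ := ENNReal.lt_iff_exists_coe.1 hfin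
    exact ⟨⟨γ M, (hγ0 M).le⟩, hγ0 M, hγ1 M, hmain Ω' hΩ' hΩ'Ω M hM.1.le K hK hKΩ'⟩
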